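/- Let $\mathcal L\subset\mathbb C$ be a period lattice (spanned over $\mathbb Z$ by two $\mathbb R$-linearly independent complex numbers), with Weierstrass functions $\wp,\zeta$. Let $m\ge 1$ be an integer and let $\omega\neq 0$ be a half-period, $2\omega\in\mathcal L$. Let $\eta$ be the constant with $\zeta(z+2\omega)=\zeta(z)+2\eta$, so that $\eta=\zeta(\omega)$ if $\omega\notin\mathcal L$. Call $z_0\in\mathbb C$ admissible if $\omega x+z_0\notin\mathcal L$ for all $x\in\mathbb R$; for such $z_0$ let $$L_{z_0}=-\frac{d^2}{dx^2}+m(m+1)\,\omega^2\,\wp(\omega x+z_0)$$ be the complex Lamé operator in $L^2(\mathbb R)$, with its maximal domain $H^2(\mathbb R)$. For $E\in\mathbb C$, call $k_1,\dots,k_m\in\mathbb C\setminus\mathcal L$ Hermite parameters for $E$ if the Lamé equation $-\psi''+m(m+1)\wp(z)\psi=E\psi$ has two solutions $\psi^+,\psi^-$, holomorphic on $\mathbb C\setminus\mathcal L$, such that $\psi^+\psi^-=X(\wp(z))$ with $X(\xi)=\prod_{j=1}^m(\xi-\wp(k_j))$ and, with $C=\psi^+(\psi^-)'-(\psi^+)'\psi^-$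 their (constant) Wronskian, the following holds. If $C\ne0$, then $X'(\wp(k_j))\,\wp'(k_j)=C$ for all $j$ (this fixes the signs of the $k_j$). If $C=0$ (the exceptional case of Lamé functions), then there is a permutation $\tau$ of $\{1,\dots,m\}$ with $k_j+k_{\tau(j)}\in\mathcal L$ for all $j$. Then: 1. The spectrum of $L_{z_0}$ is the same for all admissible $z_0$. 2. For every $E\in\mathbb C$, Hermite parameters for $E$ exist. 3. For every admissible $z_0$ and every $\lambda\in\mathbb C$, and for every choice of Hermite parameters $k_1,\dots,k_m$ for $E=\lambda/\omega^2$, $$\lambda\in\operatorname{spec}(L_{z_0})\iff \operatorname{Re} f_m=0,\qquad f_m=\eta\sum_{j=1}^m k_j-\omega\sum_{j=1}^m\zeta(k_j).$$ -/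

import Mathlib

open MeasureTheory

namespace Lame

noncomputable section

/-! ### Weierstrass functions -/

/-- The Weierstrass `ζ`-function of the period lattice of `L`,
`ζ(z) = 1/z + ∑_{l ≠ 0} (1/(z - l) + 1/l + z/l²)`.
The summand at `l = 0` is `1/z`, because `1 / 0 = 0` in Lean. -/
def weierstrassZeta (L : PeriodPair) (z : ℂ) : ℂ :=
  ∑' l : L.lattice, (1 / (z - (l : ℂ)) + 1 / (l : ℂ) + z / (l : ℂ) ^ 2)

open scoped Classical in
/-- The constant `η = ζ(ω)` attached to a half-period `ω`, i.e. `2 * ω` is a period and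
`ζ(z + 2ω) = ζ(z) + 2η`. If `ω` is itself a period then `ζ` has a pole at `ω`, and `η` is read off
from the quasi-periodicity at the base point `ω₁ / 2`, which is never a lattice point. -/
def eta (L : PeriodPair) (ω : ℂ) : ℂ :=
  if ω ∈ L.lattice then
    (weierstrassZeta L (L.ω₁ / 2 + 2 * ω) - weierstrassZeta L (L.ω₁ / 2)) / 2
  else weierstrassZeta L ω

/-! ### The Lamé equation in the complex domain and Hermite's parameters -/

/-- `ψ` is a (single-valued, holomorphic outside the lattice) solution of the Lamé equation
`-ψ'' + m (m + 1) ℘ ψ = E ψ` in the complex domain. -/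
def IsLameSolution (L : PeriodPair) (m : ℕ) (E : ℂ) (ψ : ℂ → ℂ) : Prop :=
  DifferentiableOn ℂ ψ ((L.lattice : Set ℂ)ᶜ) ∧
    ∀ z ∉ L.lattice,
      -deriv (deriv ψ) z + (m * (m + 1) : ℂ) * L.weierstrassP z * ψ z = E * ψ z

/-- The polynomial `X(ξ) = ∏ j, (ξ - ℘(k j))`. -/
def hermitePoly (L : PeriodPair) {m : ℕ} (k : Fin m → ℂ) : Polynomial ℂ :=
  ∏ j, (Polynomial.X - Polynomial.C (L.weierstrassP (k j)))

/-- `k₁, …, k_m` are Hermite parameters of the Lamé equation with spectral parameter `E`: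
there are two solutions `ψ₁, ψ₂` with constant Wronskian `C`, whose product is `X(℘(z))` with
`X(ξ) = ∏ j, (ξ - ℘(k j))`.
If `C ≠ 0`, the signs of the `k j` are fixed by `X'(℘(k j)) = C / ℘'(k j)`.
If `C = 0` (the solutions are proportional Lamé functions, which happens for finitely many `E`),
this relation carries no information, and the signs are chosen as in the limit
`C → 0`: modulo the lattice, the family `k` is invariant under `k ↦ -k` (with multiplicities). -/
def IsHermiteParameters (L : PeriodPair) (m : ℕ) (E : ℂ) (k : Fin m → ℂ) : Prop :=
  (∀ j, k j ∉ L.lattice) ∧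
    ∃ (ψ₁ ψ₂ : ℂ → ℂ) (C : ℂ),
      IsLameSolution L m E ψ₁ ∧ IsLameSolution L m E ψ₂ ∧
      (∀ z ∉ L.lattice, ψ₁ z * ψ₂ z = (hermitePoly L k).eval (L.weierstrassP z)) ∧
      (∀ z ∉ L.lattice, ψ₁ z * deriv ψ₂ z - deriv ψ₁ z * ψ₂ z = C) ∧
      (C ≠ 0 → ∀ j, (hermitePoly L k).derivative.eval (L.weierstrassP (k j)) *
        L.derivWeierstrassP (k j) = C) ∧
      (C = 0 → ∃ τ : Equiv.Perm (Fin m), ∀ j, k j + k (τ j) ∈ L.lattice)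

/-- `f_m = ζ(ω) ∑ k_j - ω ∑ ζ(k_j)`, as a function of the Hermite parameters. -/
def hermiteExponent (L : PeriodPair) (ω : ℂ) {m : ℕ} (k : Fin m → ℂ) : ℂ :=
  eta L ω * ∑ j, k j - ω * ∑ j, weierstrassZeta L (k j)

/-! ### Schrödinger operators on the line and their spectrum -/

/-- The Hilbert space `L²(ℝ)` of complex-valued functions. -/
abbrev L2 : Type := Lp ℂ 2 (volume : Measure ℝ)

/-- `-f'' + V f = g` almost everywhere on `ℝ`: `f` has a representative `u` which is differentiable
with derivative `v`, and `v` is locally absolutely continuous with (locally integrable)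
derivative `h`. -/
def IsStrongSolution (V : ℝ → ℂ) (f g : ℝ → ℂ) : Prop :=
  ∃ u v h : ℝ → ℂ, f =ᵐ[volume] u ∧ (∀ x, HasDerivAt u (v x) x) ∧
    LocallyIntegrable h volume ∧ (∀ a b : ℝ, v b - v a = ∫ x in a..b, h x) ∧
    g =ᵐ[volume] fun x => -h x + V x * u x

/-- The graph of the maximal realization of `-d²/dx² + V` in `L²(ℝ)`: pairs `(f, g)` in
`L² × L²` such that `f, f'` are locally absolutely continuous and `-f'' + V f = g`.
For bounded `V` the domain is the Sobolev space `H²(ℝ)`. -/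
def schrodingerGraph (V : ℝ → ℂ) : Submodule ℂ (L2 × L2) where
  carrier := {p | IsStrongSolution V p.1 p.2}
  zero_mem' := by
    refine ⟨0, 0, 0, Lp.coeFn_zero ℂ 2 volume, fun x => hasDerivAt_const x 0,
      locallyIntegrable_zero, by simp, ?_⟩
    filter_upwards [Lp.coeFn_zero ℂ 2 (volume : Measure ℝ)] with x hx
    simp
  add_mem' := by
    rintro ⟨f, g⟩ ⟨f', g'⟩ ⟨u, v, h, h1, h2, h3, h4, h5⟩ ⟨u', v', h', h1', h2', h3', h4', h5'⟩
    refine ⟨u + u', v + v', h + h', ?_, fun x => (h2 x).add (h2' x), h3.add h3', ?_, ?_⟩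
    · exact (Lp.coeFn_add f f').trans (h1.add h1')
    · intro a b
      have i1 : IntervalIntegrable h volume a b :=
        (h3.integrableOn_isCompact isCompact_uIcc).intervalIntegrable
      have i2 : IntervalIntegrable h' volume a b :=
        (h3'.integrableOn_isCompact isCompact_uIcc).intervalIntegrable
      simp only [Pi.add_apply]
      rw [intervalIntegral.integral_add i1 i2, ← h4, ← h4']
      ring
    · filter_upwards [Lp.coeFn_add g g', h5, h5'] with x hx e e'
      simp only [Prod.mk_add_mk] at e e' ⊢
      rw [hx, Pi.add_apply, e, e']
      simp only [Pi.add_apply]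
      ring
  smul_mem' := by
    rintro c ⟨f, g⟩ ⟨u, v, h, h1, h2, h3, h4, h5⟩
    refine ⟨c • u, c • v, c • h, ?_, fun x => (h2 x).const_smul c, h3.smul c, ?_, ?_⟩
    · exact (Lp.coeFn_smul c f).trans (h1.const_smul c)
    · intro a b
      simp only [Pi.smul_apply]
      rw [intervalIntegral.integral_smul, ← h4, smul_sub]
    · filter_upwards [Lp.coeFn_smul c g, h5] with x hx e
      simp only [Prod.smul_mk] at e ⊢
      rw [hx, Pi.smul_apply, e]
      simp only [Pi.smul_apply, smul_eq_mul]
      ring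

/-- The relation `schrodingerGraph V` is single-valued, so that it is the graph of an operator. -/
theorem schrodingerGraph_snd_eq_zero (V : ℝ → ℂ) (p : L2 × L2) (hp : p ∈ schrodingerGraph V)
    (h0 : p.1 = 0) : p.2 = 0 := by
  obtain ⟨f, g⟩ := p
  obtain ⟨u, v, h, h1, h2, h3, h4, h5⟩ := hp
  simp only at h0 h1 h5 ⊢
  subst h0
  have hu : u = 0 := by
    have hc : Continuous u := continuous_iff_continuousAt.2 fun x => (h2 x).continuousAt
    exact (hc.ae_eq_iff_eq volume continuous_zero).1
      (h1.symm.trans (Lp.coeFn_zero ℂ 2 volume))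
  subst hu
  have hv : ∀ x, v x = 0 := fun x => (h2 x).unique (hasDerivAt_const x 0)
  have hh : h =ᵐ[volume] 0 := by
    have hder := LocallyIntegrable.ae_hasDerivAt_integral h3
    filter_upwards [hder] with x hx
    have e : (fun b => ∫ t in (0:ℝ)..b, h t) = fun _ => 0 := by
      funext b
      rw [← h4, hv, hv, sub_zero]
    have := hx 0
    rw [e] at this
    exact this.unique (hasDerivAt_const x 0)
  refine Lp.ext ?_
  filter_upwards [h5, hh, Lp.coeFn_zero ℂ 2 (volume : Measure ℝ)] with x e1 e2 e3
  rw [e1, e3, e2]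
  simp

/-- The operator `-d²/dx² + V` in `L²(ℝ)`, with its maximal domain. -/
def schrodingerOperator (V : ℝ → ℂ) : L2 →ₗ.[ℂ] L2 :=
  (schrodingerGraph V).toLinearPMap

/-- The graph of `schrodingerOperator V` is `schrodingerGraph V`. -/
theorem schrodingerOperator_graph (V : ℝ → ℂ) :
    (schrodingerOperator V).graph = schrodingerGraph V :=
  Submodule.toLinearPMap_graph_eq _ (schrodingerGraph_snd_eq_zero V)

/-- The spectrum of an unbounded operator `T` in a normed space: `c` is not in the spectrum iff
`T - c : dom T → H` has a bounded everywhere defined two-sided inverse `R`. -/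
def unboundedSpectrum {H : Type*} [NormedAddCommGroup H] [NormedSpace ℂ H] (T : H →ₗ.[ℂ] H) :
    Set ℂ :=
  {c | ¬ ∃ R : H →L[ℂ] H, (∀ f : T.domain, R (T f - c • (f : H)) = f) ∧
    ∀ g : H, ∃ f : T.domain, (f : H) = R g ∧ T f - c • (f : H) = g}

/-- The potential `m (m + 1) ω² ℘(ω x + z₀)`. -/
def lamePotential (L : PeriodPair) (m : ℕ) (ω z₀ : ℂ) (x : ℝ) : ℂ :=
  (m * (m + 1) : ℂ) * ω ^ 2 * L.weierstrassP (ω * x + z₀)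

/-- The spectrum of the complex Lamé operator `-d²/dx² + m (m + 1) ω² ℘(ω x + z₀)` in `L²(ℝ)`. -/
def lameSpectrum (L : PeriodPair) (m : ℕ) (ω z₀ : ℂ) : Set ℂ :=
  unboundedSpectrum (schrodingerOperator (lamePotential L m ω z₀))

/-- The shift `z₀` is admissible: the line `ω x + z₀`, `x ∈ ℝ`, avoids the lattice. -/
def IsAdmissibleShift (L : PeriodPair) (ω z₀ : ℂ) : Prop :=
  ∀ x : ℝ, ω * x + z₀ ∉ L.lattice

end

end Lame

namespace Lame

open Filter Topology

/-! ### Holomorphic functions on the complement of a lattice -/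

/-! The argument is Floquet theory with explicit multipliers. Since `2 * ω` is a period of `℘`, the
potential on the line has period 2, and a solution `ψ` of the Lamé equation with `E = λ / ω²`
restricts to a solution `x ↦ ψ (ω x + z₀)` of the eigenvalue equation. Whether `λ` is spectral
depends only on the modulus of the factor that `ψ` picks up under `z ↦ z + 2ω`. This factor does not
see `z₀`, so the first claim follows from the other two.

Multipliers. Put `P = X(℘) = ψ⁺ψ⁻`. From `P' = (ψ⁺ψ⁻)'` and the Wronskian `C` one gets `(ψ⁺)'/ψ⁺ =
(P' - C) / (2P)`. The sign conditions on the `k j` say exactly that `C / X(ξ) = ∑ ℘'(k j) / (ξ - ℘(k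
j))` (`SignCondition.sum_div`), and the addition formula `zeta_add_formula` turns the logarithmic
derivative into `∑ (ζ(z + k j) - ζ(z) - ζ(k j))`. Hence `ψ⁺` is a multiple of Hermite's product `∏
σ(z + k j) / σ(z) * exp (-z ζ(k j))`, and the quasi-periodicity of `σ` gives the multiplier `exp (2
f_m)`. The solution `ψ⁻` belongs to `-k`, `-C` and has the inverse multiplier. If `C = 0`, the two
solutions are proportional, so the multiplier equals its inverse and `Re f_m = 0`.

Existence. Products of two solutions obey a linear third order equation. In the variable `℘` it
lowers the degree of polynomials of degree at most `m`, so a dimension count gives a monic solution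
`X` of degree `m`. A first integral of the equation is constant on `X`; its square root is the
Wronskian. Surjectivity of `℘` turns the roots of `X` into parameters, with signs chosen by `℘'(-k)
= -℘'(k)` if `C ≠ 0`; if `C = 0`, roots away from the branch points are double and split into pairs
`k, -k`.

Spectrum. If `Re f_m = 0`, then `ψ⁺` is bounded on the line with its derivative, and slowly varying
cutoffs of it are approximate eigenfunctions. If `Re f_m ≠ 0`, the two solutions are independent and
decay exponentially at opposite ends; their Green's kernel is at most a constant times `exp (-α |x -
t|)`, so Schur's test bounds the resolvent. -/

lemma countable_lattice (L : PeriodPair) : (L.lattice : Set ℂ).Countable :=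
  countable_of_Lindelof_of_discrete (X := L.lattice)

lemma isOpen_compl_lattice (L : PeriodPair) : IsOpen (L.lattice : Set ℂ)ᶜ :=
  L.isClosed_lattice.isOpen_compl

lemma isPreconnected_compl_lattice (L : PeriodPair) : IsPreconnected (L.lattice : Set ℂ)ᶜ :=
  ((countable_lattice L).isConnected_compl_of_one_lt_rank (by simp)).2

lemma eventually_punctured_notMem_lattice (L : PeriodPair) (z : ℂ) :
    ∀ᶠ w in 𝓝[≠] z, w ∉ L.lattice := by
  filter_upwards [self_mem_nhdsWithin,
    mem_nhdsWithin_of_mem_nhds (L.compl_lattice_sdiff_singleton_mem_nhds z)] with w h1 h2 h3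
  exact h2 ⟨h3, h1⟩

/-- Transports a removable singularity along a period, so that removability has to be checked at one
representative of each lattice class only. -/
lemma exists_analyticAt_eventuallyEq_add {f : ℂ → ℂ} {z l : ℂ}
    (hper : ∀ᶠ w in 𝓝[≠] z, f (w + l) = f w)
    (hf : ∃ F : ℂ → ℂ, AnalyticAt ℂ F z ∧ f =ᶠ[𝓝[≠] z] F) :
    ∃ F : ℂ → ℂ, AnalyticAt ℂ F (z + l) ∧ f =ᶠ[𝓝[≠] (z + l)] F := by
  obtain ⟨F, hF, hfF⟩ := hf
  refine ⟨fun w => F (w - l), ?_, ?_⟩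
  · refine AnalyticAt.comp (g := F) (f := fun w => w - l) (x := z + l) ?_ (by fun_prop)
    simpa using hF
  · have h1 : Tendsto (fun w => w - l) (𝓝[≠] (z + l)) (𝓝[≠] z) := by
      refine tendsto_nhdsWithin_iff.2 ⟨?_, ?_⟩
      · have hc : Continuous fun w : ℂ => w - l := by fun_prop
        simpa using (hc.tendsto (z + l)).mono_left (nhdsWithin_le_nhds (s := {z + l}ᶜ))
      · filter_upwards [self_mem_nhdsWithin] with w hw h
        exact hw (sub_eq_iff_eq_add.1 h)
    filter_upwards [h1.eventually hper, h1.eventually hfF] with w h2 h3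
    rw [← h3, ← h2, sub_add_cancel]

/-- An elliptic function all of whose singularities are removable is constant. -/
theorem eventuallyEq_const_of_periodic_of_removable (L : PeriodPair) (f : ℂ → ℂ)
    (hper : ∀ z, ∀ l ∈ L.lattice, ∀ᶠ w in 𝓝[≠] z, f (w + l) = f w)
    (hf : ∀ z, ∃ F : ℂ → ℂ, AnalyticAt ℂ F z ∧ f =ᶠ[𝓝[≠] z] F) :
    ∃ c : ℂ, ∀ z, f =ᶠ[𝓝[≠] z] fun _ => c := by
  choose F hF hfF using hf
  have lim : ∀ z, Tendsto f (𝓝[≠] z) (𝓝 (F z z)) := fun z =>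
    ((hF z).continuousAt.tendsto.mono_left nhdsWithin_le_nhds).congr' (hfF z).symm
  -- The local extensions glue: their values are the punctured limits of `f`, hence independent of
  -- the extension used.
  set g : ℂ → ℂ := fun z => F z z with hg
  have hgF : ∀ z, g =ᶠ[𝓝 z] F z := by
    intro z
    have h1 : ∀ᶠ w in 𝓝 z, AnalyticAt ℂ (F z) w := (hF z).eventually_analyticAt
    have h2 : ∀ᶠ w in 𝓝 z, w ≠ z → f w = F z w := by
      have := hfF z
      rwa [EventuallyEq, eventually_nhdsWithin_iff] at this
    filter_upwards [h1, eventually_eventually_nhds.2 h2] with w hw1 hw2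
    by_cases hwz : w = z
    · subst hwz; rfl
    have h3 : f =ᶠ[𝓝[≠] w] F z := by
      filter_upwards [mem_nhdsWithin_of_mem_nhds hw2,
        mem_nhdsWithin_of_mem_nhds (isOpen_ne.mem_nhds hwz)] with v hv1 hv2
      exact hv1 hv2
    exact tendsto_nhds_unique (lim w)
      ((hw1.continuousAt.tendsto.mono_left nhdsWithin_le_nhds).congr' h3.symm)
  have hdiff : Differentiable ℂ g := fun z =>
    ((hF z).congr (hgF z).symm).differentiableAt
  have hgper : ∀ z, ∀ l ∈ L.lattice, g (z + l) = g z := by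
    intro z l hl
    have h1 : Tendsto (fun w => w + l) (𝓝[≠] z) (𝓝[≠] (z + l)) := by
      refine tendsto_nhdsWithin_iff.2 ⟨?_, ?_⟩
      · exact ((continuous_add_const l).tendsto z).mono_left nhdsWithin_le_nhds
      · filter_upwards [self_mem_nhdsWithin] with w hw
        simpa using hw
    have h2 := (lim (z + l)).comp h1
    exact tendsto_nhds_unique (h2.congr' (hper z l hl)) (lim z)
  -- Continuity and periodicity make the range of the entire function `g` compact, so Liouville's
  -- theorem applies.
  have hb := (IsZLattice.isCompact_range_of_periodic L.lattice g
    hdiff.continuous fun z w hw ↦ hgper z w hw).isBounded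
  refine ⟨g 0, fun z => ?_⟩
  filter_upwards [hfF z, mem_nhdsWithin_of_mem_nhds (hgF z)] with w h1 h2
  rw [h1, ← h2]
  exact hdiff.apply_eq_apply_of_bounded hb w 0

/-- Two functions, holomorphic outside a lattice, whose Wronskian vanishes on a set
clustering everywhere, are proportional. -/
theorem exists_eq_const_mul_of_wronskian_eq_zero (L : PeriodPair) {f g : ℂ → ℂ}
    (hf : DifferentiableOn ℂ f (L.lattice : Set ℂ)ᶜ)
    (hg : DifferentiableOn ℂ g (L.lattice : Set ℂ)ᶜ)
    (h : ∀ z ∉ L.lattice, ∀ᶠ w in 𝓝[≠] z, deriv f w * g w = f w * deriv g w)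
    {z₁ : ℂ} (hz₁ : z₁ ∉ L.lattice) (hgz : g z₁ ≠ 0) :
    ∃ c : ℂ, ∀ z ∉ L.lattice, f z = c * g z := by
  have ho := isOpen_compl_lattice L
  have hfa := hf.analyticOnNhd ho
  have hga := hg.analyticOnNhd ho
  -- Continuity carries the identity over to the isolated points that the hypothesis leaves out.
  have h' : ∀ z ∉ L.lattice, deriv f z * g z = f z * deriv g z := by
    intro z hz
    have c1 : ContinuousAt (fun w => deriv f w * g w) z :=
      (hfa z hz).deriv.continuousAt.mul (hga z hz).continuousAt
    have c2 : ContinuousAt (fun w => f w * deriv g w) z :=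
      (hfa z hz).continuousAt.mul (hga z hz).deriv.continuousAt
    exact tendsto_nhds_unique (c1.tendsto.mono_left nhdsWithin_le_nhds)
      ((c2.tendsto.mono_left nhdsWithin_le_nhds).congr' (by
        filter_upwards [h z hz] with w hw using hw.symm))
  have hnear : ∀ᶠ w in 𝓝 z₁, w ∉ L.lattice ∧ g w ≠ 0 :=
    Filter.Eventually.and (ho.mem_nhds hz₁) ((hga z₁ hz₁).continuousAt.eventually_ne hgz)
  obtain ⟨r, hr, hball⟩ := Metric.eventually_nhds_iff_ball.1 hnear
  have hconst : ∀ w ∈ Metric.ball z₁ r, f w / g w = f z₁ / g z₁ := by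
    intro w hw
    refine (convex_ball z₁ r).is_const_of_fderivWithin_eq_zero (𝕜 := ℂ)
      (f := fun w => f w / g w) ?_ ?_ hw (Metric.mem_ball_self hr)
    · intro v hv
      exact ((hfa v (hball v hv).1).differentiableAt.div
        (hga v (hball v hv).1).differentiableAt (hball v hv).2).differentiableWithinAt
    · intro v hv
      rw [fderivWithin_of_isOpen Metric.isOpen_ball hv]
      have hd := (hfa v (hball v hv).1).differentiableAt.hasDerivAt.div
        (hga v (hball v hv).1).differentiableAt.hasDerivAt (hball v hv).2
      rw [h' v (hball v hv).1, sub_self, zero_div] at hd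
      have := hd.hasFDerivAt.fderiv
      simp only [Pi.div_def] at this
      rw [this]
      ext; simp
  refine ⟨f z₁ / g z₁, fun z hz => ?_⟩
  -- The quotient is constant near `z₁`; the identity theorem on the connected complement of the
  -- lattice also covers the zeros of `g`.
  have := hfa.eqOn_of_preconnected_of_eventuallyEq
    (g := fun z => f z₁ / g z₁ * g z) (fun z hz => analyticAt_const.mul (hga z hz))
    (isPreconnected_compl_lattice L) hz₁ (by
      filter_upwards [Metric.ball_mem_nhds z₁ hr] with w hw
      rw [← hconst w hw, div_mul_cancel₀ _ (hball w hw).2])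
  exact this hz

/-! ### The Weierstrass `ζ`-function -/

/-- The Weierstrass `ζ`-function with the summand of `l₀` missing. -/
noncomputable def weierstrassZetaExcept (L : PeriodPair) (l₀ z : ℂ) : ℂ :=
  ∑' l : L.lattice, if (l : ℂ) = l₀ then 0 else (1 / (z - (l : ℂ)) + 1 / (l : ℂ) + z / (l : ℂ) ^ 2)

/-- Over a common denominator the summand is visibly `O(‖l‖⁻³)`, which is summable over a lattice of
rank two. -/
lemma zeta_summand_eq {z l : ℂ} (h1 : z - l ≠ 0) (h2 : l ≠ 0) :
    1 / (z - l) + 1 / l + z / l ^ 2 = z ^ 2 / (l ^ 2 * (z - l)) := by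
  field_simp
  ring

lemma norm_zeta_summand_le (r : ℝ) (hr : 0 < r) (s : ℂ) (hs : ‖s‖ < r) (l : ℂ)
    (h : 2 * r ≤ ‖l‖) :
    ‖1 / (s - l) + 1 / l + s / l ^ 2‖ ≤ 2 * r ^ 2 * ‖l‖ ^ (-3 : ℝ) := by
  have hl : 0 < ‖l‖ := by linarith
  have hl0 : l ≠ 0 := norm_pos_iff.1 hl
  have hsl : ‖l‖ / 2 ≤ ‖s - l‖ := by
    rw [norm_sub_rev]
    exact .trans (by linarith) (norm_sub_norm_le l s)
  have hsl0 : s - l ≠ 0 := norm_pos_iff.1 (by linarith)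
  rw [zeta_summand_eq hsl0 hl0, norm_div, norm_pow, norm_mul, norm_pow]
  calc ‖s‖ ^ 2 / (‖l‖ ^ 2 * ‖s - l‖) ≤ r ^ 2 / (‖l‖ ^ 2 * (‖l‖ / 2)) := by gcongr
    _ = 2 * r ^ 2 / ‖l‖ ^ 3 := by field_simp
    _ = _ := by norm_cast

lemma hasSumLocallyUniformly_zetaExcept (L : PeriodPair) (l₀ : ℂ) :
    HasSumLocallyUniformly
      (fun (l : L.lattice) (z : ℂ) ↦ if (l : ℂ) = l₀ then 0 else
        (1 / (z - (l : ℂ)) + 1 / (l : ℂ) + z / (l : ℂ) ^ 2))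
      (weierstrassZetaExcept L l₀) := by
  refine L.hasSumLocallyUniformly_aux (u := fun r l => 2 * r ^ 2 * ‖l‖ ^ (-3 : ℝ)) _
    (fun _ _ ↦ (ZLattice.summable_norm_rpow _ _ (by simp; norm_num)).mul_left _) fun r hr ↦
    Filter.eventually_atTop.mpr ⟨2 * r, ?_⟩
  rintro _ h s hs l rfl
  split_ifs
  · simp only [norm_zero]; positivity
  · exact norm_zeta_summand_le r hr s hs l h

lemma hasDerivAt_zeta_summand {z l : ℂ} (h : z ≠ l) :
    HasDerivAt (fun z : ℂ => 1 / (z - l) + 1 / l + z / l ^ 2) (-(1 / (z - l) ^ 2 - 1 / l ^ 2)) z := by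
  have h0 : z - l ≠ 0 := sub_ne_zero.2 h
  have h1 : HasDerivAt (fun z : ℂ => 1 / (z - l)) (-(1 / (z - l) ^ 2)) z := by
    simpa [neg_div] using! ((hasDerivAt_id z).sub_const l).inv h0
  have h2 : HasDerivAt (fun z : ℂ => z / l ^ 2) (1 / l ^ 2) z := (hasDerivAt_id z).div_const _
  exact ((h1.add_const (1 / l)).add h2).congr_deriv (by ring)

lemma differentiableOn_zetaExcept_summand (L : PeriodPair) (l₀ : ℂ) (l : L.lattice) :
    DifferentiableOn ℂ (fun z : ℂ ↦ if (l : ℂ) = l₀ then 0 else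
        (1 / (z - (l : ℂ)) + 1 / (l : ℂ) + z / (l : ℂ) ^ 2)) ((L.lattice : Set ℂ) \ {l₀})ᶜ := by
  intro z hz
  split_ifs with h
  · exact differentiableWithinAt_const _
  · refine (hasDerivAt_zeta_summand ?_).differentiableAt.differentiableWithinAt
    rintro rfl
    exact hz ⟨l.2, h⟩

lemma differentiableOn_zetaExcept (L : PeriodPair) (l₀ : ℂ) :
    DifferentiableOn ℂ (weierstrassZetaExcept L l₀) ((L.lattice : Set ℂ) \ {l₀})ᶜ := by
  refine (hasSumLocallyUniformly_zetaExcept L l₀).hasSumLocallyUniformlyOn.differentiableOn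
    (.of_forall fun s ↦ .fun_sum fun i hi ↦ ?_) L.isOpen_compl_lattice_sdiff
  exact differentiableOn_zetaExcept_summand L l₀ i

lemma deriv_zetaExcept (L : PeriodPair) (l₀ : ℂ) :
    Set.EqOn (deriv (weierstrassZetaExcept L l₀)) (fun z => -L.weierstrassPExcept l₀ z)
      ((L.lattice : Set ℂ) \ {l₀})ᶜ := by
  refine ((hasSumLocallyUniformly_zetaExcept L l₀).tendstoLocallyUniformlyOn.deriv
    (.of_forall fun s ↦ .fun_sum fun i hi ↦ differentiableOn_zetaExcept_summand L l₀ i)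
      L.isOpen_compl_lattice_sdiff).unique ?_
  have := (L.hasSumLocallyUniformly_weierstrassPExcept l₀).tendstoLocallyUniformlyOn
    (s := ((L.lattice : Set ℂ) \ {l₀})ᶜ) |>.neg
  refine this.congr ?_
  intro s z hz
  simp only [Function.comp_apply, Pi.neg_apply]
  rw [deriv_fun_sum]
  · rw [← Finset.sum_neg_distrib]
    refine Finset.sum_congr rfl fun l _ => ?_
    by_cases h : (l : ℂ) = l₀
    · simp [h]
    · simp only [h, if_false]
      refine (hasDerivAt_zeta_summand ?_).deriv.symm
      rintro rfl
      exact hz ⟨l.2, h⟩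
  · intro l _
    exact (differentiableOn_zetaExcept_summand L l₀ l z hz).differentiableAt
      (L.isOpen_compl_lattice_sdiff.mem_nhds hz)

/-- With `l₀ = ω₁ / 2` nothing is left out, so the results on the truncated series also cover `ζ`
itself. -/
lemma zetaExcept_of_notMem (L : PeriodPair) {l₀ : ℂ} (h : l₀ ∉ L.lattice) :
    weierstrassZetaExcept L l₀ = weierstrassZeta L := by
  funext z
  unfold weierstrassZetaExcept weierstrassZeta
  refine tsum_congr fun l => ?_
  rw [if_neg]
  rintro rfl
  exact h l.2

lemma hasSum_zeta (L : PeriodPair) (z : ℂ) :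
    HasSum (fun l : L.lattice => 1 / (z - (l : ℂ)) + 1 / (l : ℂ) + z / (l : ℂ) ^ 2)
      (weierstrassZeta L z) := by
  have := (hasSumLocallyUniformly_zetaExcept L (L.ω₁ / 2)).hasSum (x := z)
  rw [zetaExcept_of_notMem L L.ω₁_div_two_notMem_lattice] at this
  refine this.congr_fun fun l => ?_
  rw [if_neg]
  intro h
  exact L.ω₁_div_two_notMem_lattice (h ▸ l.2)

lemma zetaExcept_zero_add (L : PeriodPair) (z : ℂ) :
    weierstrassZeta L z = 1 / z + weierstrassZetaExcept L 0 z := by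
  have h1 := hasSum_zeta L z
  have h2 : HasSum _ _ := (hasSumLocallyUniformly_zetaExcept L 0).hasSum (x := z)
  have h3 := hasSum_ite_eq (0 : L.lattice) (1 / z)
  refine h1.unique ((h3.add h2).congr_fun fun l => ?_)
  by_cases h : l = 0
  · simp [h]
  · have h' : (l : ℂ) ≠ 0 := by simpa using h
    simp [h]

lemma hasDerivAt_zeta (L : PeriodPair) {z : ℂ} (hz : z ∉ L.lattice) :
    HasDerivAt (weierstrassZeta L) (-L.weierstrassP z) z := by
  have hn := L.ω₁_div_two_notMem_lattice
  have hz' : z ∈ ((L.lattice : Set ℂ) \ {L.ω₁ / 2})ᶜ := fun h => hz h.1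
  have h1 := deriv_zetaExcept L (L.ω₁ / 2) hz'
  have h2 := (differentiableOn_zetaExcept L (L.ω₁ / 2)).differentiableAt
    (L.isOpen_compl_lattice_sdiff.mem_nhds hz')
  have h3 := h2.hasDerivAt
  rw [h1] at h3
  simpa only [zetaExcept_of_notMem L hn, L.weierstrassPExcept_of_notMem _ hn] using h3

lemma differentiableOn_zeta (L : PeriodPair) :
    DifferentiableOn ℂ (weierstrassZeta L) (L.lattice : Set ℂ)ᶜ := fun _ hz =>
  (hasDerivAt_zeta L hz).differentiableAt.differentiableWithinAt

lemma analyticAt_zeta (L : PeriodPair) {z : ℂ} (hz : z ∉ L.lattice) :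
    AnalyticAt ℂ (weierstrassZeta L) z :=
  (differentiableOn_zeta L).analyticAt ((isOpen_compl_lattice L).mem_nhds hz)

lemma analyticAt_zetaExcept_zero (L : PeriodPair) :
    AnalyticAt ℂ (weierstrassZetaExcept L 0) 0 :=
  (differentiableOn_zetaExcept L 0).analyticAt
    (L.isOpen_compl_lattice_sdiff.mem_nhds (by simp))

lemma zeta_neg (L : PeriodPair) (z : ℂ) : weierstrassZeta L (-z) = -weierstrassZeta L z := by
  unfold weierstrassZeta
  rw [← (Equiv.neg L.lattice).tsum_eq, ← tsum_neg]
  refine tsum_congr fun l => ?_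
  simp only [Equiv.neg_apply, NegMemClass.coe_neg]
  rw [show -z - -(l : ℂ) = -(z - l) by ring]
  simp only [one_div, inv_neg, neg_sq]
  ring

lemma notMem_lattice_add (L : PeriodPair) {z l : ℂ} (hz : z ∉ L.lattice) (hl : l ∈ L.lattice) :
    z + l ∉ L.lattice := fun h => hz (by simpa using sub_mem h hl)

lemma weierstrassP_add (L : PeriodPair) (z : ℂ) {l : ℂ} (hl : l ∈ L.lattice) :
    L.weierstrassP (z + l) = L.weierstrassP z := L.weierstrassP_add_coe z ⟨l, hl⟩

lemma derivWeierstrassP_add (L : PeriodPair) (z : ℂ) {l : ℂ} (hl : l ∈ L.lattice) :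
    L.derivWeierstrassP (z + l) = L.derivWeierstrassP z := L.derivWeierstrassP_add_coe z ⟨l, hl⟩

/-- The derivative `-℘` is periodic and the complement of the lattice is connected. -/
lemma exists_zeta_add (L : PeriodPair) {l : ℂ} (hl : l ∈ L.lattice) :
    ∃ c, ∀ z ∉ L.lattice, weierstrassZeta L (z + l) = weierstrassZeta L z + c := by
  have ho := isOpen_compl_lattice L
  have key := ho.exists_is_const_of_deriv_eq_zero (isPreconnected_compl_lattice L)
    (f := fun z => weierstrassZeta L (z + l) - weierstrassZeta L z) ?_ ?_
  · obtain ⟨c, hc⟩ := key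
    exact ⟨c, fun z hz => by rw [← hc z hz]; ring⟩
  · intro z hz
    exact (((hasDerivAt_zeta L (notMem_lattice_add L hz hl)).comp_add_const z l).sub
      (hasDerivAt_zeta L hz)).differentiableAt.differentiableWithinAt
  · intro z hz
    have := (((hasDerivAt_zeta L (notMem_lattice_add L hz hl)).comp_add_const z l).sub
      (hasDerivAt_zeta L hz)).deriv
    rw [weierstrassP_add L z hl, sub_self] at this
    exact this

lemma zeta_add_two_mul (L : PeriodPair) {ω : ℂ} (h : 2 * ω ∈ L.lattice) {z : ℂ}
    (hz : z ∉ L.lattice) :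
    weierstrassZeta L (z + 2 * ω) = weierstrassZeta L z + 2 * eta L ω := by
  obtain ⟨c, hc⟩ := exists_zeta_add L h
  rw [hc z hz]
  congr 1
  unfold eta
  split_ifs with hω
  · rw [hc _ L.ω₁_div_two_notMem_lattice]
    ring
  -- At `z = -ω` oddness gives `ζ(ω) = -ζ(ω) + c`, that is `c = 2 ζ(ω)`.
  · have := hc (-ω) (fun h' => hω (by simpa using neg_mem h'))
    rw [zeta_neg, show -ω + 2 * ω = ω by ring] at this
    linear_combination -this

end Lame

namespace Lame

open Filter Topology

/-! ### The Weierstrass `σ`-function -/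

/-- The factor of the Weierstrass product of `σ` with its zero at `l`, which is `1` for `l = 0`. -/
noncomputable def sigmaFactor (l z : ℂ) : ℂ := (1 - z / l) * Complex.exp (z / l + (z / l) ^ 2 / 2)

/-- The Weierstrass `σ`-function of a lattice. -/
noncomputable def weierstrassSigma (L : PeriodPair) (z : ℂ) : ℂ :=
  z * ∏' l : L.lattice, sigmaFactor l z

lemma sigmaFactor_zero (z : ℂ) : sigmaFactor 0 z = 1 := by simp [sigmaFactor]

lemma differentiable_sigmaFactor (l : ℂ) : Differentiable ℂ (sigmaFactor l) := by
  unfold sigmaFactor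
  fun_prop

lemma sigmaFactor_ne_zero {l z : ℂ} (h : z ≠ l) : sigmaFactor l z ≠ 0 := by
  refine mul_ne_zero (fun h0 => ?_) (Complex.exp_ne_zero _)
  by_cases hl : l = 0
  · simp [hl] at h0
  · exact h ((div_eq_one_iff_eq hl).1 (sub_eq_zero.1 h0).symm)

/-- The exponent cancels the Taylor polynomial of `log (1 - w)` up to order two, which leaves a
cubic remainder. -/
lemma norm_weierstrassFactor_sub_one_le {w : ℂ} (hw : ‖w‖ ≤ 1 / 2) :
    ‖(1 - w) * Complex.exp (w + w ^ 2 / 2) - 1‖ ≤ 2 * ‖w‖ ^ 3 := by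
  have hne : 1 - w ≠ 0 := by
    intro h
    have : w = 1 := (sub_eq_zero.1 h).symm
    rw [this] at hw
    norm_num at hw
  have h1 : (1 - w) * Complex.exp (w + w ^ 2 / 2)
      = Complex.exp (Complex.log (1 - w) + (w + w ^ 2 / 2)) := by
    rw [Complex.exp_add (Complex.log _), Complex.exp_log hne]
  have h2 : ‖Complex.log (1 - w) + (w + w ^ 2 / 2)‖ ≤ ‖w‖ ^ 3 := by
    have := Complex.norm_log_sub_logTaylor_le 2 (z := -w) (by rw [norm_neg]; linarith)
    rw [norm_neg] at this
    have e : Complex.log (1 + -w) - Complex.logTaylor (2 + 1) (-w)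
        = Complex.log (1 - w) + (w + w ^ 2 / 2) := by
      simp [Complex.logTaylor_succ, Complex.logTaylor_zero, sub_eq_add_neg]
      ring
    rw [e] at this
    refine this.trans ?_
    have h3 : (1 - ‖w‖)⁻¹ ≤ 2 := by
      rw [inv_le_comm₀ (by linarith) (by norm_num)]
      linarith
    have h4 : ‖w‖ ^ 3 * (1 - ‖w‖)⁻¹ ≤ ‖w‖ ^ 3 * 2 := by gcongr
    push_cast
    norm_num at this ⊢
    nlinarith [norm_nonneg w, pow_nonneg (norm_nonneg w) 3]
  have h3 : ‖w‖ ^ 3 ≤ 1 := pow_le_one₀ (norm_nonneg w) (by linarith)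
  rw [h1]
  exact (Complex.norm_exp_sub_one_le (h2.trans h3)).trans (by linarith)

lemma norm_sigmaFactor_sub_one_le {r : ℝ} (hr : 0 < r) {l z : ℂ} (hz : ‖z‖ < r)
    (hl : 2 * r ≤ ‖l‖) : ‖sigmaFactor l z - 1‖ ≤ 2 * r ^ 3 * ‖l‖ ^ (-3 : ℝ) := by
  have hl0 : 0 < ‖l‖ := by linarith
  have h1 : ‖z / l‖ ≤ 1 / 2 := by
    rw [norm_div, div_le_iff₀ hl0]
    linarith
  refine (norm_weierstrassFactor_sub_one_le h1).trans ?_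
  calc 2 * ‖z / l‖ ^ 3 = 2 * ‖z‖ ^ 3 / ‖l‖ ^ 3 := by rw [norm_div, div_pow]; ring
    _ ≤ 2 * r ^ 3 / ‖l‖ ^ 3 := by gcongr
    _ = _ := by norm_cast

lemma eventually_cofinite_lattice_norm_ge (L : PeriodPair) (R : ℝ) :
    ∀ᶠ l : L.lattice in cofinite, R ≤ ‖(l : ℂ)‖ := by
  refine (isCompact_iff_finite.mp (isCompact_closedBall (0 : L.lattice) R)).subset ?_
  intro l hl
  simp only [Set.mem_compl_iff, Set.mem_ofPred_eq, not_le] at hl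
  simpa using hl.le

lemma summable_norm_lattice (L : PeriodPair) (C : ℝ) :
    Summable fun l : L.lattice => C * ‖(l : ℂ)‖ ^ (-3 : ℝ) :=
  (ZLattice.summable_norm_rpow L.lattice (-3) (by simp; norm_num)).mul_left C

lemma hasProdLocallyUniformlyOn_sigmaFactor (L : PeriodPair) {r : ℝ} (hr : 0 < r) :
    HasProdLocallyUniformlyOn (fun (l : L.lattice) z => sigmaFactor l z)
      (fun z => ∏' l : L.lattice, sigmaFactor l z) (Metric.ball 0 r) := by
  have := Summable.hasProdLocallyUniformlyOn_one_add (K := Metric.ball (0 : ℂ) r)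
    (f := fun (l : L.lattice) z => sigmaFactor l z - 1) Metric.isOpen_ball
    (summable_norm_lattice L (2 * r ^ 3)) ?_ ?_
  · simpa using this
  · filter_upwards [eventually_cofinite_lattice_norm_ge L (2 * r)] with l hl z hz
    exact norm_sigmaFactor_sub_one_le hr (by simpa using hz) hl
  · intro l
    exact ((differentiable_sigmaFactor l).sub_const 1).continuous.continuousOn

lemma differentiable_tprod_sigmaFactor (L : PeriodPair) :
    Differentiable ℂ fun z => ∏' l : L.lattice, sigmaFactor l z := by
  intro z
  have hr : 0 < ‖z‖ + 1 := by positivity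
  have h1 : TendstoLocallyUniformlyOn _ _ _ _ := hasProdLocallyUniformlyOn_sigmaFactor L hr
  have h2 := h1.differentiableOn (.of_forall fun s ↦ ?_) Metric.isOpen_ball
  · exact h2.differentiableAt (Metric.isOpen_ball.mem_nhds (by simp))
  · exact DifferentiableOn.fun_finsetProd fun l _ =>
      (differentiable_sigmaFactor l).differentiableOn

lemma differentiable_sigma (L : PeriodPair) : Differentiable ℂ (weierstrassSigma L) :=
  differentiable_id.mul (differentiable_tprod_sigmaFactor L)

lemma tprod_sigmaFactor_ne_zero (L : PeriodPair) {z : ℂ} (hz : z ∉ L.lattice) :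
    ∏' l : L.lattice, sigmaFactor l z ≠ 0 := by
  have hr : 0 < ‖z‖ + 1 := by positivity
  have := tprod_one_add_ne_zero_of_summable (f := fun l : L.lattice => sigmaFactor l z - 1) ?_ ?_
  · simpa using this
  · intro l
    rw [add_sub_cancel]
    refine sigmaFactor_ne_zero ?_
    rintro rfl
    exact hz l.2
  · refine Summable.of_norm_bounded_eventually
      (summable_norm_lattice L (2 * (‖z‖ + 1) ^ 3)) ?_
    filter_upwards [eventually_cofinite_lattice_norm_ge L (2 * (‖z‖ + 1))] with l hl
    rw [norm_norm]
    exact norm_sigmaFactor_sub_one_le hr (by linarith) hl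

lemma sigma_ne_zero (L : PeriodPair) {z : ℂ} (hz : z ∉ L.lattice) : weierstrassSigma L z ≠ 0 :=
  mul_ne_zero (by rintro rfl; exact hz (zero_mem _)) (tprod_sigmaFactor_ne_zero L hz)

/-- The logarithmic derivative of a factor of `σ` is the corresponding summand of `ζ`; the case `l =
0` is left to the prefactor `z` of the product. -/
lemma logDeriv_sigmaFactor {l z : ℂ} (h : z ≠ l) :
    logDeriv (sigmaFactor l) z
      = if l = 0 then 0 else 1 / (z - l) + 1 / l + z / l ^ 2 := by
  split_ifs with hl
  · subst hl
    have : sigmaFactor 0 = fun _ => 1 := funext sigmaFactor_zero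
    simp [logDeriv, this]
  · have h1 : HasDerivAt (fun z : ℂ => 1 - z / l) (-(1 / l)) z := by
      simpa using ((hasDerivAt_id z).div_const l).const_sub 1
    have h2 : HasDerivAt (fun z : ℂ => Complex.exp (z / l + (z / l) ^ 2 / 2))
        (Complex.exp (z / l + (z / l) ^ 2 / 2) * (1 / l + z / l ^ 2)) z := by
      have h3 : HasDerivAt (fun z : ℂ => z / l) (1 / l) z := (hasDerivAt_id z).div_const l
      refine (h3.add ((h3.pow 2).div_const 2)).cexp.congr_deriv ?_
      simp
      ring
    have h4 : HasDerivAt (sigmaFactor l) _ z := h1.mul h2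
    have h5 : z - l ≠ 0 := sub_ne_zero.2 h
    have h6 : l - z ≠ 0 := sub_ne_zero.2 h.symm
    rw [logDeriv_apply, h4.deriv, sigmaFactor]
    have := Complex.exp_ne_zero (z / l + (z / l) ^ 2 / 2)
    rw [show 1 - z / l = (l - z) / l by field_simp]
    generalize Complex.exp (z / l + (z / l) ^ 2 / 2) = e at *
    field_simp
    ring

/-- Locally uniform convergence allows logarithmic differentiation of the product factor by factor;
the prefactor `z` supplies the missing summand `1 / z`. -/
lemma hasDerivAt_sigma (L : PeriodPair) {z : ℂ} (hz : z ∉ L.lattice) :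
    HasDerivAt (weierstrassSigma L) (weierstrassZeta L z * weierstrassSigma L z) z := by
  have hz0 : z ≠ 0 := by rintro rfl; exact hz (zero_mem _)
  have hr : 0 < ‖z‖ + 1 := by positivity
  have hne : ∀ l : L.lattice, z ≠ l := by rintro l rfl; exact hz l.2
  have hs : HasSum (fun l : L.lattice => logDeriv (sigmaFactor l) z)
      (weierstrassZetaExcept L 0 z) := by
    simp only [fun l : L.lattice => logDeriv_sigmaFactor (hne l)]
    exact (hasSumLocallyUniformly_zetaExcept L 0).hasSum
  have h1 := logDeriv_tprod_eq_tsum (s := Metric.ball (0 : ℂ) (‖z‖ + 1)) Metric.isOpen_ball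
    (x := z) (by simp) (f := fun l : L.lattice => sigmaFactor l)
    (fun l => sigmaFactor_ne_zero (hne l))
    (fun l => (differentiable_sigmaFactor l).differentiableOn) hs.summable
    (hasProdLocallyUniformlyOn_sigmaFactor L hr).multipliableLocallyUniformlyOn
    (tprod_sigmaFactor_ne_zero L hz)
  rw [hs.tsum_eq, logDeriv_apply, div_eq_iff (tprod_sigmaFactor_ne_zero L hz)] at h1
  have h2 := (hasDerivAt_id z).mul (differentiable_tprod_sigmaFactor L z).hasDerivAt
  rw [h1] at h2
  refine h2.congr_deriv ?_
  rw [zetaExcept_zero_add, weierstrassSigma, id]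
  field_simp

/-- Both sides have the same logarithmic derivative, because `ζ` increases by `2η`. The value of `c`
is irrelevant: it cancels in the quotients `σ(z + k) / σ(z)`. -/
lemma exists_sigma_add_two_mul (L : PeriodPair) {ω : ℂ} (h : 2 * ω ∈ L.lattice) :
    ∃ c : ℂ, c ≠ 0 ∧ ∀ z, weierstrassSigma L (z + 2 * ω)
      = c * Complex.exp (2 * eta L ω * z) * weierstrassSigma L z := by
  have hn := L.ω₁_div_two_notMem_lattice
  have hf : Differentiable ℂ fun z => weierstrassSigma L (z + 2 * ω) :=
    (differentiable_sigma L).comp (differentiable_id.add_const _)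
  have hg : Differentiable ℂ fun z =>
      Complex.exp (2 * eta L ω * z) * weierstrassSigma L z :=
    (differentiable_id.const_mul _).cexp.mul (differentiable_sigma L)
  obtain ⟨c, hc⟩ := exists_eq_const_mul_of_wronskian_eq_zero L
    (f := fun z => weierstrassSigma L (z + 2 * ω))
    (g := fun z => Complex.exp (2 * eta L ω * z) * weierstrassSigma L z)
    hf.differentiableOn hg.differentiableOn (fun z _ => by
      filter_upwards [eventually_punctured_notMem_lattice L z] with w hw
      have h1 := (hasDerivAt_sigma L (notMem_lattice_add L hw h)).comp_add_const w (2 * ω)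
      have h2 : HasDerivAt (fun z => Complex.exp (2 * eta L ω * z) * weierstrassSigma L z) _ w :=
        (((hasDerivAt_id w).const_mul (2 * eta L ω)).cexp).mul (hasDerivAt_sigma L hw)
      rw [h1.deriv, h2.deriv, zeta_add_two_mul L h hw]
      simp only [id]
      ring) hn
    (mul_ne_zero (Complex.exp_ne_zero _) (sigma_ne_zero L hn))
  refine ⟨c, ?_, fun z => ?_⟩
  · rintro rfl
    exact sigma_ne_zero L (notMem_lattice_add L hn h) (by simpa using hc _ hn)
  · have t1 : Tendsto (fun z => weierstrassSigma L (z + 2 * ω)) (𝓝[≠] z) (𝓝 _) :=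
      (hf.continuous.tendsto z).mono_left nhdsWithin_le_nhds
    have t2 := ((hg.continuous.const_mul c).tendsto z).mono_left
      (nhdsWithin_le_nhds (s := {z}ᶜ))
    rw [mul_assoc]
    refine tendsto_nhds_unique t1 (t2.congr' ?_)
    filter_upwards [eventually_punctured_notMem_lattice L z] with w hw using (hc w hw).symm

end Lame

namespace Lame

open Filter Topology

/-! ### The addition formula and the values of `℘` -/

lemma notMem_lattice_neg (L : PeriodPair) {z : ℂ} (hz : z ∉ L.lattice) : -z ∉ L.lattice :=
  fun h => hz (by simpa using neg_mem h)

lemma eventually_punctured_add_notMem_lattice (L : PeriodPair) (k z : ℂ) :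
    ∀ᶠ w in 𝓝[≠] z, w + k ∉ L.lattice := by
  have h1 : Tendsto (fun w => w + k) (𝓝[≠] z) (𝓝[≠] (z + k)) := by
    refine tendsto_nhdsWithin_iff.2 ⟨?_, ?_⟩
    · exact ((continuous_add_const k).tendsto z).mono_left nhdsWithin_le_nhds
    · filter_upwards [self_mem_nhdsWithin] with w hw
      simpa using hw
  exact h1.eventually (eventually_punctured_notMem_lattice L (z + k))

lemma weierstrassP_eq_except_add (L : PeriodPair) (z : ℂ) :
    L.weierstrassP z = L.weierstrassPExcept 0 z + 1 / z ^ 2 := by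
  simpa using (L.weierstrassPExcept_add 0 z).symm

lemma derivWeierstrassP_eq_except_sub (L : PeriodPair) (z : ℂ) :
    L.derivWeierstrassP z = L.derivWeierstrassPExcept 0 z - 2 / z ^ 3 := by
  simpa using (L.derivWeierstrassPExcept_sub 0 z).symm

lemma analyticAt_weierstrassP (L : PeriodPair) {z : ℂ} (hz : z ∉ L.lattice) :
    AnalyticAt ℂ L.weierstrassP z := L.analyticOnNhd_weierstrassP z hz

lemma analyticAt_derivWeierstrassP (L : PeriodPair) {z : ℂ} (hz : z ∉ L.lattice) :
    AnalyticAt ℂ L.derivWeierstrassP z := L.analyticOnNhd_derivWeierstrassP z hz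

lemma hasDerivAt_weierstrassP (L : PeriodPair) {z : ℂ} (hz : z ∉ L.lattice) :
    HasDerivAt L.weierstrassP (L.derivWeierstrassP z) z := by
  have := (analyticAt_weierstrassP L hz).differentiableAt.hasDerivAt
  rwa [L.deriv_weierstrassP] at this

/-- The difference of the two sides of the addition formula for `ζ`, cleared of denominators. -/
noncomputable def additionDefect (L : PeriodPair) (k z : ℂ) : ℂ :=
  (L.weierstrassP z - L.weierstrassP k) *
      (weierstrassZeta L (z + k) - weierstrassZeta L z - weierstrassZeta L k)
    - (L.derivWeierstrassP z - L.derivWeierstrassP k) / 2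

lemma additionDefect_periodic (L : PeriodPair) (k : ℂ) {z l : ℂ} (hl : l ∈ L.lattice)
    (hz : z ∉ L.lattice) (hzk : z + k ∉ L.lattice) :
    additionDefect L k (z + l) = additionDefect L k z := by
  obtain ⟨c, hc⟩ := exists_zeta_add L hl
  unfold additionDefect
  rw [weierstrassP_add L z hl, derivWeierstrassP_add L z hl, hc z hz,
    show z + l + k = z + k + l by ring, hc _ hzk]
  ring

lemma analyticAt_additionDefect (L : PeriodPair) (k : ℂ) {z : ℂ}
    (hz : z ∉ L.lattice) (hzk : z + k ∉ L.lattice) : AnalyticAt ℂ (additionDefect L k) z := by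
  have h1 := analyticAt_weierstrassP L hz
  have h2 := analyticAt_derivWeierstrassP L hz
  have h3 := analyticAt_zeta L hz
  have h4 : AnalyticAt ℂ (fun z => weierstrassZeta L (z + k)) z :=
    AnalyticAt.comp (g := weierstrassZeta L) (f := fun z => z + k) (analyticAt_zeta L hzk)
      (by fun_prop)
  unfold additionDefect
  fun_prop

lemma zetaExcept_zero_zero (L : PeriodPair) : weierstrassZetaExcept L 0 0 = 0 := by
  unfold weierstrassZetaExcept
  convert tsum_zero with l
  simp

/-- At the origin the poles of order three of `-℘(z) / z` and of `-℘'(z) / 2` cancel. What remains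
is `N(z) / z²` plus analytic terms, and `N` vanishes to second order. -/
lemma exists_analyticAt_additionDefect_zero (L : PeriodPair) {k : ℂ} (hk : k ∉ L.lattice) :
    ∃ F : ℂ → ℂ, AnalyticAt ℂ F 0 ∧ additionDefect L k =ᶠ[𝓝[≠] 0] F := by
  have hp : AnalyticAt ℂ (L.weierstrassPExcept 0) 0 := L.analyticAt_weierstrassPExcept 0
  have hp' : AnalyticAt ℂ (L.derivWeierstrassPExcept 0) 0 := L.analyticAt_derivWeierstrassPExcept 0
  have he := analyticAt_zetaExcept_zero L
  have hZ : AnalyticAt ℂ (fun z => weierstrassZeta L (z + k)) 0 :=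
    AnalyticAt.comp (g := weierstrassZeta L) (f := fun z => z + k)
      (analyticAt_zeta L (by simpa using hk)) (by fun_prop)
  set D : ℂ → ℂ := fun z =>
    weierstrassZeta L (z + k) - weierstrassZetaExcept L 0 z - weierstrassZeta L k with hD
  have hDa : AnalyticAt ℂ D 0 := by fun_prop
  set N : ℂ → ℂ := fun z => D z + z * (L.weierstrassP k - L.weierstrassPExcept 0 z) with hN
  have hNa : AnalyticAt ℂ N 0 := by fun_prop
  have hN' : HasDerivAt N 0 0 := by
    have d1 : HasDerivAt (fun z => weierstrassZeta L (z + k)) (-L.weierstrassP k) 0 := by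
      have := (hasDerivAt_zeta L (z := 0 + k) (by simpa using hk)).comp_add_const 0 k
      simpa using this
    have d2 : HasDerivAt (weierstrassZetaExcept L 0) (-L.weierstrassPExcept 0 0) 0 := by
      have := he.differentiableAt.hasDerivAt
      rwa [deriv_zetaExcept L 0 (x := 0) (by simp)] at this
    have d3 := (hasDerivAt_id (0 : ℂ)).mul
      (hp.differentiableAt.hasDerivAt.const_sub (L.weierstrassP k))
    refine (((d1.sub d2).sub_const (weierstrassZeta L k)).add d3).congr_deriv ?_
    simp
  have hN0 : N 0 = 0 := by simp [hN, hD, zetaExcept_zero_zero]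
  obtain ⟨g, hg, hNg⟩ : ∃ g : ℂ → ℂ, AnalyticAt ℂ g 0 ∧ ∀ᶠ z in 𝓝 0, N z = (z - 0) ^ 2 • g z := by
    refine (natCast_le_analyticOrderAt (n := 2) hNa).1 ?_
    rw [natCast_le_analyticOrderAt_iff_iteratedDeriv_eq_zero hNa]
    intro i hi
    interval_cases i
    · simpa using hN0
    · simpa using hN'.deriv
  refine ⟨fun z => g z + (L.weierstrassPExcept 0 z - L.weierstrassP k) * D z
    - L.derivWeierstrassPExcept 0 z / 2 + L.derivWeierstrassP k / 2, by fun_prop, ?_⟩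
  filter_upwards [mem_nhdsWithin_of_mem_nhds hNg, self_mem_nhdsWithin] with z hz hz0
  have hz0 : z ≠ 0 := hz0
  have hgz : g z = N z / z ^ 2 := by
    rw [hz]
    simp only [sub_zero, smul_eq_mul]
    field_simp
  rw [hgz, additionDefect, zetaExcept_zero_add L z, weierstrassP_eq_except_add L z,
    derivWeierstrassP_eq_except_sub L z]
  simp only [hN, hD]
  field_simp
  ring

/-- The simple pole of `ζ(z + k)` meets the zero of `℘(z) - ℘(k)`. Their product tends to `℘'(-k) =
-℘'(k)`, which the second term of the defect, equal to `℘'(k)` there, compensates; this value fixes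
the constant in the addition formula. -/
lemma exists_analyticAt_additionDefect_neg (L : PeriodPair) {k : ℂ} (hk : k ∉ L.lattice) :
    ∃ F : ℂ → ℂ, AnalyticAt ℂ F (-k) ∧ F (-k) = 0 ∧ additionDefect L k =ᶠ[𝓝[≠] (-k)] F := by
  have hnk := notMem_lattice_neg L hk
  have h1 := analyticAt_weierstrassP L hnk
  have h2 := analyticAt_derivWeierstrassP L hnk
  have h3 := analyticAt_zeta L hnk
  have h4 : AnalyticAt ℂ (fun z => weierstrassZetaExcept L 0 (z + k)) (-k) := by
    refine AnalyticAt.comp (g := weierstrassZetaExcept L 0) (f := fun z => z + k) ?_ (by fun_prop)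
    simpa using analyticAt_zetaExcept_zero L
  obtain ⟨q, hq, hpq⟩ : ∃ q : ℂ → ℂ, AnalyticAt ℂ q (-k) ∧
      ∀ᶠ z in 𝓝 (-k), L.weierstrassP z - L.weierstrassP k = (z - -k) ^ 1 • q z := by
    have ha : AnalyticAt ℂ (fun z => L.weierstrassP z - L.weierstrassP k) (-k) := by fun_prop
    refine (natCast_le_analyticOrderAt (n := 1) ha).1 ?_
    rw [natCast_le_analyticOrderAt_iff_iteratedDeriv_eq_zero ha]
    intro i hi
    interval_cases i
    simp
  have hqk : q (-k) = -L.derivWeierstrassP k := by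
    have d1 := (hasDerivAt_weierstrassP L hnk).sub_const (L.weierstrassP k)
    have d2 := ((hasDerivAt_id (-k)).sub_const (-k)).mul hq.differentiableAt.hasDerivAt
    have d3 : HasDerivAt (fun z => L.weierstrassP z - L.weierstrassP k) (q (-k)) (-k) := by
      refine (d2.congr_of_eventuallyEq ?_).congr_deriv (by simp)
      filter_upwards [hpq] with z hz
      simpa using! hz
    rw [d3.unique d1, L.derivWeierstrassP_neg]
  refine ⟨fun z => q z + (L.weierstrassP z - L.weierstrassP k) *
      (weierstrassZetaExcept L 0 (z + k) - weierstrassZeta L z - weierstrassZeta L k)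
    - (L.derivWeierstrassP z - L.derivWeierstrassP k) / 2, by fun_prop, ?_, ?_⟩
  · simp only [hqk, L.weierstrassP_neg, L.derivWeierstrassP_neg]
    ring
  · filter_upwards [mem_nhdsWithin_of_mem_nhds hpq, self_mem_nhdsWithin] with z hz hzk
    have hz0 : z + k ≠ 0 := fun h => hzk (eq_neg_of_add_eq_zero_left h)
    have : q z = (L.weierstrassP z - L.weierstrassP k) * (1 / (z + k)) := by
      rw [hz]
      simp only [sub_neg_eq_add, pow_one, smul_eq_mul]
      field_simp
    rw [additionDefect, zetaExcept_zero_add L (z + k)]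
    simp only [this]
    ring

/-- The addition formula of the Weierstrass `ζ`-function. -/
theorem zeta_add_formula (L : PeriodPair) {k z : ℂ} (hk : k ∉ L.lattice) (hz : z ∉ L.lattice)
    (hzk : z + k ∉ L.lattice) :
    (L.weierstrassP z - L.weierstrassP k) *
        (weierstrassZeta L (z + k) - weierstrassZeta L z - weierstrassZeta L k)
      = (L.derivWeierstrassP z - L.derivWeierstrassP k) / 2 := by
  have hper : ∀ z, ∀ l ∈ L.lattice, ∀ᶠ w in 𝓝[≠] z,
      additionDefect L k (w + l) = additionDefect L k w := by
    intro z l hl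
    filter_upwards [eventually_punctured_notMem_lattice L z,
      eventually_punctured_add_notMem_lattice L k z] with w h1 h2
    exact additionDefect_periodic L k hl h1 h2
  obtain ⟨F, hF, hF0, hFe⟩ := exists_analyticAt_additionDefect_neg L hk
  -- Singularities can occur only in the lattice classes of `0` and `-k`, where the two preceding
  -- lemmas apply.
  obtain ⟨c, hc⟩ := eventuallyEq_const_of_periodic_of_removable L (additionDefect L k) hper (by
    intro z
    by_cases h1 : z ∈ L.lattice
    · have := exists_analyticAt_eventuallyEq_add (hper 0 z h1)
        (exists_analyticAt_additionDefect_zero L hk)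
      rwa [zero_add] at this
    by_cases h2 : z + k ∈ L.lattice
    · have := exists_analyticAt_eventuallyEq_add (hper (-k) (z + k) h2) ⟨F, hF, hFe⟩
      rwa [show -k + (z + k) = z by ring] at this
    exact ⟨_, analyticAt_additionDefect L k h1 h2, EventuallyEq.rfl⟩)
  have hc0 : c = 0 := by
    have t1 := (hF.continuousAt.tendsto.mono_left (nhdsWithin_le_nhds (s := {-k}ᶜ)))
    rw [hF0] at t1
    exact tendsto_nhds_unique (tendsto_const_nhds.congr' ((hc (-k)).symm.trans hFe)) t1
  have t2 := ((analyticAt_additionDefect L k hz hzk).continuousAt.tendsto.mono_left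
    (nhdsWithin_le_nhds (s := {z}ᶜ)))
  have := tendsto_nhds_unique t2 (tendsto_const_nhds.congr' (hc z).symm)
  rw [hc0, additionDefect] at this
  exact sub_eq_zero.1 this

/-- Every complex number is a value of `℘`. -/
theorem exists_weierstrassP_eq (L : PeriodPair) (ξ : ℂ) :
    ∃ k ∉ L.lattice, L.weierstrassP k = ξ := by
  by_contra! hno
  -- If `ξ` were omitted, `1 / (℘ - ξ)` would be an elliptic function without poles, hence constant;
  -- it tends to zero at the pole of `℘`, yet never vanishes off the lattice.
  have hper : ∀ z, ∀ l ∈ L.lattice, ∀ᶠ w in 𝓝[≠] z,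
      (fun z => (L.weierstrassP z - ξ)⁻¹) (w + l) = (fun z => (L.weierstrassP z - ξ)⁻¹) w := by
    intro z l hl
    exact Eventually.of_forall fun w => by simp only [weierstrassP_add L w hl]
  set F : ℂ → ℂ := fun z => z ^ 2 / (1 + z ^ 2 * (L.weierstrassPExcept 0 z - ξ)) with hF
  have hp : AnalyticAt ℂ (L.weierstrassPExcept 0) 0 := L.analyticAt_weierstrassPExcept 0
  have hFa : AnalyticAt ℂ F 0 := by
    refine AnalyticAt.div (by fun_prop) (by fun_prop) (by simp)
  have hFe : (fun z => (L.weierstrassP z - ξ)⁻¹) =ᶠ[𝓝[≠] 0] F := by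
    filter_upwards [self_mem_nhdsWithin] with z hz
    have hz : z ≠ 0 := hz
    rw [weierstrassP_eq_except_add L z, hF,
      show L.weierstrassPExcept 0 z + 1 / z ^ 2 - ξ
        = (1 + z ^ 2 * (L.weierstrassPExcept 0 z - ξ)) / z ^ 2 by field_simp; ring, inv_div]
  obtain ⟨c, hc⟩ := eventuallyEq_const_of_periodic_of_removable L _ hper (by
    intro z
    by_cases h1 : z ∈ L.lattice
    · have := exists_analyticAt_eventuallyEq_add (hper 0 z h1) ⟨F, hFa, hFe⟩
      rwa [zero_add] at this
    · exact ⟨_, ((analyticAt_weierstrassP L h1).sub analyticAt_const).inv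
        (sub_ne_zero.2 (hno z h1)), EventuallyEq.rfl⟩)
  have hc0 : c = 0 := by
    have t1 := (hFa.continuousAt.tendsto.mono_left (nhdsWithin_le_nhds (s := {0}ᶜ)))
    have hF0 : F 0 = 0 := by simp [hF]
    rw [hF0] at t1
    exact tendsto_nhds_unique (tendsto_const_nhds.congr' ((hc 0).symm.trans hFe)) t1
  obtain ⟨w, h1, h2⟩ := ((hc 0).and (eventually_punctured_notMem_lattice L 0)).exists
  rw [hc0] at h1
  exact inv_ne_zero (sub_ne_zero.2 (hno w h2)) h1

/-- A nonzero polynomial in `℘` has isolated zeros. -/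
theorem eventually_eval_weierstrassP_ne_zero (L : PeriodPair) {X : Polynomial ℂ} (hX : X ≠ 0)
    {z : ℂ} (hz : z ∉ L.lattice) :
    ∀ᶠ w in 𝓝[≠] z, w ∉ L.lattice ∧ X.eval (L.weierstrassP w) ≠ 0 := by
  refine (eventually_punctured_notMem_lattice L z).and ?_
  have ha : AnalyticOnNhd ℂ (fun w => X.eval (L.weierstrassP w)) (L.lattice : Set ℂ)ᶜ := by
    intro w hw
    exact AnalyticAt.aeval_polynomial (analyticAt_weierstrassP L hw) X
  by_contra hcon
  have h0 := ha.eqOn_zero_of_preconnected_of_frequently_eq_zero (isPreconnected_compl_lattice L)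
    hz hcon
  -- Otherwise `X(℘)` vanishes identically and, `℘` being surjective, every complex number is a root
  -- of `X`.
  obtain ⟨ξ, hξ⟩ := X.roots.toFinset.exists_notMem
  obtain ⟨k, hk, rfl⟩ := exists_weierstrassP_eq L ξ
  exact hξ (by simpa [hX] using h0 hk)

/-- The zeros of `℘'` are half-periods. -/
theorem two_mul_mem_lattice_of_derivWeierstrassP_eq_zero (L : PeriodPair) {k : ℂ}
    (hk : k ∉ L.lattice) (h : L.derivWeierstrassP k = 0) : 2 * k ∈ L.lattice := by
  by_contra h2
  have hnk := notMem_lattice_neg L hk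
  -- With `℘'(k) = 0` the addition formulas for `k` and `-k` have equal right sides, so `ζ(z + k) -
  -- ζ(z - k) - 2 ζ(k) = 0`. This is multiplied by `z + k`; if `2k` is no period, the result is
  -- regular at `-k` with value `1`, a contradiction.
  have hev : ∀ᶠ z in 𝓝[≠] (-k), 1 + (z + k) * (weierstrassZetaExcept L 0 (z + k)
      - weierstrassZeta L (z - k) - 2 * weierstrassZeta L k) = 0 := by
    filter_upwards [eventually_eval_weierstrassP_ne_zero L
        (X := Polynomial.X - Polynomial.C (L.weierstrassP k)) (Polynomial.X_sub_C_ne_zero _) hnk,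
      eventually_punctured_add_notMem_lattice L k (-k),
      eventually_punctured_add_notMem_lattice L (-k) (-k)] with z h3 h4 h5
    have h6 : L.weierstrassP z - L.weierstrassP k ≠ 0 := by simpa using h3.2
    have e1 := zeta_add_formula L hk h3.1 h4
    have e2 := zeta_add_formula L hnk h3.1 h5
    rw [L.weierstrassP_neg, L.derivWeierstrassP_neg, zeta_neg, h] at e2
    rw [h] at e1
    have e3 : weierstrassZeta L (z + k) - weierstrassZeta L (z - k) - 2 * weierstrassZeta L k
        = 0 := by
      refine (mul_eq_zero.1 (?_ : (L.weierstrassP z - L.weierstrassP k) * _ = 0)).resolve_left h6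
      rw [← sub_eq_add_neg] at e2
      linear_combination e1 - e2
    rw [zetaExcept_zero_add] at e3
    have h7 : z + k ≠ 0 := fun h => h4 (h ▸ zero_mem _)
    field_simp at e3
    linear_combination e3
  have h4 : AnalyticAt ℂ (fun z => weierstrassZetaExcept L 0 (z + k)) (-k) := by
    refine AnalyticAt.comp (g := weierstrassZetaExcept L 0) (f := fun z => z + k) ?_ (by fun_prop)
    simpa using analyticAt_zetaExcept_zero L
  have h5 : AnalyticAt ℂ (fun z => weierstrassZeta L (z - k)) (-k) := by
    refine AnalyticAt.comp (g := weierstrassZeta L) (f := fun z => z - k) ?_ (by fun_prop)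
    refine analyticAt_zeta L fun h => h2 ?_
    have := neg_mem h
    rwa [show -(-k - k) = 2 * k by ring] at this
  have h6 : AnalyticAt ℂ (fun z => 1 + (z + k) * (weierstrassZetaExcept L 0 (z + k)
      - weierstrassZeta L (z - k) - 2 * weierstrassZeta L k)) (-k) := by fun_prop
  have := tendsto_nhds_unique
    (h6.continuousAt.tendsto.mono_left (nhdsWithin_le_nhds (s := {-k}ᶜ)))
    (tendsto_const_nhds.congr' (hev.mono fun z hz => hz.symm))
  simp at this

end Lame

namespace Lame

open Filter Topology

/-! ### Hermite's product solutions -/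

/-- The product `∏ j, σ(z + k j) / σ(z) * exp (-z ζ(k j))`. -/
noncomputable def hermiteProduct (L : PeriodPair) {m : ℕ} (k : Fin m → ℂ) (z : ℂ) : ℂ :=
  ∏ j, (weierstrassSigma L (z + k j) / weierstrassSigma L z *
    Complex.exp (-(weierstrassZeta L (k j) * z)))

lemma differentiableOn_hermiteProduct (L : PeriodPair) {m : ℕ} (k : Fin m → ℂ) :
    DifferentiableOn ℂ (hermiteProduct L k) (L.lattice : Set ℂ)ᶜ := by
  refine DifferentiableOn.fun_finsetProd fun j _ => ?_
  refine DifferentiableOn.mul (DifferentiableOn.div ?_ ?_ fun z hz => sigma_ne_zero L hz) ?_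
  · exact ((differentiable_sigma L).comp (differentiable_id.add_const _)).differentiableOn
  · exact (differentiable_sigma L).differentiableOn
  · exact (differentiable_id.const_mul _).neg.cexp.differentiableOn

lemma hermiteProduct_ne_zero (L : PeriodPair) {m : ℕ} (k : Fin m → ℂ) {z : ℂ}
    (hz : z ∉ L.lattice) (hk : ∀ j, z + k j ∉ L.lattice) : hermiteProduct L k z ≠ 0 :=
  Finset.prod_ne_zero_iff.2 fun j _ => mul_ne_zero
    (div_ne_zero (sigma_ne_zero L (hk j)) (sigma_ne_zero L hz)) (Complex.exp_ne_zero _)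

/-- In each quotient `σ(z + k j) / σ(z)` the constant and the `z`-dependent exponentials cancel,
which leaves `exp (2 η k j)`; the exponential factor contributes `exp (-2 ω ζ(k j))`. -/
lemma hermiteProduct_add_two_mul (L : PeriodPair) {m : ℕ} (k : Fin m → ℂ) {ω : ℂ}
    (h : 2 * ω ∈ L.lattice) (z : ℂ) :
    hermiteProduct L k (z + 2 * ω)
      = Complex.exp (2 * hermiteExponent L ω k) * hermiteProduct L k z := by
  obtain ⟨c, hc, hσ⟩ := exists_sigma_add_two_mul L h
  have h1 : Complex.exp (2 * hermiteExponent L ω k)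
      = ∏ j, Complex.exp (2 * eta L ω * k j - 2 * ω * weierstrassZeta L (k j)) := by
    rw [← Complex.exp_sum]
    congr 1
    rw [hermiteExponent, Finset.sum_sub_distrib, ← Finset.mul_sum, ← Finset.mul_sum]
    ring
  rw [h1, hermiteProduct, hermiteProduct, ← Finset.prod_mul_distrib]
  refine Finset.prod_congr rfl fun j _ => ?_
  rw [show z + 2 * ω + k j = z + k j + 2 * ω by ring, hσ, hσ,
    show 2 * eta L ω * (z + k j) = 2 * eta L ω * z + 2 * eta L ω * k j by ring, Complex.exp_add,
    show -(weierstrassZeta L (k j) * (z + 2 * ω))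
      = -(weierstrassZeta L (k j) * z) + -(2 * ω * weierstrassZeta L (k j)) by ring,
    Complex.exp_add, sub_eq_add_neg, Complex.exp_add]
  have := Complex.exp_ne_zero (2 * eta L ω * z)
  field_simp

lemma hasDerivAt_hermiteProduct (L : PeriodPair) {m : ℕ} (k : Fin m → ℂ) {z : ℂ}
    (hz : z ∉ L.lattice) (hk : ∀ j, z + k j ∉ L.lattice) :
    HasDerivAt (hermiteProduct L k)
      ((∑ j, (weierstrassZeta L (z + k j) - weierstrassZeta L z - weierstrassZeta L (k j)))
        * hermiteProduct L k z) z := by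
  have hfac : ∀ j, HasDerivAt (fun z => weierstrassSigma L (z + k j) / weierstrassSigma L z *
      Complex.exp (-(weierstrassZeta L (k j) * z)))
      ((weierstrassZeta L (z + k j) - weierstrassZeta L z - weierstrassZeta L (k j)) *
        (weierstrassSigma L (z + k j) / weierstrassSigma L z *
          Complex.exp (-(weierstrassZeta L (k j) * z)))) z := by
    intro j
    have h1 := (hasDerivAt_sigma L (hk j)).comp_add_const z (k j)
    have h2 := hasDerivAt_sigma L hz
    have h3 := ((hasDerivAt_id z).const_mul (weierstrassZeta L (k j))).neg.cexp
    have h0 := sigma_ne_zero L hz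
    refine ((h1.div h2 h0).mul h3).congr_deriv ?_
    simp only [id, Pi.neg_apply, Pi.div_apply]
    field_simp
    ring
  have := HasDerivAt.fun_finsetProd (u := Finset.univ) fun j _ => hfac j
  refine this.congr_deriv ?_
  rw [Finset.sum_mul]
  refine Finset.sum_congr rfl fun i _ => ?_
  rw [hermiteProduct, ← Finset.mul_prod_erase Finset.univ _ (Finset.mem_univ i), smul_eq_mul]
  ring

/-! ### The polynomial of the parameters -/

lemma eval_hermitePoly (L : PeriodPair) {m : ℕ} (k : Fin m → ℂ) (ξ : ℂ) :
    (hermitePoly L k).eval ξ = ∏ j, (ξ - L.weierstrassP (k j)) := by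
  simp [hermitePoly, Polynomial.eval_prod]

lemma hermitePoly_ne_zero (L : PeriodPair) {m : ℕ} (k : Fin m → ℂ) : hermitePoly L k ≠ 0 :=
  Finset.prod_ne_zero_iff.2 fun _ _ => Polynomial.X_sub_C_ne_zero _

lemma hermitePoly_neg (L : PeriodPair) {m : ℕ} (k : Fin m → ℂ) :
    hermitePoly L (-k) = hermitePoly L k := by
  simp [hermitePoly, L.weierstrassP_neg]

lemma sub_ne_zero_of_eval_hermitePoly_ne_zero (L : PeriodPair) {m : ℕ} {k : Fin m → ℂ} {ξ : ℂ}
    (h : (hermitePoly L k).eval ξ ≠ 0) (j : Fin m) : ξ - L.weierstrassP (k j) ≠ 0 := by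
  rw [eval_hermitePoly] at h
  exact Finset.prod_ne_zero_iff.1 h j (Finset.mem_univ j)

lemma add_notMem_lattice_of_eval_hermitePoly_ne_zero (L : PeriodPair) {m : ℕ} {k : Fin m → ℂ}
    {z : ℂ} (h : (hermitePoly L k).eval (L.weierstrassP z) ≠ 0) (j : Fin m) :
    z + k j ∉ L.lattice := by
  intro hmem
  refine sub_ne_zero_of_eval_hermitePoly_ne_zero L h j ?_
  have := weierstrassP_add L (-k j) hmem
  rw [show -k j + (z + k j) = z by ring, L.weierstrassP_neg] at this
  rw [this, sub_self]

lemma sum_inv_eq_derivative_div (L : PeriodPair) {m : ℕ} {k : Fin m → ℂ} {ξ : ℂ}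
    (h : (hermitePoly L k).eval ξ ≠ 0) :
    (∑ j, 1 / (ξ - L.weierstrassP (k j))) * (hermitePoly L k).eval ξ
      = (hermitePoly L k).derivative.eval ξ := by
  rw [hermitePoly, Polynomial.derivative_prod_finset, Polynomial.eval_finsetSum, Finset.sum_mul]
  refine Finset.sum_congr rfl fun j _ => ?_
  have h1 := sub_ne_zero_of_eval_hermitePoly_ne_zero L h j
  rw [← Finset.mul_prod_erase Finset.univ _ (Finset.mem_univ j)]
  simp
  field_simp

/-- The two sign conditions in the definition of Hermite parameters. -/
def SignCondition (L : PeriodPair) {m : ℕ} (k : Fin m → ℂ) (C : ℂ) : Prop :=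
  (C ≠ 0 → ∀ j, (hermitePoly L k).derivative.eval (L.weierstrassP (k j)) *
    L.derivWeierstrassP (k j) = C) ∧
  (C = 0 → ∃ τ : Equiv.Perm (Fin m), ∀ j, k j + k (τ j) ∈ L.lattice)

/-- Changing the signs of `k` and `C` corresponds to exchanging the two solutions, so every
statement about the first one transfers to the second. -/
lemma SignCondition.neg {L : PeriodPair} {m : ℕ} {k : Fin m → ℂ} {C : ℂ}
    (h : SignCondition L k C) : SignCondition L (-k) (-C) := by
  refine ⟨fun hC j => ?_, fun hC => ?_⟩
  · rw [hermitePoly_neg, Pi.neg_apply, L.weierstrassP_neg, L.derivWeierstrassP_neg, mul_neg,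
      h.1 (by simpa using hC) j]
  · obtain ⟨τ, hτ⟩ := h.2 (by simpa using hC)
    refine ⟨τ, fun j => ?_⟩
    have := neg_mem (hτ j)
    simpa [neg_add, add_comm] using this

/-- Partial fractions for `C / X`. -/
lemma SignCondition.sum_div {L : PeriodPair} {m : ℕ} (hm : 1 ≤ m) {k : Fin m → ℂ} {C : ℂ}
    (h : SignCondition L k C) {ξ : ℂ} (hξ : (hermitePoly L k).eval ξ ≠ 0) :
    (∑ j, L.derivWeierstrassP (k j) / (ξ - L.weierstrassP (k j))) * (hermitePoly L k).eval ξ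
      = C := by
  by_cases hC : C = 0
  · obtain ⟨τ, hτ⟩ := h.2 hC
    set g : Fin m → ℂ := fun j => L.derivWeierstrassP (k j) / (ξ - L.weierstrassP (k j)) with hg
    -- Since `k (τ j) ≡ -k j` modulo the lattice, evenness of `℘` and oddness of `℘'` make the
    -- permuted terms opposite.
    have h1 : ∀ j, g (τ j) = -g j := by
      intro j
      have e1 := weierstrassP_add L (-k j) (hτ j)
      have e2 := derivWeierstrassP_add L (-k j) (hτ j)
      rw [neg_add_cancel_left, L.weierstrassP_neg] at e1
      rw [neg_add_cancel_left, L.derivWeierstrassP_neg] at e2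
      simp only [hg, e1, e2, neg_div]
    have h2 : ∑ j, g j = -∑ j, g j := by
      rw [← Finset.sum_neg_distrib, ← Equiv.sum_comp τ]
      exact Finset.sum_congr rfl fun j _ => h1 j
    rw [self_eq_neg.1 h2, zero_mul, hC]
  · have h1 := h.1 hC
    set v : Fin m → ℂ := fun j => L.weierstrassP (k j) with hv
    have hnod : hermitePoly L k = Lagrange.nodal Finset.univ v := rfl
    have hd : ∀ j, (hermitePoly L k).derivative.eval (v j) ≠ 0 := fun j h0 => by
      apply hC
      rw [← h1 j, h0, zero_mul]
    -- A repeated root would annihilate `X'` and hence `C`. With distinct nodes, Lagrange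
    -- interpolation of the constant `1` is the partial fraction expansion of `1 / X`.
    have hinj : Set.InjOn v (Finset.univ : Finset (Fin m)) := by
      intro i _ j _ hij
      by_contra hne
      apply hd j
      rw [hnod, Lagrange.eval_nodal_derivative_eval_node_eq (Finset.mem_univ j)]
      rw [← hij]
      exact Lagrange.eval_nodal_at_node (Finset.mem_erase.2 ⟨hne, Finset.mem_univ i⟩)
    have hne : ∀ i ∈ (Finset.univ : Finset (Fin m)), ξ ≠ v i := fun j _ =>
      sub_ne_zero.1 (sub_ne_zero_of_eval_hermitePoly_ne_zero L hξ j)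
    have key := Lagrange.eval_interpolate_not_at_node (r := (1 : Fin m → ℂ)) hne
    rw [Lagrange.interpolate_one hinj ⟨⟨0, hm⟩, Finset.mem_univ _⟩, Polynomial.eval_one, ← hnod]
      at key
    calc _ = C * ((hermitePoly L k).eval ξ *
          ∑ i, Lagrange.nodalWeight Finset.univ v i * (ξ - v i)⁻¹ * (1 : Fin m → ℂ) i) := by
          rw [mul_comm, mul_left_comm, Finset.mul_sum (a := C)]
          congr 1
          refine Finset.sum_congr rfl fun j _ => ?_
          rw [Lagrange.nodalWeight_eq_eval_derivative_nodal (Finset.mem_univ j), ← hnod,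
            ← h1 j, Pi.one_apply]
          have := hd j
          simp only [hv] at this ⊢
          field_simp
      _ = C := by rw [← key, mul_one]

/-- The logarithmic derivative of Hermite's product is `(P' - C) / (2 P)` for `P = X(℘)`. -/
lemma SignCondition.hasDerivAt_hermiteProduct {L : PeriodPair} {m : ℕ} (hm : 1 ≤ m)
    {k : Fin m → ℂ} {C : ℂ} (h : SignCondition L k C) (hk : ∀ j, k j ∉ L.lattice) {z : ℂ}
    (hz : z ∉ L.lattice) (hP : (hermitePoly L k).eval (L.weierstrassP z) ≠ 0) :
    HasDerivAt (hermiteProduct L k)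
      (((hermitePoly L k).derivative.eval (L.weierstrassP z) * L.derivWeierstrassP z - C) /
        (2 * (hermitePoly L k).eval (L.weierstrassP z)) * hermiteProduct L k z) z := by
  have hzk := add_notMem_lattice_of_eval_hermitePoly_ne_zero L hP
  refine (Lame.hasDerivAt_hermiteProduct L k hz hzk).congr_deriv ?_
  congr 1
  rw [eq_div_iff (by simpa using hP)]
  have h1 : ∀ j, weierstrassZeta L (z + k j) - weierstrassZeta L z - weierstrassZeta L (k j)
      = (1 / (L.weierstrassP z - L.weierstrassP (k j)) * L.derivWeierstrassP z
        - L.derivWeierstrassP (k j) / (L.weierstrassP z - L.weierstrassP (k j))) / 2 := by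
    intro j
    have h0 := sub_ne_zero_of_eval_hermitePoly_ne_zero L hP j
    have := zeta_add_formula L (hk j) hz (hzk j)
    field_simp
    linear_combination 2 * this
  simp only [h1]
  rw [← sum_inv_eq_derivative_div L hP, ← Finset.sum_div, Finset.sum_sub_distrib,
    ← Finset.sum_mul]
  linear_combination -h.sum_div hm hP

lemma hasDerivAt_eval_weierstrassP (L : PeriodPair) (X : Polynomial ℂ) {z : ℂ}
    (hz : z ∉ L.lattice) :
    HasDerivAt (fun z => X.eval (L.weierstrassP z))
      (X.derivative.eval (L.weierstrassP z) * L.derivWeierstrassP z) z :=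
  (X.hasDerivAt (L.weierstrassP z)).comp z (hasDerivAt_weierstrassP L hz)

/-- A function with the logarithmic derivative of Hermite's product has the same multipliers. -/
lemma SignCondition.add_two_mul {L : PeriodPair} {m : ℕ} (hm : 1 ≤ m)
    {k : Fin m → ℂ} {C : ℂ} (h : SignCondition L k C) (hk : ∀ j, k j ∉ L.lattice) {ψ : ℂ → ℂ}
    (hψ : DifferentiableOn ℂ ψ (L.lattice : Set ℂ)ᶜ)
    (hlog : ∀ z ∉ L.lattice, 2 * (hermitePoly L k).eval (L.weierstrassP z) * deriv ψ z
      = ((hermitePoly L k).derivative.eval (L.weierstrassP z) * L.derivWeierstrassP z - C) * ψ z)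
    {ω : ℂ} (hω : 2 * ω ∈ L.lattice) {z : ℂ} (hz : z ∉ L.lattice) :
    ψ (z + 2 * ω) = Complex.exp (2 * hermiteExponent L ω k) * ψ z := by
  obtain ⟨z₁, hz₁, hP⟩ := (eventually_eval_weierstrassP_ne_zero L (hermitePoly_ne_zero L k)
    L.ω₁_div_two_notMem_lattice).exists
  -- Equal logarithmic derivatives make `ψ` a constant multiple of Hermite's product, whose
  -- multiplier is explicit.
  obtain ⟨c, hc⟩ := exists_eq_const_mul_of_wronskian_eq_zero L hψ
    (differentiableOn_hermiteProduct L k) (fun z hz => by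
      filter_upwards [eventually_eval_weierstrassP_ne_zero L (hermitePoly_ne_zero L k) hz]
        with w hw
      rw [(h.hasDerivAt_hermiteProduct hm hk hw.1 hw.2).deriv]
      have h1 := hlog w hw.1
      have h2 := hw.2
      field_simp
      linear_combination hermiteProduct L k w * h1) hz₁
    (hermiteProduct_ne_zero L k hz₁ (add_notMem_lattice_of_eval_hermitePoly_ne_zero L hP))
  rw [hc _ (notMem_lattice_add L hz hω), hc z hz, hermiteProduct_add_two_mul L k hω]
  ring

lemma hermiteExponent_neg (L : PeriodPair) (ω : ℂ) {m : ℕ} (k : Fin m → ℂ) :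
    hermiteExponent L ω (-k) = -hermiteExponent L ω k := by
  simp [hermiteExponent, zeta_neg]
  ring

end Lame

namespace Lame

open Polynomial

/-! ### The polynomial solutions of Hermite's third order equation -/

/-- The cubic `4 ξ³ - g₂ ξ - g₃`. -/
noncomputable def weierstrassCubic (g₂ g₃ : ℂ) : ℂ[X] := 4 * X ^ 3 - C g₂ * X - C g₃

/-- Half of the derivative of the cubic. -/
noncomputable def weierstrassQuadratic (g₂ : ℂ) : ℂ[X] := 6 * X ^ 2 - C (g₂ / 2)

/-- The equation for the products of two solutions of `ψ'' = (a ℘ - E) ψ`, in the variable `℘`. -/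
noncomputable def hermiteOperator (g₂ g₃ a E : ℂ) : ℂ[X] →ₗ[ℂ] ℂ[X] :=
  LinearMap.mulLeft ℂ (weierstrassCubic g₂ g₃) ∘ₗ derivative ∘ₗ derivative ∘ₗ derivative
  + LinearMap.mulLeft ℂ (3 * weierstrassQuadratic g₂) ∘ₗ derivative ∘ₗ derivative
  + LinearMap.mulLeft ℂ (12 * X - 4 * C a * X + 4 * C E) ∘ₗ derivative
  - (2 * a) • LinearMap.id

lemma hermiteOperator_apply (g₂ g₃ a E : ℂ) (f : ℂ[X]) :
    hermiteOperator g₂ g₃ a E f = weierstrassCubic g₂ g₃ * derivative (derivative (derivative f))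
      + 3 * weierstrassQuadratic g₂ * derivative (derivative f)
      + (12 * X - 4 * C a * X + 4 * C E) * derivative f - C (2 * a) * f := by
  simp [hermiteOperator, smul_eq_C_mul, mul_assoc]

lemma coeff_X_mul_derivative (f : ℂ[X]) (j : ℕ) : (X * derivative f).coeff j = j * f.coeff j := by
  cases j with
  | zero => simp
  | succ n => rw [coeff_X_mul, coeff_derivative]; push_cast; ring

lemma coeff_X_sq_mul_derivative (f : ℂ[X]) (j : ℕ) :
    (X ^ 2 * derivative (derivative f)).coeff j = j * (j - 1) * f.coeff j := by
  have : X ^ 2 * derivative (derivative f) = X * derivative (X * derivative f) - X * derivative f := by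
    simp only [derivative_mul, derivative_X]
    ring
  rw [this, coeff_sub, coeff_X_mul_derivative, coeff_X_mul_derivative]
  ring

lemma coeff_X_cube_mul_derivative (f : ℂ[X]) (j : ℕ) :
    (X ^ 3 * derivative (derivative (derivative f))).coeff j
      = j * (j - 1) * (j - 2) * f.coeff j := by
  have : X ^ 3 * derivative (derivative (derivative f))
      = X * derivative (X ^ 2 * derivative (derivative f))
        - 2 * (X ^ 2 * derivative (derivative f)) := by
    simp only [derivative_mul, derivative_X_sq, C_ofNat]
    ring
  rw [this, coeff_sub, coeff_X_mul_derivative, coeff_ofNat_mul, coeff_X_sq_mul_derivative]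
  ring

/-- Only terms that preserve the degree count: `4n(n-1)(n-2) + 18n(n-1) + 12n - 4an - 2a` factors as
stated, while `g₂`, `g₃` and `E` enter in lower degrees. -/
lemma coeff_hermiteOperator_of_natDegree_le (g₂ g₃ a E : ℂ) {f : ℂ[X]} {n : ℕ}
    (hf : f.natDegree ≤ n) :
    (hermiteOperator g₂ g₃ a E f).coeff n
      = 2 * (2 * n + 1) * (n * (n + 1) - a) * f.coeff n := by
  have h0 : ∀ i, n < i → f.coeff i = 0 := fun i hi =>
    coeff_eq_zero_of_natDegree_lt (lt_of_le_of_lt hf hi)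
  have e : hermiteOperator g₂ g₃ a E f
      = 4 * (X ^ 3 * derivative (derivative (derivative f)))
      - C g₂ * (X * derivative (derivative (derivative f)))
      - C g₃ * derivative (derivative (derivative f))
      + 18 * (X ^ 2 * derivative (derivative f))
      - 3 * (C (g₂ / 2) * derivative (derivative f))
      + 12 * (X * derivative f) - 4 * (C a * (X * derivative f))
      + 4 * (C E * derivative f) - C (2 * a) * f := by
    rw [hermiteOperator_apply, weierstrassCubic, weierstrassQuadratic]
    ring
  rw [e]
  simp only [coeff_add, coeff_sub, coeff_C_mul, coeff_ofNat_mul, coeff_X_mul_derivative, coeff_X_sq_mul_derivative,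
    coeff_X_cube_mul_derivative]
  simp only [coeff_derivative, h0 (n + 1) (by omega), h0 (n + 1 + 1) (by omega),
    h0 (n + 1 + 1 + 1) (by omega)]
  ring

/-- Hermite's third order equation has a monic polynomial solution of degree `m`. -/
theorem exists_monic_hermiteOperator_eq_zero (g₂ g₃ E : ℂ) (m : ℕ) :
    ∃ f : ℂ[X], f.Monic ∧ f.natDegree = m ∧ hermiteOperator g₂ g₃ (m * (m + 1)) E f = 0 := by
  set D := hermiteOperator g₂ g₃ (m * (m + 1)) E with hD
  -- For `a = m(m+1)` the coefficient in degree `m` is annihilated, so a space of dimension `m + 1`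
  -- is mapped into one of dimension `m`.
  have hmaps : ∀ f ∈ degreeLT ℂ (m + 1), D f ∈ degreeLT ℂ m := by
    intro f hf
    rw [mem_degreeLT] at hf ⊢
    rw [degree_lt_iff_coeff_zero]
    rw [degree_lt_iff_coeff_zero] at hf
    intro n hn
    rw [hD, coeff_hermiteOperator_of_natDegree_le]
    · rcases hn.eq_or_lt with rfl | hn
      · ring
      · rw [hf n hn, mul_zero]
    · exact natDegree_le_iff_coeff_eq_zero.2 fun i hi => hf i (by omega)
  have : FiniteDimensional ℂ (degreeLT ℂ (m + 1)) :=
    (degreeLTEquiv ℂ (m + 1)).symm.finiteDimensional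
  have : FiniteDimensional ℂ (degreeLT ℂ m) := (degreeLTEquiv ℂ m).symm.finiteDimensional
  have hker := LinearMap.ker_ne_bot_of_finrank_lt (f := D.restrict hmaps) (by
    rw [(degreeLTEquiv ℂ (m + 1)).finrank_eq, (degreeLTEquiv ℂ m).finrank_eq]
    simp)
  obtain ⟨⟨g, hg⟩, hg0, hgne⟩ := Submodule.exists_mem_ne_zero_of_ne_bot hker
  have hDg : D g = 0 := by simpa [LinearMap.restrict_apply] using congrArg Subtype.val hg0
  have hgne : g ≠ 0 := fun h => hgne (Subtype.ext h)
  -- The leading coefficient of `D g` vanishes, which forces `n(n+1) = m(m+1)` for the degree `n` of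
  -- `g`.
  have hdeg : g.natDegree = m := by
    have h1 := coeff_hermiteOperator_of_natDegree_le g₂ g₃ (m * (m + 1)) E (le_refl g.natDegree)
    rw [← hD, hDg, coeff_zero] at h1
    have h2 : g.coeff g.natDegree ≠ 0 := leadingCoeff_ne_zero.2 hgne
    have h3 : ((g.natDegree * (g.natDegree + 1) : ℕ) : ℂ) = ((m * (m + 1) : ℕ) : ℂ) := by
      have h4 : (2 * (g.natDegree : ℂ) + 1) ≠ 0 := by exact_mod_cast Nat.succ_ne_zero (2 * g.natDegree)
      have h5 : 2 * (2 * (g.natDegree : ℂ) + 1) ≠ 0 := mul_ne_zero two_ne_zero h4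
      have := (mul_eq_zero.1 ((mul_eq_zero.1 h1.symm).resolve_right h2)).resolve_left h5
      push_cast
      linear_combination this
    have h4 := Nat.cast_injective h3
    rcases lt_trichotomy g.natDegree m with h | h | h
    · nlinarith
    · exact h
    · nlinarith
  have hlead : g.leadingCoeff⁻¹ ≠ 0 := inv_ne_zero (leadingCoeff_ne_zero.2 hgne)
  refine ⟨C g.leadingCoeff⁻¹ * g, ?_, ?_, ?_⟩
  · rw [Monic, leadingCoeff_mul, leadingCoeff_C,
      inv_mul_cancel₀ (leadingCoeff_ne_zero.2 hgne)]
  · rw [natDegree_C_mul hlead, hdeg]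
  · rw [← smul_eq_C_mul, map_smul, hDg, smul_zero]

/-- The first integral of Hermite's equation, whose constant value is the squared Wronskian. -/
noncomputable def hermiteFirstIntegral (g₂ g₃ a E : ℂ) (f : ℂ[X]) : ℂ[X] :=
  weierstrassCubic g₂ g₃ * derivative f ^ 2
    - 2 * f * (weierstrassCubic g₂ g₃ * derivative (derivative f)
      + weierstrassQuadratic g₂ * derivative f)
    + 4 * (C a * X - C E) * f ^ 2

/-- The derivative of the first integral is `-2 f` times the third order operator applied to `f`, so
it is constant. The sign of the root `c` amounts to the order of the two solutions. -/
theorem exists_hermiteFirstIntegral_eq (g₂ g₃ a E : ℂ) {f : ℂ[X]}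
    (hf : hermiteOperator g₂ g₃ a E f = 0) :
    ∃ c : ℂ, hermiteFirstIntegral g₂ g₃ a E f = C (c ^ 2) := by
  set Q := hermiteFirstIntegral g₂ g₃ a E f with hQ
  have hg : C g₂ = 2 * C (g₂ / 2) := by
    rw [← C_ofNat, ← C_mul]
    congr 1
    ring
  have h1 : derivative (weierstrassCubic g₂ g₃) = 2 * weierstrassQuadratic g₂ := by
    simp only [weierstrassCubic, weierstrassQuadratic, derivative_sub, derivative_mul,
      derivative_C, derivative_X_pow, derivative_X, derivative_ofNat, hg]
    push_cast
    simp only [C_ofNat]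
    ring
  have h2 : derivative (weierstrassQuadratic g₂) = 12 * X := by
    simp only [weierstrassQuadratic, derivative_sub, derivative_mul,
      derivative_C, derivative_X_pow, derivative_ofNat]
    push_cast
    simp only [C_ofNat]
    ring
  have hder : derivative Q = 0 := by
    have : derivative Q = -2 * f * hermiteOperator g₂ g₃ a E f := by
      rw [hermiteOperator_apply, hQ, hermiteFirstIntegral]
      simp only [derivative_add, derivative_sub, derivative_mul, derivative_pow, h1, h2,
        derivative_C, derivative_X, derivative_ofNat, C_mul, C_ofNat]
      push_cast
      simp only [C_ofNat]
      ring
    rw [this, hf, mul_zero]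
  obtain ⟨c, hc⟩ := IsAlgClosed.exists_pow_nat_eq (Q.coeff 0) two_pos
  exact ⟨c, by rw [hc]; exact eq_C_of_derivative_eq_zero hder⟩

end Lame

/-! ### Hermite parameters from the roots of the polynomial solution -/

namespace Lame

open Polynomial

lemma X_sub_C_mul_derivative_pow (b : ℂ) (n : ℕ) :
    (X - C b) * derivative ((X - C b) ^ n) = (n : ℂ[X]) * (X - C b) ^ n := by
  cases n with
  | zero => simp
  | succ n =>
    rw [derivative_X_sub_C_pow, Nat.add_sub_cancel, C_eq_natCast]
    ring

/-- If the first integral vanishes, the zeros outside the branch points are double. -/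
lemma rootMultiplicity_eq_two {g₂ g₃ a E : ℂ} {f : ℂ[X]} (hf : f ≠ 0)
    (h : hermiteFirstIntegral g₂ g₃ a E f = 0) {b : ℂ} (hb : f.IsRoot b)
    (hp : (weierstrassCubic g₂ g₃).eval b ≠ 0) : f.rootMultiplicity b = 2 := by
  set r := f.rootMultiplicity b with hr
  obtain ⟨Y, hY, hYb⟩ := exists_eq_pow_rootMultiplicity_mul_and_not_dvd f hf b
  rw [← hr] at hY
  have hYb' : Y.eval b ≠ 0 := fun h0 => hYb (dvd_iff_isRoot.2 h0)
  set T : ℂ[X] := X - C b with hT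
  have hT' : derivative T = 1 := by simp [hT]
  have e1 : T * derivative f = T ^ r * ((r : ℂ[X]) * Y + T * derivative Y) := by
    rw [hY, derivative_mul]
    linear_combination Y * X_sub_C_mul_derivative_pow b r
  have e2 : T ^ 2 * derivative (derivative f) = T ^ r * (((r : ℂ[X]) * ((r : ℂ[X]) - 1)) * Y
      + 2 * (r : ℂ[X]) * T * derivative Y + T ^ 2 * derivative (derivative Y)) := by
    have e3 := congrArg derivative e1
    simp only [derivative_mul, derivative_add, derivative_natCast, hT'] at e3
    have := X_sub_C_mul_derivative_pow b r
    rw [← hT] at this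
    linear_combination T * e3 - e1 + ((r : ℂ[X]) * Y + T * derivative Y) * this
  have e4 : T ^ (2 * r) * (weierstrassCubic g₂ g₃ * ((r : ℂ[X]) * Y + T * derivative Y) ^ 2
      - 2 * Y * (weierstrassCubic g₂ g₃ * (((r : ℂ[X]) * ((r : ℂ[X]) - 1)) * Y
      + 2 * (r : ℂ[X]) * T * derivative Y + T ^ 2 * derivative (derivative Y))
      + weierstrassQuadratic g₂ * T * ((r : ℂ[X]) * Y + T * derivative Y))
      + 4 * (C a * X - C E) * T ^ 2 * Y ^ 2) = 0 := by
    have e5 : T ^ 2 * hermiteFirstIntegral g₂ g₃ a E f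
        = weierstrassCubic g₂ g₃ * (T * derivative f) ^ 2
        - 2 * f * (weierstrassCubic g₂ g₃ * (T ^ 2 * derivative (derivative f))
          + weierstrassQuadratic g₂ * T * (T * derivative f))
        + 4 * (C a * X - C E) * T ^ 2 * f ^ 2 := by
      rw [hermiteFirstIntegral]
      ring
    rw [h, mul_zero, e1, e2, hY] at e5
    rw [e5]
    ring
  have hT0 : T ^ (2 * r) ≠ 0 := pow_ne_zero _ (X_sub_C_ne_zero b)
  have e6 := congrArg (eval b) ((mul_eq_zero.1 e4).resolve_left hT0)
  have hTb : T.eval b = 0 := by simp [hT]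
  simp only [eval_add, eval_sub, eval_mul, eval_pow, hTb, eval_natCast, eval_one, eval_zero,
    eval_ofNat, zero_mul, mul_zero, add_zero, zero_pow two_ne_zero] at e6
  -- After division by `T ^ (2 * r)` only `r² - 2r(r-1) = r(2-r)` survives at `b`.
  have e7 : (weierstrassCubic g₂ g₃).eval b * Y.eval b ^ 2 * ((r : ℂ) * (2 - r)) = 0 := by
    linear_combination e6
  have e8 := (mul_eq_zero.1 e7).resolve_left (mul_ne_zero hp (pow_ne_zero 2 hYb'))
  have hr0 : (r : ℂ) ≠ 0 := by
    have : 0 < r := (rootMultiplicity_pos hf).2 hb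
    exact_mod_cast this.ne'
  have e9 := (mul_eq_zero.1 e8).resolve_left hr0
  have : (r : ℂ) = (2 : ℕ) := by push_cast; linear_combination -e9
  exact_mod_cast this

lemma exists_fin_map_eq {α : Type*} (s : Multiset α) :
    ∃ v : Fin (Multiset.card s) → α, (Finset.univ.val.map v) = s := by
  obtain ⟨l, rfl⟩ := Quot.exists_rep s
  exact ⟨l.get, (Fin.univ_val_map _).trans (congrArg _ (List.ofFn_get l))⟩

lemma Monic.exists_eq_prod_X_sub_C {f : ℂ[X]} (hf : f.Monic) {m : ℕ} (hm : f.natDegree = m) :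
    ∃ v : Fin m → ℂ, f = ∏ j, (X - C (v j)) := by
  have hs := IsAlgClosed.splits f
  obtain ⟨v, hv⟩ := exists_fin_map_eq f.roots
  have hc : Multiset.card f.roots = m := by rw [← hm]; exact hs.natDegree_eq_card_roots.symm
  subst hc
  refine ⟨v, ?_⟩
  conv_lhs => rw [hs.eq_prod_roots_of_monic hf, ← hv, Multiset.map_map]
  rfl

variable (L : PeriodPair)

lemma eval_weierstrassCubic {k : ℂ} (hk : k ∉ L.lattice) :
    (weierstrassCubic L.g₂ L.g₃).eval (L.weierstrassP k) = L.derivWeierstrassP k ^ 2 := by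
  rw [L.derivWeierstrassP_sq k hk]
  simp [weierstrassCubic]

/-- Parameters with a nonzero Wronskian. -/
lemma exists_parameters_of_ne_zero {m : ℕ} {a E c : ℂ} {f : ℂ[X]} (hf : f.Monic)
    (hm : f.natDegree = m) (hc : c ≠ 0)
    (h : hermiteFirstIntegral L.g₂ L.g₃ a E f = C (c ^ 2)) :
    ∃ k : Fin m → ℂ, (∀ j, k j ∉ L.lattice) ∧ hermitePoly L k = f ∧ SignCondition L k c := by
  obtain ⟨v, hv⟩ := Monic.exists_eq_prod_X_sub_C hf hm
  have key : ∀ j, ∃ k ∉ L.lattice, L.weierstrassP k = v j ∧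
      (derivative f).eval (v j) * L.derivWeierstrassP k = c := by
    intro j
    obtain ⟨k, hk, hkv⟩ := exists_weierstrassP_eq L (v j)
    have h0 : f.eval (v j) = 0 := by
      rw [hv, eval_prod]
      exact Finset.prod_eq_zero (Finset.mem_univ j) (by simp)
    have h1 := congrArg (eval (v j)) h
    simp only [hermiteFirstIntegral, eval_add, eval_sub, eval_mul, eval_pow, h0, eval_C] at h1
    rw [← hkv, eval_weierstrassCubic L hk, hkv] at h1
    -- At a root of `f` the first integral reduces to its first term, so the sign condition holds up
    -- to a sign, which replacing `k` by `-k` corrects.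
    have h2 : ((derivative f).eval (v j) * L.derivWeierstrassP k) ^ 2 = c ^ 2 := by
      linear_combination h1
    rcases sq_eq_sq_iff_eq_or_eq_neg.1 h2 with h3 | h3
    · exact ⟨k, hk, hkv, h3⟩
    · refine ⟨-k, notMem_lattice_neg L hk, by rw [L.weierstrassP_neg, hkv], ?_⟩
      rw [L.derivWeierstrassP_neg, mul_neg, h3, neg_neg]
  choose k hk hkv hkc using key
  have hX : hermitePoly L k = f := by
    rw [hv, hermitePoly]
    simp only [hkv]
  exact ⟨k, hk, hX, fun _ j => by rw [hX, hkv, hkc], fun h => absurd h hc⟩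

/-- Parameters with a zero Wronskian. -/
lemma exists_parameters_of_eq_zero {m : ℕ} {a E : ℂ} {f : ℂ[X]} (hf : f.Monic)
    (hm : f.natDegree = m) (h : hermiteFirstIntegral L.g₂ L.g₃ a E f = 0) :
    ∃ k : Fin m → ℂ, (∀ j, k j ∉ L.lattice) ∧ hermitePoly L k = f ∧ SignCondition L k 0 := by
  classical
  set p := weierstrassCubic L.g₂ L.g₃ with hp
  have hs := IsAlgClosed.splits f
  set A := f.roots.filter fun b => p.eval b = 0 with hA
  set B := (f.roots.filter fun b => p.eval b ≠ 0).dedup with hB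
  -- Roots at branch points may have any multiplicity; the others are double, so `B` lists each of
  -- them once.
  have hroots : f.roots = A + (B + B) := by
    ext b
    rw [Multiset.count_add, Multiset.count_add, hA, hB]
    by_cases hb : p.eval b = 0
    · rw [Multiset.count_filter_of_pos (p := fun b => p.eval b = 0) hb]
      simp [hb]
    · rw [Multiset.count_filter_of_neg (p := fun b => p.eval b = 0) hb, Multiset.count_dedup]
      split_ifs with hmem
      · have hroot : f.IsRoot b := isRoot_of_mem_roots (Multiset.mem_filter.1 hmem).1
        rw [count_roots, rootMultiplicity_eq_two hf.ne_zero h hroot hb]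
      · rw [count_roots, rootMultiplicity_eq_zero]
        intro hroot
        exact hmem (Multiset.mem_filter.2 ⟨(mem_roots hf.ne_zero).2 hroot, hb⟩)
  obtain ⟨α, hα⟩ := exists_fin_map_eq A
  obtain ⟨β, hβ⟩ := exists_fin_map_eq B
  choose κ hκ hκv using exists_weierstrassP_eq L
  let ι := Fin (Multiset.card A) ⊕ (Fin (Multiset.card B) ⊕ Fin (Multiset.card B))
  let K : ι → ℂ := Sum.elim (fun i => κ (α i)) (Sum.elim (fun i => κ (β i)) fun i => -κ (β i))
  -- Parameters over branch points are half-periods and are paired with themselves; the two copies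
  -- of `B` carry opposite parameters and are swapped.
  let σ : ι ≃ ι := Equiv.sumCongr (Equiv.refl _) (Equiv.sumComm _ _)
  have hcard : Fintype.card (Fin m) = Fintype.card ι := by
    have h1 : Multiset.card f.roots = m := by rw [← hm]; exact hs.natDegree_eq_card_roots.symm
    have h2 := congrArg Multiset.card hroots
    simp only [Multiset.card_add] at h2
    simp only [ι, Fintype.card_fin, Fintype.card_sum]
    omega
  let e : Fin m ≃ ι := Fintype.equivOfCardEq hcard
  have hK : ∀ i, K i ∉ L.lattice := by
    rintro (i | i | i)
    · exact hκ _
    · exact hκ _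
    · exact notMem_lattice_neg L (hκ _)
  have hKσ : ∀ i, K i + K (σ i) ∈ L.lattice := by
    rintro (i | i | i)
    · have hmem : α i ∈ A := by
        rw [← hα]
        exact Multiset.mem_map_of_mem _ (Finset.mem_univ_val i)
      have h1 : p.eval (α i) = 0 := (Multiset.mem_filter.1 hmem).2
      rw [← hκv (α i), hp, eval_weierstrassCubic L (hκ _)] at h1
      have := two_mul_mem_lattice_of_derivWeierstrassP_eq_zero L (hκ _)
        (pow_eq_zero_iff two_ne_zero |>.1 h1)
      rw [two_mul] at this
      exact this
    · change κ (β i) + -κ (β i) ∈ L.lattice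
      simp
    · change -κ (β i) + κ (β i) ∈ L.lattice
      simp
  refine ⟨K ∘ e, fun j => hK _, ?_, fun h => absurd rfl h, fun _ =>
    ⟨(e.trans σ).trans e.symm, fun j => by simpa using hKσ (e j)⟩⟩
  have hprod : ∀ (n : ℕ) (v : Fin n → ℂ), ∏ i, (X - C (v i))
      = ((Finset.univ.val.map v).map fun b => X - C b).prod := by
    intro n v
    rw [Multiset.map_map]
    rfl
  calc hermitePoly L (K ∘ e) = ∏ i, (X - C (L.weierstrassP (K i))) :=
        e.prod_comp fun i => X - C (L.weierstrassP (K i))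
    _ = (∏ i, (X - C (α i))) * ((∏ i, (X - C (β i))) * ∏ i, (X - C (β i))) := by
        rw [Fintype.prod_sum_type, Fintype.prod_sum_type]
        simp [K, hκv, L.weierstrassP_neg]
    _ = f := by
        conv_rhs => rw [hs.eq_prod_roots_of_monic hf, hroots]
        rw [Multiset.map_add, Multiset.map_add, Multiset.prod_add, Multiset.prod_add, hprod, hprod,
          hα, hβ]

end Lame

namespace Lame

open Filter Topology Polynomial

/-! ### Existence of Hermite parameters -/

lemma eq_of_eventually_punctured {f g : ℂ → ℂ} {z : ℂ} (hf : ContinuousAt f z)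
    (hg : ContinuousAt g z) (h : ∀ᶠ w in 𝓝[≠] z, f w = g w) : f z = g z :=
  tendsto_nhds_unique (hf.tendsto.mono_left nhdsWithin_le_nhds)
    ((hg.tendsto.mono_left nhdsWithin_le_nhds).congr' (h.mono fun _ hw => hw.symm))

/-- Differentiating `℘'² = 4℘³ - g₂℘ - g₃` gives `2℘'℘''`; `℘'` is cancelled off its zeros, and
continuity covers the zeros. -/
lemma hasDerivAt_derivWeierstrassP (L : PeriodPair) {z : ℂ} (hz : z ∉ L.lattice) :
    HasDerivAt L.derivWeierstrassP ((weierstrassQuadratic L.g₂).eval (L.weierstrassP z)) z := by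
  have ha := analyticAt_derivWeierstrassP L hz
  refine ha.differentiableAt.hasDerivAt.congr_deriv ?_
  have hc : weierstrassCubic L.g₂ L.g₃ ≠ 0 := by
    intro h
    have := congrArg (fun f : ℂ[X] => f.coeff 3) h
    simp [weierstrassCubic] at this
  refine eq_of_eventually_punctured ha.deriv.continuousAt
    (g := fun z => (weierstrassQuadratic L.g₂).eval (L.weierstrassP z))
    ((weierstrassQuadratic L.g₂).continuous.continuousAt.comp
      (analyticAt_weierstrassP L hz).continuousAt) ?_
  filter_upwards [eventually_eval_weierstrassP_ne_zero L hc hz] with w hw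
  have hw' := hw.2
  rw [eval_weierstrassCubic L hw.1] at hw'
  have h0 : L.derivWeierstrassP w ≠ 0 := fun h => hw' (by rw [h]; ring)
  have d1 := ((analyticAt_derivWeierstrassP L hw.1).differentiableAt.hasDerivAt).pow 2
  have d2 := hasDerivAt_eval_weierstrassP L (weierstrassCubic L.g₂ L.g₃) hw.1
  have d3 := d1.congr_of_eventuallyEq
    (f₁ := fun z => (weierstrassCubic L.g₂ L.g₃).eval (L.weierstrassP z)) (by
      filter_upwards [(isOpen_compl_lattice L).mem_nhds hw.1] with v hv
      exact eval_weierstrassCubic L hv)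
  have h1 := d3.unique d2
  have h2 : (derivative (weierstrassCubic L.g₂ L.g₃)).eval (L.weierstrassP w)
      = 2 * (weierstrassQuadratic L.g₂).eval (L.weierstrassP w) := by
    simp [weierstrassCubic, weierstrassQuadratic]
    ring
  rw [h2] at h1
  simp only [Nat.cast_ofNat, Nat.add_one_sub_one, pow_one] at h1
  refine mul_left_cancel₀ (mul_ne_zero two_ne_zero h0) ?_
  linear_combination h1

/-- Hermite's products solve the Lamé equation. -/
theorem isLameSolution_hermiteProduct (L : PeriodPair) {m : ℕ} (hm : 1 ≤ m) {E c : ℂ}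
    {k : Fin m → ℂ} (hk : ∀ j, k j ∉ L.lattice) (hs : SignCondition L k c)
    (h : hermiteFirstIntegral L.g₂ L.g₃ (m * (m + 1)) E (hermitePoly L k) = C (c ^ 2)) :
    IsLameSolution L m E (hermiteProduct L k) := by
  have hd := differentiableOn_hermiteProduct L k
  have ho := isOpen_compl_lattice L
  refine ⟨hd, fun z hz => ?_⟩
  have ha := fun w (hw : w ∉ L.lattice) => hd.analyticAt (ho.mem_nhds hw)
  have hP := fun w (hw : w ∉ L.lattice) => analyticAt_weierstrassP L hw
  refine eq_of_eventually_punctured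
    (f := fun z => -deriv (deriv (hermiteProduct L k)) z
      + (m * (m + 1) : ℂ) * L.weierstrassP z * hermiteProduct L k z)
    (g := fun z => E * hermiteProduct L k z)
    (((ha z hz).deriv.deriv.continuousAt.neg).add
      ((continuousAt_const.mul (hP z hz).continuousAt).mul (ha z hz).continuousAt))
    (continuousAt_const.mul (ha z hz).continuousAt) ?_
  set X := hermitePoly L k with hX
  filter_upwards [eventually_eval_weierstrassP_ne_zero L (hermitePoly_ne_zero L k) hz] with w hw
  have hopen : ∀ᶠ v in 𝓝 w, v ∉ L.lattice ∧ X.eval (L.weierstrassP v) ≠ 0 :=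
    Filter.Eventually.and (ho.mem_nhds hw.1)
      ((hasDerivAt_eval_weierstrassP L X hw.1).continuousAt.eventually_ne hw.2)
  have h1 : deriv (hermiteProduct L k) =ᶠ[𝓝 w] fun v =>
      ((derivative X).eval (L.weierstrassP v) * L.derivWeierstrassP v - c) /
        (2 * X.eval (L.weierstrassP v)) * hermiteProduct L k v := by
    filter_upwards [hopen] with v hv
    exact (hs.hasDerivAt_hermiteProduct hm hk hv.1 hv.2).deriv
  have d1 := ((((hasDerivAt_eval_weierstrassP L (derivative X) hw.1).mul
    (hasDerivAt_derivWeierstrassP L hw.1)).sub_const c).div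
    ((hasDerivAt_eval_weierstrassP L X hw.1).const_mul 2) (mul_ne_zero two_ne_zero hw.2)).mul
    (hs.hasDerivAt_hermiteProduct hm hk hw.1 hw.2)
  have h2 := (d1.congr_of_eventuallyEq h1).deriv
  -- Substituting `(P' - c) / (2P)` into the Riccati form of the Lamé equation leaves exactly `P'² -
  -- 2PP'' + 4(a℘ - E)P² = c²`, the first integral at `℘(w)`.
  have h3 := congrArg (eval (L.weierstrassP w)) h
  simp only [hermiteFirstIntegral, eval_add, eval_sub, eval_mul, eval_pow, eval_C, eval_X,
    eval_ofNat] at h3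
  rw [eval_weierstrassCubic L hw.1] at h3
  rw [h2]
  have h4 : X.eval (L.weierstrassP w) ≠ 0 := hw.2
  simp only [Pi.div_apply, Pi.mul_apply, ← hX]
  generalize hermiteProduct L k w = y
  generalize eval (L.weierstrassP w) X = f0 at *
  generalize eval (L.weierstrassP w) (derivative X) = f1 at *
  generalize eval (L.weierstrassP w) (derivative (derivative X)) = f2 at *
  generalize eval (L.weierstrassP w) (weierstrassQuadratic L.g₂) = q at *
  field_simp
  linear_combination y * h3

/-- **Hermite**: parameters exist for every value of the spectral parameter. -/
theorem exists_isHermiteParameters (L : PeriodPair) {m : ℕ} (hm : 1 ≤ m) (E : ℂ) :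
    ∃ k : Fin m → ℂ, IsHermiteParameters L m E k := by
  obtain ⟨f, hf, hfm, hfD⟩ := exists_monic_hermiteOperator_eq_zero L.g₂ L.g₃ E m
  obtain ⟨c, hc⟩ := exists_hermiteFirstIntegral_eq L.g₂ L.g₃ (m * (m + 1)) E hfD
  obtain ⟨k, hk, hkf, hs⟩ : ∃ k : Fin m → ℂ, (∀ j, k j ∉ L.lattice) ∧ hermitePoly L k = f ∧
      SignCondition L k c := by
    by_cases h0 : c = 0
    · subst h0
      exact exists_parameters_of_eq_zero L hf hfm (by simpa using hc)
    · exact exists_parameters_of_ne_zero L hf hfm h0 hc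
  subst hkf
  have hk' : ∀ j, (-k) j ∉ L.lattice := fun j => notMem_lattice_neg L (hk j)
  have hs' := hs.neg
  have hX' := hermitePoly_neg L k
  have ho := isOpen_compl_lattice L
  set X := hermitePoly L k with hX
  have l1 := isLameSolution_hermiteProduct L hm hk hs hc
  have l2 := isLameSolution_hermiteProduct L hm hk' hs' (E := E) (by rw [hX', neg_sq]; exact hc)
  obtain ⟨z₁, hz₁, hP₁⟩ := (eventually_eval_weierstrassP_ne_zero L (hermitePoly_ne_zero L k)
    L.ω₁_div_two_notMem_lattice).exists
  have n1 := hermiteProduct_ne_zero L k hz₁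
    (add_notMem_lattice_of_eval_hermitePoly_ne_zero L hP₁)
  have n2 := hermiteProduct_ne_zero L (-k) hz₁
    (add_notMem_lattice_of_eval_hermitePoly_ne_zero L (hX'.symm ▸ hP₁))
  have hlog1 : ∀ z ∉ L.lattice, X.eval (L.weierstrassP z) ≠ 0 → HasDerivAt (hermiteProduct L k)
      (((derivative X).eval (L.weierstrassP z) * L.derivWeierstrassP z - c) /
        (2 * X.eval (L.weierstrassP z)) * hermiteProduct L k z) z :=
    fun z hz hP => hs.hasDerivAt_hermiteProduct hm hk hz hP
  have hlog2 : ∀ z ∉ L.lattice, X.eval (L.weierstrassP z) ≠ 0 → HasDerivAt (hermiteProduct L (-k))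
      (((derivative X).eval (L.weierstrassP z) * L.derivWeierstrassP z + c) /
        (2 * X.eval (L.weierstrassP z)) * hermiteProduct L (-k) z) z := by
    intro z hz hP
    have := hs'.hasDerivAt_hermiteProduct hm hk' hz (by rwa [hX'])
    rwa [hX', sub_neg_eq_add] at this
  have hXd : DifferentiableOn ℂ (fun z => X.eval (L.weierstrassP z)) (L.lattice : Set ℂ)ᶜ :=
    fun z hz => (hasDerivAt_eval_weierstrassP L X hz).differentiableAt.differentiableWithinAt
  -- In the product of the two Hermite products the constants `∓c` cancel, so its logarithmic
  -- derivative is that of `X(℘)`. The factor `b` is absorbed into the second solution.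
  obtain ⟨b, hb⟩ := exists_eq_const_mul_of_wronskian_eq_zero L hXd (l1.1.mul l2.1)
    (fun z hz => by
      filter_upwards [eventually_eval_weierstrassP_ne_zero L (hermitePoly_ne_zero L k) hz]
        with w hw
      have h1 := hlog1 w hw.1 hw.2
      have h2 := hlog2 w hw.1 hw.2
      rw [(h1.mul h2).deriv, (hasDerivAt_eval_weierstrassP L X hw.1).deriv]
      have h4 : X.eval (L.weierstrassP w) ≠ 0 := hw.2
      simp only [Pi.mul_apply]
      field_simp
      ring) hz₁ (mul_ne_zero n1 n2)
  simp only [Pi.mul_apply] at hb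
  have hbd : ∀ z ∉ L.lattice, DifferentiableAt ℂ (hermiteProduct L (-k)) z := fun z hz =>
    l2.1.differentiableAt (ho.mem_nhds hz)
  have hder : ∀ z ∉ L.lattice, deriv (fun z => b * hermiteProduct L (-k) z) z
      = b * deriv (hermiteProduct L (-k)) z := fun z hz => deriv_const_mul b (hbd z hz)
  refine ⟨k, hk, hermiteProduct L k, fun z => b * hermiteProduct L (-k) z, c, l1, ⟨?_, ?_⟩, ?_, ?_,
    hs.1, hs.2⟩
  · exact l2.1.const_mul b
  · intro z hz
    have h1 : deriv (fun z => b * hermiteProduct L (-k) z) =ᶠ[𝓝 z]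
        fun z => b * deriv (hermiteProduct L (-k)) z := by
      filter_upwards [ho.mem_nhds hz] with w hw using hder w hw
    rw [h1.deriv_eq, deriv_const_mul b
      (l2.1.analyticAt (ho.mem_nhds hz)).deriv.differentiableAt]
    linear_combination b * l2.2 z hz
  · intro z hz
    rw [hb z hz]
    ring
  · intro z hz
    have a1 := l1.1.analyticAt (ho.mem_nhds hz)
    have a2 := l2.1.analyticAt (ho.mem_nhds hz)
    rw [hder z hz]
    refine eq_of_eventually_punctured
      (f := fun z => hermiteProduct L k z * (b * deriv (hermiteProduct L (-k)) z)
        - deriv (hermiteProduct L k) z * (b * hermiteProduct L (-k) z)) (g := fun _ => c)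
      ((a1.continuousAt.mul (continuousAt_const.mul a2.deriv.continuousAt)).sub
        (a1.deriv.continuousAt.mul (continuousAt_const.mul a2.continuousAt)))
      continuousAt_const ?_
    filter_upwards [eventually_eval_weierstrassP_ne_zero L (hermitePoly_ne_zero L k) hz] with w hw
    rw [(hlog1 w hw.1 hw.2).deriv, (hlog2 w hw.1 hw.2).deriv]
    have h4 : X.eval (L.weierstrassP w) ≠ 0 := hw.2
    have h5 := hb w hw.1
    field_simp
    linear_combination -2 * c * h5

/-- The multipliers of the two solutions attached to Hermite parameters. -/
theorem IsHermiteParameters.exists_multiplier {L : PeriodPair} {m : ℕ} (hm : 1 ≤ m) {E : ℂ}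
    {k : Fin m → ℂ} (h : IsHermiteParameters L m E k) {ω : ℂ} (hω : 2 * ω ∈ L.lattice) :
    ∃ (ψ₁ ψ₂ : ℂ → ℂ) (c : ℂ), IsLameSolution L m E ψ₁ ∧ IsLameSolution L m E ψ₂ ∧
      (∀ z ∉ L.lattice, ψ₁ z * deriv ψ₂ z - deriv ψ₁ z * ψ₂ z = c) ∧
      (∀ z ∉ L.lattice, ψ₁ (z + 2 * ω) = Complex.exp (2 * hermiteExponent L ω k) * ψ₁ z) ∧
      (∀ z ∉ L.lattice, ψ₂ (z + 2 * ω) = Complex.exp (-(2 * hermiteExponent L ω k)) * ψ₂ z) ∧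
      (∀ z ∉ L.lattice, ∀ᶠ w in 𝓝[≠] z, ψ₁ w ≠ 0) ∧
      (c = 0 → (hermiteExponent L ω k).re = 0) := by
  obtain ⟨hk, ψ₁, ψ₂, c, h1, h2, hprod, hW, hs1, hs2⟩ := h
  have hs : SignCondition L k c := ⟨hs1, hs2⟩
  have ho := isOpen_compl_lattice L
  have hdP : ∀ z ∉ L.lattice, (derivative (hermitePoly L k)).eval (L.weierstrassP z)
      * L.derivWeierstrassP z = deriv ψ₁ z * ψ₂ z + ψ₁ z * deriv ψ₂ z := by
    intro z hz
    have d1 := (h1.1.differentiableAt (ho.mem_nhds hz)).hasDerivAt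
    have d2 := (h2.1.differentiableAt (ho.mem_nhds hz)).hasDerivAt
    refine (hasDerivAt_eval_weierstrassP L (hermitePoly L k) hz).unique
      ((d1.mul d2).congr_of_eventuallyEq ?_)
    filter_upwards [ho.mem_nhds hz] with w hw using (hprod w hw).symm
  have m1 : ∀ z ∉ L.lattice, ψ₁ (z + 2 * ω) = Complex.exp (2 * hermiteExponent L ω k) * ψ₁ z :=
    fun z hz => hs.add_two_mul hm hk h1.1 (fun z hz => by
      rw [hdP z hz, ← hprod z hz, ← hW z hz]
      ring) hω hz
  have m2 : ∀ z ∉ L.lattice, ψ₂ (z + 2 * ω) = Complex.exp (-(2 * hermiteExponent L ω k)) * ψ₂ z := by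
    intro z hz
    have := hs.neg.add_two_mul hm (fun j => notMem_lattice_neg L (hk j)) h2.1 (fun z hz => by
      rw [hermitePoly_neg, hdP z hz, ← hprod z hz, ← hW z hz]
      ring) hω hz
    rwa [hermiteExponent_neg, mul_neg] at this
  have hne : ∀ z ∉ L.lattice, ∀ᶠ w in 𝓝[≠] z, w ∉ L.lattice ∧ ψ₁ w * ψ₂ w ≠ 0 := by
    intro z hz
    filter_upwards [eventually_eval_weierstrassP_ne_zero L (hermitePoly_ne_zero L k) hz] with w hw
    exact ⟨hw.1, (hprod w hw.1).symm ▸ hw.2⟩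
  refine ⟨ψ₁, ψ₂, c, h1, h2, hW, m1, m2, fun z hz => (hne z hz).mono fun w hw =>
    left_ne_zero_of_mul hw.2, fun hc => ?_⟩
  obtain ⟨z₁, hz₁, hn⟩ := (hne _ L.ω₁_div_two_notMem_lattice).exists
  -- Proportional solutions share their multiplier, so `exp (2f) = exp (-2f)` and the modulus is
  -- one.
  obtain ⟨b, hb⟩ := exists_eq_const_mul_of_wronskian_eq_zero L h2.1 h1.1 (fun z _ => by
    filter_upwards [eventually_punctured_notMem_lattice L z] with w hw
    linear_combination hW w hw + hc) hz₁ (left_ne_zero_of_mul hn)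
  have e1 := m2 z₁ hz₁
  rw [hb _ (notMem_lattice_add L hz₁ hω), m1 z₁ hz₁, hb z₁ hz₁] at e1
  have hbn : b * ψ₁ z₁ ≠ 0 := by
    rw [← hb z₁ hz₁]
    exact right_ne_zero_of_mul hn
  have e2 : Complex.exp (2 * hermiteExponent L ω k)
      = Complex.exp (-(2 * hermiteExponent L ω k)) := by
    refine mul_right_cancel₀ hbn ?_
    linear_combination e1
  have e3 := congrArg norm e2
  rw [Complex.norm_exp, Complex.norm_exp, Real.exp_eq_exp] at e3
  simp at e3
  linarith

end Lame

namespace Lame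

open Filter Topology

/-! ### Resolvent criteria for Schrödinger operators -/

lemma mem_schrodingerOperator_graph {V : ℝ → ℂ} {f g : L2} (h : (f, g) ∈ schrodingerGraph V) :
    ∃ y : (schrodingerOperator V).domain, (y : L2) = f ∧ schrodingerOperator V y = g := by
  rw [← schrodingerOperator_graph] at h
  exact (LinearPMap.mem_graph_iff _).1 h

lemma apply_mem_schrodingerGraph {V : ℝ → ℂ} (y : (schrodingerOperator V).domain) :
    ((y : L2), schrodingerOperator V y) ∈ schrodingerGraph V := by
  rw [← schrodingerOperator_graph]
  exact LinearPMap.mem_graph _ y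

/-- Outside the spectrum, the norm is controlled by the graph norm of `T - c`. -/
theorem exists_norm_le_of_notMem_spectrum {V : ℝ → ℂ} {c : ℂ}
    (hc : c ∉ unboundedSpectrum (schrodingerOperator V)) :
    ∃ K : ℝ, ∀ f g : L2, (f, g) ∈ schrodingerGraph V → ‖f‖ ≤ K * ‖g - c • f‖ := by
  simp only [unboundedSpectrum, Set.mem_ofPred_eq, not_not] at hc
  obtain ⟨R, hR, -⟩ := hc
  refine ⟨‖R‖, fun f g hfg => ?_⟩
  obtain ⟨y, rfl, rfl⟩ := mem_schrodingerOperator_graph hfg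
  conv_lhs => rw [← hR y]
  exact R.le_opNorm _

/-- If `T - c` is injective and has bounded solutions, `c` is not in the spectrum. -/
theorem notMem_spectrum_of_exists_bound {V : ℝ → ℂ} {c : ℂ} {M : ℝ}
    (hex : ∀ g : L2, ∃ f : L2, (f, g + c • f) ∈ schrodingerGraph V ∧ ‖f‖ ≤ M * ‖g‖)
    (huniq : ∀ f : L2, (f, c • f) ∈ schrodingerGraph V → f = 0) :
    c ∉ unboundedSpectrum (schrodingerOperator V) := by
  have huniq' : ∀ g f₁ f₂ : L2, (f₁, g + c • f₁) ∈ schrodingerGraph V →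
      (f₂, g + c • f₂) ∈ schrodingerGraph V → f₁ = f₂ := by
    intro g f₁ f₂ h1 h2
    have h3 := sub_mem h1 h2
    rw [Prod.mk_sub_mk, add_sub_add_left_eq_sub, ← smul_sub] at h3
    exact sub_eq_zero.1 (huniq _ h3)
  choose F hF hFM using hex
  -- Uniqueness makes the chosen solutions depend linearly on `g`.
  let R₀ : L2 →ₗ[ℂ] L2 :=
    { toFun := F
      map_add' := fun g₁ g₂ => by
        refine huniq' (g₁ + g₂) _ _ (hF _) ?_
        have := add_mem (hF g₁) (hF g₂)
        rw [Prod.mk_add_mk] at this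
        convert this using 2
        rw [smul_add]
        abel
      map_smul' := fun a g => by
        refine huniq' (a • g) _ _ (hF _) ?_
        have := Submodule.smul_mem _ a (hF g)
        rw [Prod.smul_mk] at this
        rwa [smul_add, smul_comm a c] at this }
  simp only [unboundedSpectrum, Set.mem_ofPred_eq, not_not]
  refine ⟨R₀.mkContinuous M hFM, fun y => ?_, fun g => ?_⟩
  · refine huniq' _ _ _ (hF _) ?_
    rw [sub_add_cancel]
    exact apply_mem_schrodingerGraph y
  · obtain ⟨y, hy, hTy⟩ := mem_schrodingerOperator_graph (hF g)
    refine ⟨y, hy, ?_⟩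
    rw [hTy, hy, add_sub_cancel_right]

/-! ### Bounded solutions give points of the spectrum -/

lemma mem_schrodingerGraph_of_hasDerivAt {V : ℝ → ℂ} {u v h : ℝ → ℂ} (hu : ∀ x, HasDerivAt u (v x) x)
    (hv : ∀ x, HasDerivAt v (h x) x) (hh : Continuous h) (h1 : MemLp u 2 volume)
    (h2 : MemLp (fun x => -h x + V x * u x) 2 volume) :
    (h1.toLp u, h2.toLp _) ∈ schrodingerGraph V := by
  refine ⟨u, v, h, h1.coeFn_toLp, hu, hh.locallyIntegrable, fun a b => ?_, h2.coeFn_toLp⟩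
  exact (intervalIntegral.integral_eq_sub_of_hasDerivAt (fun x _ => hv x)
    (hh.intervalIntegrable a b)).symm

lemma exists_cutoff : ∃ (φ φ' φ'' : ℝ → ℝ) (D : ℝ), 0 ≤ D ∧ (∀ x, HasDerivAt φ (φ' x) x) ∧
    (∀ x, HasDerivAt φ' (φ'' x) x) ∧ Continuous φ'' ∧ (∀ x, |φ' x| ≤ D) ∧ (∀ x, |φ'' x| ≤ D) ∧
    (∀ x, |x| ≤ 1 → φ x = 1) ∧ (∀ x, 2 < |x| → φ x = 0) ∧ (∀ x, 2 < |x| → φ' x = 0) ∧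
    (∀ x, 2 < |x| → φ'' x = 0) := by
  let b : ContDiffBump (0 : ℝ) := ⟨1, 2, one_pos, one_lt_two⟩
  have hb : ContDiff ℝ 2 (b : ℝ → ℝ) := b.contDiff
  have hb1 : ContDiff ℝ 1 (deriv b) := ContDiff.deriv' (n := 1) (b.contDiff (n := 1 + 1))
  have hb2 : ContDiff ℝ 0 (deriv (deriv b)) := ContDiff.deriv' (n := 0) (by simpa using hb1)
  have hs : HasCompactSupport b := b.hasCompactSupport
  obtain ⟨D₁, hD₁⟩ := hs.deriv.exists_bound_of_continuous hb1.continuous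
  obtain ⟨D₂, hD₂⟩ := hs.deriv.deriv.exists_bound_of_continuous hb2.continuous
  have h0 : ∀ x : ℝ, 2 < |x| → b =ᶠ[𝓝 x] 0 := by
    intro x hx
    filter_upwards [(isOpen_lt continuous_const continuous_abs).mem_nhds hx] with y hy
    exact b.zero_of_le_dist (by simpa using hy.le)
  refine ⟨b, deriv b, deriv (deriv b), max D₁ D₂, ?_, ?_, ?_, hb2.continuous, ?_, ?_, ?_, ?_, ?_, ?_⟩
  · exact ((norm_nonneg _).trans (hD₁ 0)).trans (le_max_left _ _)
  · exact fun x => (hb.differentiable (by norm_num) x).hasDerivAt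
  · exact fun x => (hb1.differentiable (by norm_num) x).hasDerivAt
  · exact fun x => (hD₁ x).trans (le_max_left _ _)
  · exact fun x => (hD₂ x).trans (le_max_right _ _)
  · exact fun x hx => b.one_of_mem_closedBall (by simpa using hx)
  · exact fun x hx => (h0 x hx).eq_of_nhds
  · intro x hx
    rw [(h0 x hx).deriv_eq]
    simp
  · intro x hx
    rw [(h0 x hx).deriv.deriv_eq]
    simp

/-- A bounded solution with bounded derivative gives a point of the spectrum. -/
theorem mem_spectrum_of_bounded_solution {V : ℝ → ℂ} (hV : Continuous V) {c : ℂ}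
    {y y' : ℝ → ℂ} (hy : ∀ x, HasDerivAt y (y' x) x)
    (hy' : ∀ x, HasDerivAt y' ((V x - c) * y x) x) {B : ℝ} (hB : ∀ x, ‖y x‖ ≤ B)
    (hB' : ∀ x, ‖y' x‖ ≤ B) {x₀ : ℝ} (hx₀ : y x₀ ≠ 0) :
    c ∈ unboundedSpectrum (schrodingerOperator V) := by
  by_contra hc
  obtain ⟨K, hK⟩ := exists_norm_le_of_notMem_spectrum hc
  obtain ⟨φ, φ', φ'', D, hD, hφ, hφ', hφc, hD1, hD2, hone, hz, hz', hz''⟩ := exists_cutoff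
  have hyc : Continuous y := continuous_iff_continuousAt.2 fun x => (hy x).continuousAt
  have hyc' : Continuous y' := continuous_iff_continuousAt.2 fun x => (hy' x).continuousAt
  have hφ0 : Continuous φ := continuous_iff_continuousAt.2 fun x => (hφ x).continuousAt
  have hφ1 : Continuous φ' := continuous_iff_continuousAt.2 fun x => (hφ' x).continuousAt
  have hB0 : 0 ≤ B := (norm_nonneg _).trans (hB 0)
  -- The mass of `y` in this fixed window bounds the norms of all cutoff functions from below.
  set S : Set ℝ := Set.Icc (x₀ - 1) (x₀ + 1) with hS
  set δ : ENNReal := eLpNorm (S.indicator y) 2 volume with hδ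
  have hSm : MeasurableSet S := measurableSet_Icc
  have hδ0 : δ ≠ 0 := by
    intro h0
    rw [hδ, eLpNorm_indicator_eq_eLpNorm_restrict hSm, eLpNorm_eq_zero_iff
      hyc.aestronglyMeasurable (by norm_num)] at h0
    have h1 := (ae_restrict_iff' hSm).1 h0
    have h2 : ∀ᶠ x in 𝓝 x₀, x ∈ S ∧ y x ≠ 0 :=
      Filter.Eventually.and (Icc_mem_nhds (by linarith) (by linarith)) (hyc.continuousAt.eventually_ne hx₀)
    obtain ⟨r, hr, hball⟩ := Metric.eventually_nhds_iff_ball.1 h2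
    have h3 : volume (Metric.ball x₀ r) = 0 := by
      refine measure_mono_null (fun x hx => ?_) (ae_iff.1 h1)
      simp only [Set.mem_ofPred_eq, Classical.not_imp]
      exact hball x hx
    exact (Metric.measure_ball_pos volume x₀ hr).ne' h3
  have main : ∀ t : ℝ, 1 ≤ t → δ.toReal ≤ K * (6 * D * B / t) := by
    intro t ht
    have ht0 : 0 < t := by linarith
    -- The residual of the cutoff at scale `s` is at most `3DB/s` on an interval of length `4s`, so
    -- its norm is at most `3DB/s * √(4s)`; the choice `s = t²` makes this `6DB/t`.
    set s : ℝ := t ^ 2 with hs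
    have hs1 : 1 ≤ s := one_le_pow₀ ht
    have hs0 : 0 < s := by linarith
    have harg : ∀ x, HasDerivAt (fun x => (x - x₀) / s) (1 / s) x := fun x =>
      ((hasDerivAt_id x).sub_const x₀).div_const s
    have d0 : ∀ x, HasDerivAt (fun x => (φ ((x - x₀) / s) : ℂ)) ((φ' ((x - x₀) / s) * (1 / s) : ℝ) : ℂ) x :=
      fun x => ((hφ _).comp x (harg x)).ofReal_comp
    have d1 : ∀ x, HasDerivAt (fun x => ((φ' ((x - x₀) / s) * (1 / s) : ℝ) : ℂ))
        ((φ'' ((x - x₀) / s) * (1 / s) * (1 / s) : ℝ) : ℂ) x :=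
      fun x => (((hφ' _).comp x (harg x)).mul_const (1 / s)).ofReal_comp
    set u : ℝ → ℂ := fun x => (φ ((x - x₀) / s) : ℂ) * y x with hu
    set v : ℝ → ℂ := fun x => ((φ' ((x - x₀) / s) * (1 / s) : ℝ) : ℂ) * y x
      + (φ ((x - x₀) / s) : ℂ) * y' x with hv
    set h : ℝ → ℂ := fun x => (((φ'' ((x - x₀) / s) * (1 / s) * (1 / s) : ℝ) : ℂ) * y x
        + ((φ' ((x - x₀) / s) * (1 / s) : ℝ) : ℂ) * y' x)
      + (((φ' ((x - x₀) / s) * (1 / s) : ℝ) : ℂ) * y' x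
        + (φ ((x - x₀) / s) : ℂ) * ((V x - c) * y x)) with hh
    have hud : ∀ x, HasDerivAt u (v x) x := fun x => (d0 x).mul (hy x)
    have hvd : ∀ x, HasDerivAt v (h x) x := fun x =>
      ((d1 x).mul (hy x)).add ((d0 x).mul (hy' x))
    have huc : Continuous u := continuous_iff_continuousAt.2 fun x => (hud x).continuousAt
    have hhc : Continuous h := by fun_prop
    have hout : ∀ x, x ∉ Metric.closedBall x₀ (2 * s) → 2 < |(x - x₀) / s| := by
      intro x hx
      rw [Metric.mem_closedBall, Real.dist_eq, not_le] at hx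
      rw [abs_div, abs_of_pos hs0, lt_div_iff₀ hs0]
      exact hx
    have hucs : HasCompactSupport u := HasCompactSupport.intro (isCompact_closedBall x₀ (2 * s))
      fun x hx => by simp [hu, hz _ (hout x hx)]
    have hgcs : HasCompactSupport fun x => -h x + V x * u x :=
      HasCompactSupport.intro (isCompact_closedBall x₀ (2 * s)) fun x hx => by
        simp [hu, hh, hz _ (hout x hx), hz' _ (hout x hx), hz'' _ (hout x hx)]
    have m1 : MemLp u 2 volume := huc.memLp_of_hasCompactSupport hucs
    have m2 : MemLp (fun x => -h x + V x * u x) 2 volume :=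
      Continuous.memLp_of_hasCompactSupport (by fun_prop) hgcs
    have key := hK _ _ (mem_schrodingerGraph_of_hasDerivAt hud hvd hhc m1 m2)
    have e1 : m2.toLp _ - c • m1.toLp u = (m2.sub (m1.const_smul c)).toLp _ := by
      rw [MemLp.toLp_sub m2 (m1.const_smul c), MemLp.toLp_const_smul]
    rw [e1, Lp.norm_toLp, Lp.norm_toLp] at key
    have e2 : eLpNorm ((fun x => -h x + V x * u x) - c • u) 2 volume
        ≤ ENNReal.ofReal (6 * D * B / t) := by
      set r : ℝ := 3 * D * B / s with hr
      have hr0 : 0 ≤ r := by positivity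
      have hle : eLpNorm ((fun x => -h x + V x * u x) - c • u) 2 volume
          ≤ eLpNorm ((Metric.closedBall x₀ (2 * s)).indicator fun _ => r) 2 volume := by
        refine eLpNorm_mono_real fun x => ?_
        by_cases hx : x ∈ Metric.closedBall x₀ (2 * s)
        · rw [Set.indicator_of_mem hx]
          have e3 : ((fun x => -h x + V x * u x) - c • u) x
              = -(((φ'' ((x - x₀) / s) * (1 / s) * (1 / s) : ℝ) : ℂ) * y x)
                + -(2 * ((φ' ((x - x₀) / s) * (1 / s) : ℝ) : ℂ) * y' x) := by
            simp only [Pi.sub_apply, Pi.smul_apply, smul_eq_mul, hu, hh]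
            ring
          rw [e3]
          refine (norm_add_le _ _).trans ?_
          simp only [norm_neg, norm_mul, Complex.norm_real, Real.norm_eq_abs, Complex.norm_ofNat]
          simp only [abs_of_pos (by positivity : 0 < 1 / s)]
          have i1 : |φ'' ((x - x₀) / s)| * (1 / s) * (1 / s) * ‖y x‖ ≤ D * (1 / s) * 1 * B := by
            gcongr
            · exact hD2 _
            · exact (div_le_one hs0).2 hs1
            · exact hB x
          have i2 : 2 * (|φ' ((x - x₀) / s)| * (1 / s)) * ‖y' x‖ ≤ 2 * (D * (1 / s)) * B := by
            gcongr
            · exact hD1 _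
            · exact hB' x
          calc _ ≤ D * (1 / s) * 1 * B + 2 * (D * (1 / s)) * B := add_le_add i1 i2
            _ = r := by rw [hr]; ring
        · rw [Set.indicator_of_notMem hx]
          simp [hu, hh, hz _ (hout x hx), hz' _ (hout x hx), hz'' _ (hout x hx)]
      refine hle.trans ?_
      rw [eLpNorm_indicator_const measurableSet_closedBall (by norm_num) (by norm_num),
        Real.volume_closedBall, Real.enorm_eq_ofReal hr0]
      rw [show (2 * (2 * s)) = (2 * t) ^ 2 by rw [hs]; ring, ENNReal.toReal_ofNat,
        ENNReal.ofReal_rpow_of_nonneg (by positivity) (by norm_num), ← ENNReal.ofReal_mul hr0,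
        ← Real.sqrt_eq_rpow, Real.sqrt_sq (by positivity)]
      refine ENNReal.ofReal_le_ofReal (le_of_eq ?_)
      rw [hr, hs]
      field_simp
      ring
    have e4 : δ ≤ eLpNorm u 2 volume := by
      refine eLpNorm_mono fun x => ?_
      by_cases hx : x ∈ S
      · rw [Set.indicator_of_mem hx]
        have : |(x - x₀) / s| ≤ 1 := by
          rw [abs_div, abs_of_pos hs0, div_le_one hs0]
          refine (abs_le.2 ⟨?_, ?_⟩).trans hs1
          · linarith [hx.1]
          · linarith [hx.2]
        simp [hu, hone _ this]
      · rw [Set.indicator_of_notMem hx]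
        simp
    have hK0 : 0 ≤ K ∨ K < 0 := le_or_gt 0 K
    have e5 : δ.toReal ≤ (eLpNorm u 2 volume).toReal :=
      ENNReal.toReal_mono m1.eLpNorm_ne_top e4
    have hq : 0 ≤ 6 * D * B / t := by positivity
    have e6 := ENNReal.toReal_mono ENNReal.ofReal_ne_top e2
    rw [ENNReal.toReal_ofReal hq] at e6
    have hpos : 0 < δ.toReal := ENNReal.toReal_pos hδ0 (e4.trans_lt m1.eLpNorm_lt_top).ne
    have e7 := e5.trans key
    rcases hK0 with hK0 | hK0
    · exact e7.trans (mul_le_mul_of_nonneg_left e6 hK0)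
    · nlinarith [ENNReal.toReal_nonneg (a := eLpNorm ((fun x => -h x + V x * u x) - c • u) 2 volume)]
  have hδt : δ ≠ ⊤ := by
    rw [hδ, eLpNorm_indicator_eq_eLpNorm_restrict hSm]
    refine ((eLpNorm_le_of_ae_bound (C := B) (ae_of_all _ hB)).trans_lt ?_).ne
    simp only [Measure.restrict_apply MeasurableSet.univ, Set.univ_inter, hS, Real.volume_Icc]
    finiteness
  have hlim : Tendsto (fun t : ℝ => K * (6 * D * B / t)) atTop (𝓝 (K * 0)) :=
    (tendsto_const_nhds.div_atTop tendsto_id).const_mul K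
  have := ge_of_tendsto hlim ((eventually_ge_atTop 1).mono main)
  rw [mul_zero] at this
  exact absurd (ENNReal.toReal_pos hδ0 hδt) (not_lt.2 this)

end Lame

namespace Lame

open Filter Topology Set
open scoped ENNReal

/-! ### Functions which are multiplied by a constant under translation by a period -/

/-- A continuous function with multiplier `ρ` under `x ↦ x + 2` grows or decays exponentially. -/
lemma exists_norm_le_mul_exp {y : ℝ → ℂ} (hy : Continuous y) {ρ : ℂ} {α : ℝ}
    (hρ : ‖ρ‖ = Real.exp (2 * α)) (hper : ∀ x, y (x + 2) = ρ * y x) :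
    ∃ A : ℝ, 0 ≤ A ∧ ∀ x, ‖y x‖ ≤ A * Real.exp (α * x) := by
  -- Dividing out the exponential leaves a continuous function of period 2, hence a bounded one.
  set p : ℝ → ℝ := fun x => ‖y x‖ * Real.exp (-(α * x)) with hp
  have hpc : Continuous p := by fun_prop
  have hpp : Function.Periodic p 2 := by
    intro x
    simp only [hp, hper, norm_mul, hρ]
    rw [show -(α * x) = 2 * α + -(α * (x + 2)) by ring, Real.exp_add (2 * α)]
    ring
  obtain ⟨A, hA⟩ := (isCompact_Icc (a := (0 : ℝ)) (b := 2)).exists_bound_of_continuousOn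
    hpc.continuousOn
  have hA' : ∀ x, p x ≤ A := by
    intro x
    obtain ⟨t, ht, hxt⟩ := hpp.exists_mem_Ico₀ two_pos x
    rw [hxt]
    exact (le_abs_self _).trans (hA t (Ico_subset_Icc_self ht))
  refine ⟨A, le_trans (by positivity) (hA' 0), fun x => ?_⟩
  have h := mul_le_mul_of_nonneg_right (hA' x) (Real.exp_pos (α * x)).le
  simpa only [hp, mul_assoc, ← Real.exp_add, neg_add_cancel, Real.exp_zero, mul_one] using h

/-- A square integrable continuous function whose multiplier is not of modulus one vanishes. -/
lemma eq_zero_of_memLp_of_multiplier {y : ℝ → ℂ} (hy : Continuous y) (hL : MemLp y 2 volume)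
    {ρ : ℂ} (hρ : ‖ρ‖ ≠ 1) {T : ℝ} (hper : ∀ x, y (x + T) = ρ * y x) : y = 0 := by
  have h1 : eLpNorm (y ∘ fun x => x + T) 2 volume = eLpNorm y 2 volume :=
    eLpNorm_comp_measurePreserving hy.aestronglyMeasurable (measurePreserving_add_right volume T)
  have h2 : (y ∘ fun x => x + T) = ρ • y := funext hper
  rw [h2, eLpNorm_const_smul] at h1
  have h3 : ‖ρ‖ * (eLpNorm y 2 volume).toReal = (eLpNorm y 2 volume).toReal := by
    simpa using congrArg ENNReal.toReal h1
  have h4 : (‖ρ‖ - 1) * (eLpNorm y 2 volume).toReal = 0 := by linarith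
  have h5 := (mul_eq_zero.1 h4).resolve_left (sub_ne_zero.2 hρ)
  have h6 := ((ENNReal.toReal_eq_zero_iff _).1 h5).resolve_right hL.eLpNorm_ne_top
  rw [eLpNorm_eq_zero_iff hy.aestronglyMeasurable (by norm_num)] at h6
  exact (hy.ae_eq_iff_eq volume continuous_zero).1 h6

/-! ### Schur's test for convolution kernels -/

/-- Cauchy–Schwarz with the kernel split as `k^(1/2) * k^(1/2)`, followed by Tonelli and translation
invariance. -/
lemma lintegral_sq_lintegral_mul_le {k G : ℝ → ℝ≥0∞} (hk : Measurable k) (hG : Measurable G) :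
    ∫⁻ x, (∫⁻ t, k (x - t) * G t) ^ 2 ≤ (∫⁻ x, k x) ^ 2 * ∫⁻ t, G t ^ 2 := by
  have hroot : ∀ a : ℝ≥0∞, a ^ (1 / 2 : ℝ) * a ^ (1 / 2 : ℝ) = a := fun a => by
    rw [← ENNReal.rpow_add_of_nonneg _ _ (by norm_num) (by norm_num)]
    norm_num
  have hcs : ∀ x, (∫⁻ t, k (x - t) * G t) ^ 2 ≤ (∫⁻ s, k s) * ∫⁻ t, k (x - t) * G t ^ 2 := by
    intro x
    have h1 := ENNReal.lintegral_mul_norm_pow_le (μ := volume) (f := fun t => k (x - t))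
      (g := fun t => k (x - t) * G t ^ 2) (by fun_prop) (by fun_prop)
      (p := 1 / 2) (q := 1 / 2) (by norm_num) (by norm_num) (by norm_num)
    have h2 : ∀ t, k (x - t) ^ (1 / 2 : ℝ) * (k (x - t) * G t ^ 2) ^ (1 / 2 : ℝ)
        = k (x - t) * G t := by
      intro t
      rw [ENNReal.mul_rpow_of_nonneg _ _ (by norm_num), ← mul_assoc, hroot,
        ← ENNReal.rpow_natCast, ← ENNReal.rpow_mul]
      norm_num
    simp only [h2] at h1
    rw [lintegral_sub_left_eq_self (fun s => k s) x] at h1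
    calc (∫⁻ t, k (x - t) * G t) ^ 2
        ≤ ((∫⁻ s, k s) ^ (1 / 2 : ℝ) * (∫⁻ t, k (x - t) * G t ^ 2) ^ (1 / 2 : ℝ)) ^ 2 := by gcongr
      _ = _ := by rw [sq, mul_mul_mul_comm, hroot, hroot]
  calc ∫⁻ x, (∫⁻ t, k (x - t) * G t) ^ 2
      ≤ ∫⁻ x, (∫⁻ s, k s) * ∫⁻ t, k (x - t) * G t ^ 2 := lintegral_mono hcs
    _ = (∫⁻ s, k s) * ∫⁻ x, ∫⁻ t, k (x - t) * G t ^ 2 := by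
        refine lintegral_const_mul _ (Measurable.lintegral_prod_right' (f := fun p : ℝ × ℝ =>
          k (p.1 - p.2) * G p.2 ^ 2) ?_)
        fun_prop
    _ = (∫⁻ s, k s) * ∫⁻ t, ∫⁻ x, k (x - t) * G t ^ 2 := by
        rw [lintegral_lintegral_swap]
        exact Measurable.aemeasurable (by fun_prop)
    _ = (∫⁻ s, k s) * ∫⁻ t, (∫⁻ s, k s) * G t ^ 2 := by
        congr 1
        refine lintegral_congr fun t => ?_
        rw [lintegral_mul_const _ (by fun_prop), lintegral_sub_right_eq_self (fun s => k s) t]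
    _ = _ := by
        rw [lintegral_const_mul _ (by fun_prop), ← mul_assoc, ← sq]

lemma lintegral_exp_neg_abs_ne_top {α : ℝ} (hα : 0 < α) :
    ∫⁻ x : ℝ, ENNReal.ofReal (Real.exp (-(α * |x|))) ≠ ∞ := by
  have h : Integrable (fun x : ℝ => Real.exp (-(α * |x|))) volume := by
    rw [← integrableOn_univ, ← Iic_union_Ioi (a := (0 : ℝ))]
    refine IntegrableOn.union ?_ ?_
    · refine (integrableOn_exp_mul_Iic hα 0).congr_fun (fun x hx => ?_) measurableSet_Iic
      simp only [abs_of_nonpos (mem_Iic.1 hx), mul_neg, neg_neg]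
    · refine (integrableOn_exp_mul_Ioi (neg_lt_zero.2 hα) 0).congr_fun (fun x hx => ?_)
        measurableSet_Ioi
      simp only [abs_of_pos (mem_Ioi.1 hx), neg_mul]
  rw [← ofReal_integral_eq_lintegral_ofReal h (ae_of_all _ fun x => (Real.exp_pos _).le)]
  exact ENNReal.ofReal_ne_top

/-! ### Integration by parts with a locally integrable density -/

/-- The density `φ` is only locally integrable, so `A` need not be differentiable everywhere; Fubini
for `y'(x) φ(t)` on the triangle `t ≤ x` replaces the product rule. -/
lemma mul_sub_mul_eq_integral {y y' A φ : ℝ → ℂ} (hy : ∀ x, HasDerivAt y (y' x) x)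
    (hy' : Continuous y') (hφ : LocallyIntegrable φ volume) (hAc : Continuous A)
    (hA : ∀ a b, A b - A a = ∫ t in a..b, φ t) (a b : ℝ) :
    y b * A b - y a * A a = ∫ x in a..b, (y' x * A x + y x * φ x) := by
  have hyc : Continuous y := continuous_iff_continuousAt.2 fun x => (hy x).continuousAt
  have hφi : ∀ a b : ℝ, IntervalIntegrable φ volume a b := fun a b =>
    (hφ.integrableOn_isCompact isCompact_uIcc).intervalIntegrable
  have hyφ : ∀ a b : ℝ, IntervalIntegrable (fun x => y x * φ x) volume a b := fun a b =>
    (hφi a b).continuousOn_mul hyc.continuousOn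
  wlog hab : a ≤ b generalizing a b
  · rw [intervalIntegral.integral_symm, ← this b a (le_of_not_ge hab)]
    ring
  have hfub : ∫ x in Ioc a b, ∫ t in Ioc a b, (if t ≤ x then y' x * φ t else 0)
      = ∫ t in Ioc a b, ∫ x in Ioc a b, (if t ≤ x then y' x * φ t else 0) := by
    refine integral_integral_swap ?_
    have h1 : Integrable (fun p : ℝ × ℝ => y' p.1 * φ p.2)
        ((volume.restrict (Ioc a b)).prod (volume.restrict (Ioc a b))) := by
      refine Integrable.mul_prod ?_ ?_
      · exact (hy'.integrableOn_Icc.mono_set Ioc_subset_Icc_self)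
      · exact (hφ.integrableOn_isCompact isCompact_Icc).mono_set Ioc_subset_Icc_self
    refine (h1.indicator (measurableSet_le measurable_snd measurable_fst)).congr
      (ae_of_all _ fun p => ?_)
    simp only [indicator, mem_ofPred_eq, Function.uncurry]
  have hl : ∀ x ∈ Ioc a b, ∫ t in Ioc a b, (if t ≤ x then y' x * φ t else 0)
      = y' x * (A x - A a) := by
    intro x hx
    have e : (fun t => if t ≤ x then y' x * φ t else 0)
        = (Iic x).indicator fun t => y' x * φ t := by
      funext t
      simp only [indicator, mem_Iic]
    rw [e, setIntegral_indicator measurableSet_Iic, Ioc_inter_Iic, min_eq_right hx.2,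
      integral_const_mul, hA, intervalIntegral.integral_of_le hx.1.le]
  have hr : ∀ t ∈ Ioc a b, ∫ x in Ioc a b, (if t ≤ x then y' x * φ t else 0)
      = (y b - y t) * φ t := by
    intro t ht
    have e : (fun x => if t ≤ x then y' x * φ t else 0)
        = (Ici t).indicator fun x => y' x * φ t := by
      funext x
      simp only [indicator, mem_Ici]
    have e2 : Ioc a b ∩ Ici t = Icc t b := by
      ext x
      simp only [mem_inter_iff, mem_Ioc, mem_Ici, mem_Icc]
      exact ⟨fun h => ⟨h.2, h.1.2⟩, fun h => ⟨⟨ht.1.trans_le h.1, h.2⟩, h.1⟩⟩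
    rw [e, setIntegral_indicator measurableSet_Ici, e2, integral_mul_const, integral_Icc_eq_integral_Ioc,
      ← intervalIntegral.integral_of_le ht.2,
      intervalIntegral.integral_eq_sub_of_hasDerivAt (fun x _ => hy x) (hy'.intervalIntegrable _ _)]
  rw [setIntegral_congr_fun measurableSet_Ioc hl, setIntegral_congr_fun measurableSet_Ioc hr,
    ← intervalIntegral.integral_of_le hab, ← intervalIntegral.integral_of_le hab] at hfub
  have hyA : IntervalIntegrable (fun x => y' x * A x) volume a b :=
    (hy'.mul hAc).intervalIntegrable a b
  have i1 : ∫ x in a..b, y' x * (A x - A a) = (∫ x in a..b, y' x * A x) - (y b - y a) * A a := by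
    rw [← intervalIntegral.integral_eq_sub_of_hasDerivAt (fun x _ => hy x)
      (hy'.intervalIntegrable a b), ← intervalIntegral.integral_mul_const,
      ← intervalIntegral.integral_sub hyA ((hy'.intervalIntegrable a b).mul_const _)]
    simp only [mul_sub]
  have i2 : ∫ t in a..b, (y b - y t) * φ t = y b * (A b - A a) - ∫ t in a..b, y t * φ t := by
    rw [hA, ← intervalIntegral.integral_const_mul,
      ← intervalIntegral.integral_sub ((hφi a b).const_mul _) (hyφ a b)]
    simp only [sub_mul]
  rw [intervalIntegral.integral_add hyA (hyφ a b)]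
  rw [i1, i2] at hfub
  linear_combination -hfub

end Lame

namespace Lame

open Filter Topology Set
open scoped ENNReal

/-! ### The Green's function of a pair of exponentially decaying solutions -/

lemma integrableOn_mul_of_exp_bound {y g : ℝ → ℂ} (hy : Continuous y) (hg : MemLp g 2 volume)
    {A α : ℝ} (hA : ∀ x, ‖y x‖ ≤ A * Real.exp (α * x)) {s : Set ℝ}
    (hi : IntegrableOn (fun x => Real.exp (2 * α * x)) s) :
    IntegrableOn (fun x => y x * g x) s := by
  have hm : MemLp y 2 (volume.restrict s) := by
    rw [memLp_two_iff_integrable_sq_norm hy.aestronglyMeasurable]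
    refine (hi.const_mul (A ^ 2)).mono' (by fun_prop) (ae_of_all _ fun x => ?_)
    rw [Real.norm_eq_abs, abs_of_nonneg (by positivity)]
    calc ‖y x‖ ^ (2 : ℕ) ≤ (A * Real.exp (α * x)) ^ 2 := by gcongr; exact hA x
      _ = _ := by rw [mul_pow, ← Real.exp_nat_mul]; push_cast; ring_nf
  exact hm.integrable_mul (hg.restrict s)

/-- The square integrable solution of `-u'' + (V - c) u = g` given by variation of constants. -/
theorem exists_green_solution {V : ℝ → ℂ} (hV : Continuous V) {c : ℂ} {y₁ y₁' y₂ y₂' : ℝ → ℂ}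
    (hy₁ : ∀ x, HasDerivAt y₁ (y₁' x) x) (hy₁' : ∀ x, HasDerivAt y₁' ((V x - c) * y₁ x) x)
    (hy₂ : ∀ x, HasDerivAt y₂ (y₂' x) x) (hy₂' : ∀ x, HasDerivAt y₂' ((V x - c) * y₂ x) x)
    {W : ℂ} (hW0 : W ≠ 0) (hW : ∀ x, y₁ x * y₂' x - y₁' x * y₂ x = W)
    {α A : ℝ} (hα : 0 < α) (hA0 : 0 ≤ A) (hA₁ : ∀ x, ‖y₁ x‖ ≤ A * Real.exp (-α * x))
    (hA₂ : ∀ x, ‖y₂ x‖ ≤ A * Real.exp (α * x)) (g : L2) :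
    ∃ f : L2, (f, g + c • f) ∈ schrodingerGraph V ∧
      ‖f‖ ≤ (‖W⁻¹‖ * A ^ 2 * (∫⁻ x : ℝ, ENNReal.ofReal (Real.exp (-(α * |x|)))).toReal) * ‖g‖ := by
  have hc₁ : Continuous y₁ := continuous_iff_continuousAt.2 fun x => (hy₁ x).continuousAt
  have hc₁' : Continuous y₁' := continuous_iff_continuousAt.2 fun x => (hy₁' x).continuousAt
  have hc₂ : Continuous y₂ := continuous_iff_continuousAt.2 fun x => (hy₂ x).continuousAt
  have hc₂' : Continuous y₂' := continuous_iff_continuousAt.2 fun x => (hy₂' x).continuousAt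
  have hg2 : MemLp g 2 volume := Lp.memLp g
  have hgm : Measurable g := (Lp.stronglyMeasurable g).measurable
  have hgl : LocallyIntegrable g volume := hg2.locallyIntegrable (by norm_num)
  have hI₂ : ∀ x, IntegrableOn (fun t => y₂ t * g t) (Iic x) := fun x =>
    integrableOn_mul_of_exp_bound hc₂ hg2 hA₂
      (integrableOn_exp_mul_Iic (by linarith) x)
  have hI₁ : ∀ x, IntegrableOn (fun t => y₁ t * g t) (Ioi x) := fun x =>
    integrableOn_mul_of_exp_bound hc₁ hg2 hA₁
      (integrableOn_exp_mul_Ioi (by linarith) x)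
  -- Each solution is integrated towards the end where it decays, so both integrals converge for
  -- square integrable `g`.
  set P : ℝ → ℂ := fun x => ∫ t in Iic x, y₂ t * g t with hP
  set Q : ℝ → ℂ := fun x => ∫ t in Ioi x, y₁ t * g t with hQ
  have hl₂ : LocallyIntegrable (fun t => y₂ t * g t) volume := hgl.continuous_mul hc₂
  have hl₁ : LocallyIntegrable (fun t => -(y₁ t * g t)) volume := (hgl.continuous_mul hc₁).neg
  have hPi : ∀ a b, P b - P a = ∫ t in a..b, y₂ t * g t := fun a b =>
    intervalIntegral.integral_Iic_sub_Iic (hI₂ a) (hI₂ b)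
  have hQi : ∀ a b, Q b - Q a = ∫ t in a..b, -(y₁ t * g t) := fun a b => by
    rw [intervalIntegral.integral_neg, ← intervalIntegral.integral_Ioi_sub_Ioi' (hI₁ a) (hI₁ b)]
    ring
  have hcont : ∀ {φ R : ℝ → ℂ}, LocallyIntegrable φ volume →
      (∀ a b, R b - R a = ∫ t in a..b, φ t) → Continuous R := by
    intro φ R hφ hR
    have e : R = fun b => R 0 + ∫ t in (0 : ℝ)..b, φ t := funext fun b => by rw [← hR]; ring
    rw [e]
    exact continuous_const.add (intervalIntegral.continuous_primitive (fun a b =>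
      (hφ.integrableOn_isCompact isCompact_uIcc).intervalIntegrable) 0)
  have hPc : Continuous P := hcont hl₂ hPi
  have hQc : Continuous Q := hcont hl₁ hQi
  set u : ℝ → ℂ := fun x => W⁻¹ * (y₁ x * P x + y₂ x * Q x) with hu
  set v : ℝ → ℂ := fun x => W⁻¹ * (y₁' x * P x + y₂' x * Q x) with hv
  set h : ℝ → ℂ := fun x => (V x - c) * u x - g x with hh
  have huc : Continuous u := by fun_prop
  have hvc : Continuous v := by fun_prop
  have hint : ∀ {k : ℝ → ℂ} (a b : ℝ), LocallyIntegrable k volume →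
      IntervalIntegrable k volume a b := fun a b hk =>
    (hk.integrableOn_isCompact isCompact_uIcc).intervalIntegrable
  have hui : ∀ a b, u b - u a = ∫ x in a..b, v x := by
    intro a b
    have e1 := mul_sub_mul_eq_integral hy₁ hc₁' hl₂ hPc hPi a b
    have e2 := mul_sub_mul_eq_integral hy₂ hc₂' hl₁ hQc hQi a b
    have j1 : IntervalIntegrable (fun x => y₁' x * P x + y₁ x * (y₂ x * g x)) volume a b :=
      (Continuous.intervalIntegrable (by fun_prop) a b).add (hint a b (hl₂.continuous_mul hc₁))
    have j2 : IntervalIntegrable (fun x => y₂' x * Q x + y₂ x * -(y₁ x * g x)) volume a b :=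
      (Continuous.intervalIntegrable (by fun_prop) a b).add (hint a b (hl₁.continuous_mul hc₂))
    calc u b - u a = W⁻¹ * ((y₁ b * P b - y₁ a * P a) + (y₂ b * Q b - y₂ a * Q a)) := by
          simp only [hu]; ring
      _ = ∫ x in a..b, v x := by
          rw [e1, e2, ← intervalIntegral.integral_add j1 j2, ← intervalIntegral.integral_const_mul]
          refine intervalIntegral.integral_congr fun x _ => ?_
          simp only [hv]
          ring
  have hvi : ∀ a b, v b - v a = ∫ x in a..b, h x := by
    intro a b
    have e1 := mul_sub_mul_eq_integral hy₁' (by fun_prop) hl₂ hPc hPi a b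
    have e2 := mul_sub_mul_eq_integral hy₂' (by fun_prop) hl₁ hQc hQi a b
    have j1 : IntervalIntegrable (fun x => (V x - c) * y₁ x * P x + y₁' x * (y₂ x * g x))
        volume a b :=
      (Continuous.intervalIntegrable (by fun_prop) a b).add (hint a b (hl₂.continuous_mul hc₁'))
    have j2 : IntervalIntegrable (fun x => (V x - c) * y₂ x * Q x + y₂' x * -(y₁ x * g x))
        volume a b :=
      (Continuous.intervalIntegrable (by fun_prop) a b).add (hint a b (hl₁.continuous_mul hc₂'))
    calc v b - v a = W⁻¹ * ((y₁' b * P b - y₁' a * P a) + (y₂' b * Q b - y₂' a * Q a)) := by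
          simp only [hv]; ring
      _ = ∫ x in a..b, h x := by
          rw [e1, e2, ← intervalIntegral.integral_add j1 j2, ← intervalIntegral.integral_const_mul]
          refine intervalIntegral.integral_congr fun x _ => ?_
          simp only [hh, hu]
          have := hW x
          field_simp
          -- In `u'` the contributions of `P'` and `Q'` cancel; in `v'` they combine to minus the
          -- Wronskian times `g`, which gives the inhomogeneity.
          linear_combination (-g x) * this
  have hud : ∀ x, HasDerivAt u (v x) x := by
    intro x
    have e : u = fun b => u 0 + ∫ t in (0 : ℝ)..b, v t := funext fun b => by rw [← hui]; ring
    rw [e]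
    exact ((hvc.integral_hasStrictDerivAt 0 x).hasDerivAt).const_add _
  set k : ℝ → ℝ≥0∞ := fun x => ENNReal.ofReal (Real.exp (-(α * |x|))) with hk
  have hkm : Measurable k := by fun_prop
  -- For `t ≤ x` the kernel is `y₁(x) y₂(t) / W`, for `t > x` it is `y₂(x) y₁(t) / W`; in both cases
  -- the growth bounds combine to `exp (-α |x - t|)`.
  have hbound : ∀ x, ‖u x‖ₑ ≤ ‖W⁻¹‖ₑ * ENNReal.ofReal (A ^ 2) * ∫⁻ t, k (x - t) * ‖g t‖ₑ := by
    intro x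
    have b1 : ‖y₁ x * P x‖ₑ ≤ ENNReal.ofReal (A ^ 2) * ∫⁻ t in Iic x, k (x - t) * ‖g t‖ₑ := by
      rw [enorm_mul, ← lintegral_const_mul _ (by fun_prop)]
      refine (mul_le_mul_right (enorm_integral_le_lintegral_enorm _) _).trans ?_
      rw [← lintegral_const_mul _ (by fun_prop)]
      refine setLIntegral_mono (by fun_prop) fun t ht => ?_
      rw [enorm_mul, ← mul_assoc, ← mul_assoc]
      refine mul_le_mul_left ?_ _
      rw [hk, ← ENNReal.ofReal_mul (by positivity), ← ofReal_norm, ← ofReal_norm,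
        ← ENNReal.ofReal_mul (norm_nonneg _)]
      refine ENNReal.ofReal_le_ofReal ?_
      refine (mul_le_mul (hA₁ x) (hA₂ t) (norm_nonneg _) (by positivity)).trans (le_of_eq ?_)
      rw [abs_of_nonneg (sub_nonneg.2 ht), mul_mul_mul_comm, ← Real.exp_add, ← sq]
      ring_nf
    have b2 : ‖y₂ x * Q x‖ₑ ≤ ENNReal.ofReal (A ^ 2) * ∫⁻ t in Ioi x, k (x - t) * ‖g t‖ₑ := by
      rw [enorm_mul, ← lintegral_const_mul _ (by fun_prop)]
      refine (mul_le_mul_right (enorm_integral_le_lintegral_enorm _) _).trans ?_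
      rw [← lintegral_const_mul _ (by fun_prop)]
      refine setLIntegral_mono (by fun_prop) fun t ht => ?_
      rw [enorm_mul, ← mul_assoc, ← mul_assoc]
      refine mul_le_mul_left ?_ _
      rw [hk, ← ENNReal.ofReal_mul (by positivity), ← ofReal_norm, ← ofReal_norm,
        ← ENNReal.ofReal_mul (norm_nonneg _)]
      refine ENNReal.ofReal_le_ofReal ?_
      refine (mul_le_mul (hA₂ x) (hA₁ t) (norm_nonneg _) (by positivity)).trans (le_of_eq ?_)
      rw [abs_of_neg (sub_neg.2 ht), mul_mul_mul_comm, ← Real.exp_add, ← sq]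
      ring_nf
    rw [mul_assoc, hu, enorm_mul]
    refine mul_le_mul_right ((enorm_add_le _ _).trans ((add_le_add b1 b2).trans (le_of_eq ?_))) _
    rw [← mul_add, ← compl_Iic, lintegral_add_compl _ measurableSet_Iic]
  set I : ℝ≥0∞ := ∫⁻ x, k x with hI
  have hIt : I ≠ ∞ := lintegral_exp_neg_abs_ne_top hα
  set C : ℝ≥0∞ := ‖W⁻¹‖ₑ * ENNReal.ofReal (A ^ 2) with hC
  have hsq : ∀ w : ℝ → ℂ, eLpNorm w 2 volume ^ 2 = ∫⁻ x, ‖w x‖ₑ ^ 2 := fun w => by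
    have := eLpNorm_nnreal_pow_eq_lintegral (μ := volume) (f := w) (p := 2) (by norm_num)
    simpa using this
  have hnorm : eLpNorm u 2 volume ≤ C * I * eLpNorm g 2 volume := by
    refine (ENNReal.pow_le_pow_left_iff (n := 2) (by norm_num)).1 ?_
    rw [mul_pow, hsq, hsq, mul_pow, mul_assoc]
    calc ∫⁻ x, ‖u x‖ₑ ^ 2 ≤ ∫⁻ x, C ^ 2 * (∫⁻ t, k (x - t) * ‖g t‖ₑ) ^ 2 :=
          lintegral_mono fun x => by rw [← mul_pow]; gcongr; exact hbound x
      _ = C ^ 2 * ∫⁻ x, (∫⁻ t, k (x - t) * ‖g t‖ₑ) ^ 2 := by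
          refine lintegral_const_mul _ (Measurable.pow_const (Measurable.lintegral_prod_right'
            (f := fun p : ℝ × ℝ => k (p.1 - p.2) * ‖g p.2‖ₑ) ?_) 2)
          fun_prop
      _ ≤ C ^ 2 * (I ^ 2 * ∫⁻ t, ‖g t‖ₑ ^ 2) := by
          gcongr
          exact lintegral_sq_lintegral_mul_le hkm (by fun_prop)
  have hCt : C * I ≠ ∞ := ENNReal.mul_ne_top (ENNReal.mul_ne_top (by simp) (by simp)) hIt
  have hum : MemLp u 2 volume := ⟨huc.aestronglyMeasurable,
    hnorm.trans_lt (ENNReal.mul_lt_top hCt.lt_top hg2.eLpNorm_lt_top)⟩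
  refine ⟨hum.toLp u, ⟨u, v, h, hum.coeFn_toLp, hud, ?_, hvi, ?_⟩, ?_⟩
  · exact (Continuous.locallyIntegrable (by fun_prop)).sub hgl
  · filter_upwards [Lp.coeFn_add g (c • hum.toLp u), Lp.coeFn_smul c (hum.toLp u),
      hum.coeFn_toLp] with x e1 e2 e3
    rw [e1, Pi.add_apply, e2, Pi.smul_apply, e3, smul_eq_mul]
    simp only [hh]
    ring
  · rw [Lp.norm_toLp, Lp.norm_def]
    have := ENNReal.toReal_mono (ENNReal.mul_ne_top hCt hg2.eLpNorm_ne_top) hnorm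
    rw [ENNReal.toReal_mul, ENNReal.toReal_mul, hC, ENNReal.toReal_mul, toReal_enorm,
      ENNReal.toReal_ofReal (by positivity)] at this
    exact this

end Lame

/-! ### Absence of eigenfunctions and points of the resolvent set -/

namespace Lame

open Filter Topology Set

/-- A pair `(f, c f)` in the graph comes from a classical solution of the differential equation. -/
lemma exists_hasDerivAt_of_mem_schrodingerGraph {V : ℝ → ℂ} (hV : Continuous V) {c : ℂ} {f : L2}
    (hf : (f, c • f) ∈ schrodingerGraph V) :
    ∃ u v : ℝ → ℂ, f =ᵐ[volume] u ∧ (∀ x, HasDerivAt u (v x) x) ∧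
      ∀ x, HasDerivAt v ((V x - c) * u x) x := by
  obtain ⟨u, v, h, h1, h2, h3, h4, h5⟩ := hf
  refine ⟨u, v, h1, h2, fun x => ?_⟩
  have huc : Continuous u := continuous_iff_continuousAt.2 fun x => (h2 x).continuousAt
  have hh : h =ᵐ[volume] fun x => (V x - c) * u x := by
    filter_upwards [h1, h5, Lp.coeFn_smul c f] with x e1 e2 e3
    rw [e3, Pi.smul_apply, e1, smul_eq_mul] at e2
    linear_combination e2
  have e : v = fun b => v 0 + ∫ t in (0 : ℝ)..b, (V t - c) * u t := by
    funext b
    rw [← intervalIntegral.integral_congr_ae (hh.mono fun x hx _ => hx), ← h4]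
    ring
  have hc : Continuous fun t => (V t - c) * u t := by fun_prop
  rw [e]
  exact ((hc.integral_hasStrictDerivAt 0 x).hasDerivAt).const_add _

lemma wronskian_eq_const {q y y' u v : ℝ → ℂ} (hy : ∀ x, HasDerivAt y (y' x) x)
    (hy' : ∀ x, HasDerivAt y' (q x * y x) x) (hu : ∀ x, HasDerivAt u (v x) x)
    (hv : ∀ x, HasDerivAt v (q x * u x) x) (x : ℝ) :
    y x * v x - y' x * u x = y 0 * v 0 - y' 0 * u 0 := by
  have hd : ∀ x, HasDerivAt (fun x => y x * v x - y' x * u x) 0 x := fun x =>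
    (((hy x).mul (hv x)).sub ((hy' x).mul (hu x))).congr_deriv (by ring)
  exact is_const_of_deriv_eq_zero (fun x => (hd x).differentiableAt) (fun x => (hd x).deriv) x 0

/-- The Lamé-type operator with exponentially decaying solutions on both sides has no
square integrable eigenfunctions. -/
theorem eq_zero_of_mem_schrodingerGraph {V : ℝ → ℂ} (hV : Continuous V) {c : ℂ}
    {y₁ y₁' y₂ y₂' : ℝ → ℂ}
    (hy₁ : ∀ x, HasDerivAt y₁ (y₁' x) x) (hy₁' : ∀ x, HasDerivAt y₁' ((V x - c) * y₁ x) x)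
    (hy₂ : ∀ x, HasDerivAt y₂ (y₂' x) x) (hy₂' : ∀ x, HasDerivAt y₂' ((V x - c) * y₂ x) x)
    {W : ℂ} (hW0 : W ≠ 0) (hW : ∀ x, y₁ x * y₂' x - y₁' x * y₂ x = W)
    {ρ : ℂ} (hρ0 : ρ ≠ 0) (hρ : ‖ρ‖ ≠ 1) (hp₁ : ∀ x, y₁ (x + 2) = ρ * y₁ x)
    (hp₂ : ∀ x, y₂ (x + 2) = ρ⁻¹ * y₂ x) {f : L2} (hf : (f, c • f) ∈ schrodingerGraph V) :
    f = 0 := by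
  obtain ⟨u, v, hfu, hu, hv⟩ := exists_hasDerivAt_of_mem_schrodingerGraph hV hf
  have hc₂ : Continuous y₂ := continuous_iff_continuousAt.2 fun x => (hy₂ x).continuousAt
  have huc : Continuous u := continuous_iff_continuousAt.2 fun x => (hu x).continuousAt
  have huL : MemLp u 2 volume := (Lp.memLp f).ae_eq hfu
  set a : ℂ := y₂ 0 * v 0 - y₂' 0 * u 0 with ha
  set b : ℂ := y₁ 0 * v 0 - y₁' 0 * u 0 with hb
  have hcomb : ∀ x, W * u x = b * y₂ x - a * y₁ x := by
    intro x
    rw [ha, hb, ← wronskian_eq_const hy₁ hy₁' hu hv x, ← wronskian_eq_const hy₂ hy₂' hu hv x, ← hW x]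
    ring
  have hshift : ∀ x, W * u (x + 2) = b * (ρ⁻¹ * y₂ x) - a * (ρ * y₁ x) := fun x => by
    rw [hcomb, hp₁, hp₂]
  have hτ : MemLp (fun x => u (x + 2)) 2 volume :=
    huL.comp_measurePreserving (measurePreserving_add_right volume 2)
  -- The combination `u(x + 2) - ρ u(x)` eliminates `y₁`, so the `y₂` component of `u` is itself
  -- square integrable. Its multiplier forces it to vanish, and then `u` has multiplier `ρ` and
  -- vanishes too.
  have hw : MemLp (fun x => b * y₂ x) 2 volume := by
    have hne : ρ⁻¹ - ρ ≠ 0 := by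
      intro h0
      apply hρ
      have h1 : ρ * ρ = 1 := by
        field_simp at h0
        linear_combination -h0
      have h2 : ‖ρ‖ ^ 2 = 1 := by rw [sq, ← norm_mul, h1, norm_one]
      exact (pow_eq_one_iff_of_nonneg (norm_nonneg _) two_ne_zero).1 h2
    refine ((hτ.sub (huL.const_mul ρ)).const_mul (W / (ρ⁻¹ - ρ))).ae_eq (ae_of_all _ fun x => ?_)
    simp only [Pi.sub_apply]
    rw [div_mul_eq_mul_div, div_eq_iff hne]
    linear_combination hshift x - ρ * hcomb x
  have hu0 : u = 0 := by
    have hw0 : (fun x => b * y₂ x) = 0 :=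
      eq_zero_of_memLp_of_multiplier (by fun_prop) hw (ρ := ρ⁻¹)
        (by rwa [norm_inv, ne_eq, inv_eq_one]) (T := 2) fun x => by rw [hp₂]; ring
    refine eq_zero_of_memLp_of_multiplier huc huL hρ (T := 2) fun x => ?_
    have e0 : b * y₂ x = 0 := congrFun hw0 x
    refine mul_left_cancel₀ hW0 ?_
    linear_combination hshift x - ρ * hcomb x + (ρ⁻¹ - ρ) * e0
  refine Lp.ext ((hfu.trans (ae_of_all _ fun x => ?_)).trans (Lp.coeFn_zero ℂ 2 volume).symm)
  rw [hu0]

/-- A shift by 2 multiplies `y₁` by `ρ`, so `|ρ| = exp (-2α)` fixes the decay rate `α = -log |ρ| /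
2`; `y₂` decays at the same rate in the other direction. -/
theorem notMem_spectrum_of_multiplier_lt_one {V : ℝ → ℂ} (hV : Continuous V) {c : ℂ}
    {y₁ y₁' y₂ y₂' : ℝ → ℂ}
    (hy₁ : ∀ x, HasDerivAt y₁ (y₁' x) x) (hy₁' : ∀ x, HasDerivAt y₁' ((V x - c) * y₁ x) x)
    (hy₂ : ∀ x, HasDerivAt y₂ (y₂' x) x) (hy₂' : ∀ x, HasDerivAt y₂' ((V x - c) * y₂ x) x)
    {W : ℂ} (hW0 : W ≠ 0) (hW : ∀ x, y₁ x * y₂' x - y₁' x * y₂ x = W)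
    {ρ : ℂ} (hρ0 : ρ ≠ 0) (hρ : ‖ρ‖ < 1) (hp₁ : ∀ x, y₁ (x + 2) = ρ * y₁ x)
    (hp₂ : ∀ x, y₂ (x + 2) = ρ⁻¹ * y₂ x) : c ∉ unboundedSpectrum (schrodingerOperator V) := by
  have hρn : 0 < ‖ρ‖ := norm_pos_iff.2 hρ0
  obtain ⟨α, hαdef⟩ : ∃ α, α = -(Real.log ‖ρ‖) / 2 := ⟨_, rfl⟩
  have hα : 0 < α := by
    have := Real.log_neg hρn hρ
    linarith
  have e₁ : ‖ρ‖ = Real.exp (2 * -α) := by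
    rw [hαdef, show 2 * -(-(Real.log ‖ρ‖) / 2) = Real.log ‖ρ‖ by ring, Real.exp_log hρn]
  have e₂ : ‖ρ⁻¹‖ = Real.exp (2 * α) := by
    rw [norm_inv, e₁, ← Real.exp_neg]
    ring_nf
  have hc₁ : Continuous y₁ := continuous_iff_continuousAt.2 fun x => (hy₁ x).continuousAt
  have hc₂ : Continuous y₂ := continuous_iff_continuousAt.2 fun x => (hy₂ x).continuousAt
  obtain ⟨A₁, hA₁, h₁⟩ := exists_norm_le_mul_exp hc₁ e₁ hp₁
  obtain ⟨A₂, hA₂, h₂⟩ := exists_norm_le_mul_exp hc₂ e₂ hp₂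
  refine notMem_spectrum_of_exists_bound (fun g => exists_green_solution hV hy₁ hy₁' hy₂ hy₂' hW0 hW
    hα (hA₁.trans (le_max_left A₁ A₂)) (fun x => (h₁ x).trans ?_) (fun x => (h₂ x).trans ?_) g)
    fun f hf => eq_zero_of_mem_schrodingerGraph hV hy₁ hy₁' hy₂ hy₂' hW0 hW hρ0 hρ.ne hp₁ hp₂ hf
  · gcongr
    exact le_max_left _ _
  · gcongr
    exact le_max_right _ _

/-- If the multipliers are off the unit circle, the parameter is not in the spectrum. -/
theorem notMem_spectrum_of_multiplier {V : ℝ → ℂ} (hV : Continuous V) {c : ℂ}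
    {y₁ y₁' y₂ y₂' : ℝ → ℂ}
    (hy₁ : ∀ x, HasDerivAt y₁ (y₁' x) x) (hy₁' : ∀ x, HasDerivAt y₁' ((V x - c) * y₁ x) x)
    (hy₂ : ∀ x, HasDerivAt y₂ (y₂' x) x) (hy₂' : ∀ x, HasDerivAt y₂' ((V x - c) * y₂ x) x)
    {W : ℂ} (hW0 : W ≠ 0) (hW : ∀ x, y₁ x * y₂' x - y₁' x * y₂ x = W)
    {ρ : ℂ} (hρ0 : ρ ≠ 0) (hρ : ‖ρ‖ ≠ 1) (hp₁ : ∀ x, y₁ (x + 2) = ρ * y₁ x)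
    (hp₂ : ∀ x, y₂ (x + 2) = ρ⁻¹ * y₂ x) : c ∉ unboundedSpectrum (schrodingerOperator V) := by
  rcases hρ.lt_or_gt with h | h
  · exact notMem_spectrum_of_multiplier_lt_one hV hy₁ hy₁' hy₂ hy₂' hW0 hW hρ0 h hp₁ hp₂
  -- Exchanging the solutions inverts `ρ` and changes the sign of the Wronskian.
  · refine notMem_spectrum_of_multiplier_lt_one hV hy₂ hy₂' hy₁ hy₁' (neg_ne_zero.2 hW0)
      (fun x => ?_) (inv_ne_zero hρ0) ?_ hp₂ fun x => by rw [inv_inv]; exact hp₁ x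
    · rw [← hW x]
      ring
    · rw [norm_inv]
      exact inv_lt_one_of_one_lt₀ h

end Lame

namespace Lame

open Filter Topology Set

/-! ### The Lamé operator on an admissible line -/

lemma continuous_lamePotential (L : PeriodPair) (m : ℕ) {ω z₀ : ℂ}
    (hz : IsAdmissibleShift L ω z₀) : Continuous (lamePotential L m ω z₀) := by
  refine continuous_iff_continuousAt.2 fun x => ?_
  have h1 : ContinuousAt (fun x : ℝ => L.weierstrassP (ω * x + z₀)) x :=
    ContinuousAt.comp (f := fun x : ℝ => ω * (x : ℂ) + z₀) (g := L.weierstrassP)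
      (analyticAt_weierstrassP L (hz x)).continuousAt (by fun_prop)
  exact continuousAt_const.mul h1

lemma hasDerivAt_line (ω z₀ : ℂ) (x : ℝ) : HasDerivAt (fun x : ℝ => ω * (x : ℂ) + z₀) ω x := by
  simpa using ((hasDerivAt_id x).ofReal_comp.const_mul ω).add_const z₀

lemma IsLameSolution.hasDerivAt {L : PeriodPair} {m : ℕ} {E : ℂ} {ψ : ℂ → ℂ}
    (h : IsLameSolution L m E ψ) {z : ℂ} (hz : z ∉ L.lattice) : HasDerivAt ψ (deriv ψ z) z := by
  have ho : IsOpen ((L.lattice : Set ℂ)ᶜ) := isOpen_compl_lattice L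
  exact (h.1.differentiableAt (ho.mem_nhds hz)).hasDerivAt

lemma IsLameSolution.hasDerivAt_deriv {L : PeriodPair} {m : ℕ} {E : ℂ} {ψ : ℂ → ℂ}
    (h : IsLameSolution L m E ψ) {z : ℂ} (hz : z ∉ L.lattice) :
    HasDerivAt (deriv ψ) (((m * (m + 1) : ℂ) * L.weierstrassP z - E) * ψ z) z := by
  have ho : IsOpen ((L.lattice : Set ℂ)ᶜ) := isOpen_compl_lattice L
  have h1 := ((h.1.deriv ho).differentiableAt (ho.mem_nhds hz)).hasDerivAt
  refine h1.congr_deriv ?_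
  linear_combination -(h.2 z hz)

/-- Restricting a solution of the Lamé equation to the line `ω x + z₀`. -/
lemma IsLameSolution.hasDerivAt_restrict {L : PeriodPair} {m : ℕ} {c ω z₀ : ℂ} {ψ : ℂ → ℂ}
    (h : IsLameSolution L m (c / ω ^ 2) ψ) (hω : ω ≠ 0) (hz : IsAdmissibleShift L ω z₀) :
    (∀ x : ℝ, HasDerivAt (fun x : ℝ => ψ (ω * x + z₀)) (ω * deriv ψ (ω * x + z₀)) x) ∧
    ∀ x : ℝ, HasDerivAt (fun x : ℝ => ω * deriv ψ (ω * x + z₀))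
      ((lamePotential L m ω z₀ x - c) * ψ (ω * x + z₀)) x := by
  refine ⟨fun x => ?_, fun x => ?_⟩
  · have := (h.hasDerivAt (hz x)).comp x (hasDerivAt_line ω z₀ x)
    exact this.congr_deriv (mul_comm _ _)
  · have := ((h.hasDerivAt_deriv (hz x)).comp x (hasDerivAt_line ω z₀ x)).const_mul ω
    refine this.congr_deriv ?_
    rw [lamePotential]
    field_simp

lemma deriv_add_of_multiplier {L : PeriodPair} {ψ : ℂ → ℂ} {ρ p : ℂ}
    (h : ∀ z ∉ L.lattice, ψ (z + p) = ρ * ψ z) {z : ℂ} (hz : z ∉ L.lattice) :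
    deriv ψ (z + p) = ρ * deriv ψ z := by
  have ho : IsOpen ((L.lattice : Set ℂ)ᶜ) := isOpen_compl_lattice L
  have he : (fun w => ψ (w + p)) =ᶠ[𝓝 z] fun w => ρ * ψ w := by
    filter_upwards [ho.mem_nhds hz] with w hw using h w hw
  have := he.deriv_eq
  rwa [deriv_comp_add_const, deriv_const_mul_field] at this

/-- Guarantees that the bounded solution on the line is not identically zero. -/
lemma exists_line_ne_zero {ψ : ℂ → ℂ} {ω z₀ : ℂ} (hω : ω ≠ 0) (h : ∀ᶠ w in 𝓝[≠] z₀, ψ w ≠ 0) :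
    ∃ x : ℝ, ψ (ω * x + z₀) ≠ 0 := by
  have ht : Tendsto (fun x : ℝ => ω * (x : ℂ) + z₀) (𝓝[≠] 0) (𝓝[≠] z₀) := by
    refine tendsto_nhdsWithin_iff.2 ⟨?_, ?_⟩
    · refine tendsto_nhdsWithin_of_tendsto_nhds ?_
      have : ContinuousAt (fun x : ℝ => ω * (x : ℂ) + z₀) 0 := by fun_prop
      simpa [ContinuousAt] using this
    · filter_upwards [self_mem_nhdsWithin] with x hx
      simpa using ⟨hω, hx⟩
  exact (ht.eventually h).exists

/-- The spectrum of the Lamé operator in terms of Hermite's parameters. -/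
theorem mem_lameSpectrum_iff (L : PeriodPair) {m : ℕ} (hm : 1 ≤ m) {ω : ℂ} (hω : ω ≠ 0)
    (h2ω : 2 * ω ∈ L.lattice) {z₀ : ℂ} (hz : IsAdmissibleShift L ω z₀) {c : ℂ} {k : Fin m → ℂ}
    (hk : IsHermiteParameters L m (c / ω ^ 2) k) :
    c ∈ lameSpectrum L m ω z₀ ↔ (hermiteExponent L ω k).re = 0 := by
  obtain ⟨ψ₁, ψ₂, C, h₁, h₂, hC, hp₁, hp₂, hne, hC0⟩ := hk.exists_multiplier hm h2ω
  set f := hermiteExponent L ω k with hf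
  obtain ⟨d₁, d₁'⟩ := h₁.hasDerivAt_restrict hω hz
  obtain ⟨d₂, d₂'⟩ := h₂.hasDerivAt_restrict hω hz
  have hV := continuous_lamePotential L m hz
  have hshift : ∀ x : ℝ, ω * ((x + 2 : ℝ) : ℂ) + z₀ = ω * x + z₀ + 2 * ω := fun x => by
    push_cast
    ring
  have hnorm : ‖Complex.exp (2 * f)‖ = Real.exp (2 * f.re) := by
    rw [Complex.norm_exp]
    simp
  constructor
  · intro hmem
    by_contra hre
    refine notMem_spectrum_of_multiplier hV d₁ d₁' d₂ d₂' (W := ω * C) (ρ := Complex.exp (2 * f))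
      (mul_ne_zero hω fun h0 => hre (hC0 h0)) (fun x => ?_) (Complex.exp_ne_zero _) ?_ (fun x => ?_)
      (fun x => ?_) hmem
    · rw [← hC _ (hz x)]
      ring
    · rw [hnorm, ne_eq, Real.exp_eq_one_iff]
      simpa using hre
    · rw [hshift, hp₁ _ (hz x)]
    · rw [hshift, hp₂ _ (hz x), Complex.exp_neg]
  · intro hre
    -- A multiplier of modulus one is the growth rate `α = 0`, so the exponential bounds become
    -- plain bounds for the solution and its derivative.
    have hρ : ‖Complex.exp (2 * f)‖ = Real.exp (2 * 0) := by rw [hnorm, hre]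
    have hc₁ : Continuous fun x : ℝ => ψ₁ (ω * x + z₀) :=
      continuous_iff_continuousAt.2 fun x => (d₁ x).continuousAt
    have hc₁' : Continuous fun x : ℝ => ω * deriv ψ₁ (ω * x + z₀) :=
      continuous_iff_continuousAt.2 fun x => (d₁' x).continuousAt
    obtain ⟨A, -, hA⟩ := exists_norm_le_mul_exp hc₁ hρ fun x => by rw [hshift, hp₁ _ (hz x)]
    obtain ⟨A', -, hA'⟩ := exists_norm_le_mul_exp hc₁' hρ fun x => by
      rw [hshift, deriv_add_of_multiplier hp₁ (hz x)]
      ring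
    have hz0 : z₀ ∉ L.lattice := by simpa using hz 0
    obtain ⟨x₀, hx₀⟩ := exists_line_ne_zero hω (hne z₀ hz0)
    simp only [zero_mul, Real.exp_zero, mul_one] at hA hA'
    exact mem_spectrum_of_bounded_solution hV d₁ d₁' (fun x => (hA x).trans (le_max_left A A'))
      (fun x => (hA' x).trans (le_max_right A A')) hx₀

end Lame

theorem proposition3p1 (L : PeriodPair) (m : ℕ) (hm : 1 ≤ m) (ω : ℂ) (hω : ω ≠ 0)
    (h2ω : 2 * ω ∈ L.lattice) :
    (∀ z₀ z₁ : ℂ, Lame.IsAdmissibleShift L ω z₀ → Lame.IsAdmissibleShift L ω z₁ →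
      Lame.lameSpectrum L m ω z₀ = Lame.lameSpectrum L m ω z₁) ∧
    (∀ E : ℂ, ∃ k : Fin m → ℂ, Lame.IsHermiteParameters L m E k) ∧
    (∀ z₀ : ℂ, Lame.IsAdmissibleShift L ω z₀ →
      ∀ (c : ℂ) (k : Fin m → ℂ), Lame.IsHermiteParameters L m (c / ω ^ 2) k →
        (c ∈ Lame.lameSpectrum L m ω z₀ ↔ (Lame.hermiteExponent L ω k).re = 0)) := by
  refine ⟨fun z₀ z₁ h₀ h₁ => ?_, Lame.exists_isHermiteParameters L hm, fun z₀ h₀ c k hk =>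
    Lame.mem_lameSpectrum_iff L hm hω h2ω h₀ hk⟩
  -- The criterion in terms of one and the same `k` does not involve the shift.
  ext c
  obtain ⟨k, hk⟩ := Lame.exists_isHermiteParameters L hm (c / ω ^ 2)
  rw [Lame.mem_lameSpectrum_iff L hm hω h2ω h₀ hk, Lame.mem_lameSpectrum_iff L hm hω h2ω h₁ hk]
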